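/- Let $d\ge 2$ and $k\ge 2$ be integers and $w>0$ real. Let $\mathbb{T}_d$ be the infinite $(d+1)$-regular tree with vertex set $V_d$, and let $\Omega_{k,d}=\{\psi:V_d\to[k]\}$, $[k]=\{1,\dots,k\}$, carry the $\sigma$-algebra generated by the cylinder sets $\{\psi : \psi\restriction_U=\phi\}$ with $U\subset V_d$ finite and $\phi:U\to[k]$. For $U\subset V_d$ let $\partial U$ be the set of vertices of $U$ adjacent to some vertex of $V_d\setminus U$, and $U^\circ=U\setminus\partial U$. For a finite set $U$ and a colouring $\sigma:U\to[k]$ let $m(\sigma)$ be the number of monochromatic edges of $\sigma$ in the induced finite graph $\mathbb{T}_d[U]$. A probability measure $\mu$ on $\Omega_{k,d}$ is called a Gibbs measure of the $k$-state Potts model with parameter $w$ on $\mathbb{T}_d$ if for every finite set $U\subset V_d$ and $\mu$-almost every $\phi\in\Omega_{k,d}$ $$\Pr_{\mathbf\Phi\sim\mu}\bigl[\mathbf\Phi\restriction_U=\phi\restriction_U \,\big|\, \mathbf\Phi\restriction_{V_d\setminus U^\circ}=\phi\restriction_{V_d\setminus U^\circ}\bigr]=\frac{w^{m(\phi\restriction_U)}}{\sum_{\sigma}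 w^{m(\sigma)}},$$ where the sum is over all $\sigma:U\to[k]$ with $\sigma\restriction_{\partial U}=\phi\restriction_{\partial U}$, and the left-hand side is understood through conditional expectation with respect to the $\sigma$-algebra generated by the colours of the vertices in $V_d\setminus U^\circ$. Theorem. Let $k=3$ and $d\ge 2$, or $k=4$ and $d\ge 4$, and let $0<w<1$ with $w\ge 1-\frac{k}{d+1}$. Then the $k$-state Potts model with parameter $w$ on $\mathbb{T}_d$ has a unique Gibbs measure, i.e. exactly one probability measure on $\Omega_{k,d}$ is a Gibbs measure. -/

import Mathlib

open MeasureTheory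

namespace Potts

/-! ### The infinite `(d+1)`-regular tree -/

/-- Vertices of the infinite `(d+1)`-regular tree, rooted at `none`. The root has the `d + 1`
children `some (i, [])`, and every other vertex `some (i, l)` has the `d` children
`some (i, j :: l)`. -/
abbrev TreeVertex (d : ℕ) : Type := Option (Fin (d + 1) × List (Fin d))

/-- `IsChild u v`: the vertex `v` is a child of the vertex `u`. -/
inductive IsChild {d : ℕ} : TreeVertex d → TreeVertex d → Prop
  | root (i : Fin (d + 1)) : IsChild none (some (i, []))
  | step (i : Fin (d + 1)) (l : List (Fin d)) (j : Fin d) :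
      IsChild (some (i, l)) (some (i, j :: l))

/-- The infinite `(d+1)`-regular tree `𝕋_d`: adjacency is "one vertex is a child of the other". -/
def regularTree (d : ℕ) : SimpleGraph (TreeVertex d) := SimpleGraph.fromRel IsChild

theorem IsChild.ne {d : ℕ} {u v : TreeVertex d} (h : IsChild u v) : u ≠ v := by
  cases h <;> simp

theorem regularTree_adj {d : ℕ} {u v : TreeVertex d} :
    (regularTree d).Adj u v ↔ IsChild u v ∨ IsChild v u := by
  rw [regularTree, SimpleGraph.fromRel_adj]
  refine ⟨fun h => h.2, fun h => ⟨?_, h⟩⟩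
  rcases h with h | h
  · exact h.ne
  · exact h.ne.symm

/-- The graph `regularTree d` is a tree. -/
theorem regularTree_isTree (d : ℕ) : (regularTree d).IsTree := by
  constructor
  · have key : ∀ v : TreeVertex d, (regularTree d).Reachable none v := by
      rintro (_ | ⟨i, l⟩)
      · exact SimpleGraph.Reachable.refl _
      · induction l with
        | nil => exact (regularTree_adj.2 (Or.inl (IsChild.root i))).reachable
        | cons j l ih =>
          exact ih.trans (regularTree_adj.2 (Or.inl (IsChild.step i l j))).reachable
    exact SimpleGraph.Connected.mk fun u v => (key u).symm.trans (key v)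
  · -- an edge from `p` to its child `c` is a bridge: it is the only edge leaving the branch at `c`
    have key : ∀ p c : TreeVertex d, IsChild p c →
        ¬ ((regularTree d).deleteEdges {s(p, c)}).Reachable p c := by
      intro p c hpc
      obtain ⟨i, l, hc⟩ : ∃ i l, c = some (i, l) := by
        cases hpc <;> exact ⟨_, _, rfl⟩
      let D : TreeVertex d → Prop := fun x => ∃ l', x = some (i, l') ∧ l <:+ l'
      have hstep : ∀ u v, IsChild u v → s(u, v) ≠ s(p, c) → (D u ↔ D v) := by
        intro u v huv hne
        cases huv with
        | root i' =>
          constructor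
          · rintro ⟨l', h, _⟩
            simp at h
          · rintro ⟨l', h, hl⟩
            simp only [Option.some.injEq, Prod.mk.injEq] at h
            obtain ⟨rfl, rfl⟩ := h
            rw [List.suffix_nil] at hl
            subst hl hc
            cases hpc
            exact absurd rfl hne
        | step i' l' j =>
          constructor
          · rintro ⟨l'', h, hl⟩
            simp only [Option.some.injEq, Prod.mk.injEq] at h
            obtain ⟨rfl, rfl⟩ := h
            exact ⟨_, rfl, hl.trans (List.suffix_cons _ _)⟩
          · rintro ⟨l'', h, hl⟩
            simp only [Option.some.injEq, Prod.mk.injEq] at h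
            obtain ⟨rfl, rfl⟩ := h
            rcases List.suffix_cons_iff.1 hl with hl | hl
            · subst hl hc
              cases hpc
              exact absurd rfl hne
            · exact ⟨_, rfl, hl⟩
      have hwalk : ∀ u v, ((regularTree d).deleteEdges {s(p, c)}).Walk u v → (D u ↔ D v) := by
        intro u v q
        induction q with
        | nil => exact Iff.rfl
        | cons h _ ih =>
          rw [SimpleGraph.deleteEdges_adj, regularTree_adj] at h
          obtain ⟨h | h, hne⟩ := h
          · exact (hstep _ _ h hne).trans ih
          · exact (hstep _ _ h (by rwa [Sym2.eq_swap])).symm.trans ih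
      rintro ⟨q⟩
      have hDp : D p := (hwalk _ _ q).2 ⟨l, hc, List.suffix_refl l⟩
      obtain ⟨l', hp, hl⟩ := hDp
      subst hp hc
      cases hpc
      have := hl.length_le
      simp at this
    rw [SimpleGraph.isAcyclic_iff_forall_adj_isBridge]
    intro u v huv
    rw [SimpleGraph.isBridge_iff]
    rcases regularTree_adj.1 huv with h | h
    · exact key _ _ h
    · intro hr
      rw [Sym2.eq_swap] at hr
      exact key _ _ h hr.symm

/-- Every vertex of `regularTree d` has exactly `d + 1` neighbours. -/
theorem regularTree_regular (d : ℕ) (v : TreeVertex d) :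
    ((regularTree d).neighborSet v).ncard = d + 1 := by
  rcases v with _ | ⟨i, l⟩
  · have : (regularTree d).neighborSet none =
        Set.range (fun i : Fin (d + 1) => (some (i, []) : TreeVertex d)) := by
      ext x
      simp only [SimpleGraph.mem_neighborSet, regularTree_adj, Set.mem_range]
      constructor
      · rintro (h | h)
        · cases h; exact ⟨_, rfl⟩
        · cases h
      · rintro ⟨i, rfl⟩
        exact Or.inl (IsChild.root i)
    rw [this, ← Set.image_univ, Set.ncard_image_of_injective _ (fun a b h => by simpa using h),
      Set.ncard_univ, Nat.card_fin]
  · obtain ⟨p, hp, hp', huniq⟩ : ∃ p : TreeVertex d, IsChild p (some (i, l)) ∧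
        (∀ j : Fin d, (some (i, j :: l) : TreeVertex d) ≠ p) ∧
        ∀ q, IsChild q (some (i, l)) → q = p := by
      cases l with
      | nil => exact ⟨none, IsChild.root i, by simp, fun q hq => by cases hq; rfl⟩
      | cons j l =>
        refine ⟨some (i, l), IsChild.step i l j, fun j' h => ?_, fun q hq => by cases hq; rfl⟩
        simp only [Option.some.injEq, Prod.mk.injEq, true_and] at h
        have := congrArg List.length h
        simp only [List.length_cons] at this
        omega
    have : (regularTree d).neighborSet (some (i, l)) =
        insert p (Set.range (fun j : Fin d => (some (i, j :: l) : TreeVertex d))) := by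
      ext x
      simp only [SimpleGraph.mem_neighborSet, regularTree_adj, Set.mem_range, Set.mem_insert_iff]
      constructor
      · rintro (h | h)
        · cases h; exact Or.inr ⟨_, rfl⟩
        · exact Or.inl (huniq _ h)
      · rintro (rfl | ⟨j, rfl⟩)
        · exact Or.inr hp
        · exact Or.inl (IsChild.step i l j)
    rw [this, Set.ncard_insert_of_notMem (by rintro ⟨j, hj⟩; exact hp' j hj) (Set.toFinite _),
      ← Set.image_univ, Set.ncard_image_of_injective _ (fun a b h => by simpa using h),
      Set.ncard_univ, Nat.card_fin]

/-! ### The Potts model on a finite graph -/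

/-- The weight `w ^ m(σ)` of a `k`-colouring `σ` of a finite graph `G`, where `m(σ)` is the number
of monochromatic edges. -/
noncomputable def weight {W : Type*} [Finite W] (G : SimpleGraph W) {k : ℕ} (w : ℝ)
    (σ : W → Fin k) : ℝ :=
  w ^ {e ∈ G.edgeSet | (e.map σ).IsDiag}.ncard

open Classical in
/-- The probability of the colouring `φ` of a finite graph `G` in the `k`-state Potts model with
parameter `w`, conditioned on the event of being equal to `φ` on `B`. -/
noncomputable def condProb {W : Type*} [Fintype W] (G : SimpleGraph W) {k : ℕ} (w : ℝ) (B : Set W)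
    (φ : W → Fin k) : ℝ :=
  weight G w φ / ∑ σ : W → Fin k with (∀ v ∈ B, σ v = φ v), weight G w σ

/-! ### Gibbs measures on the tree -/

/-- Configurations `V_d → [k]`. As a measurable space it carries the product `σ`-algebra, i.e. the
one generated by the cylinder sets fixing the colours of finitely many vertices. -/
abbrev Config (k d : ℕ) : Type := TreeVertex d → Fin k

/-- The boundary `∂U`: vertices of `U` adjacent to some vertex outside `U`. -/
def boundary {V : Type*} (G : SimpleGraph V) (U : Set V) : Set V :=
  {v ∈ U | ∃ u, u ∉ U ∧ G.Adj v u}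

/-- The interior `U° = U \ ∂U`. -/
def interior {V : Type*} (G : SimpleGraph V) (U : Set V) : Set V :=
  U \ boundary G U

/-- `μ` is a Gibbs measure of the `k`-state Potts model with parameter `w` on the infinite
`(d+1)`-regular tree: it is a probability measure, and for every finite set `U` of vertices and
`μ`-almost every `φ`, the conditional probability that the configuration equals `φ` on `U`, given
that it equals `φ` outside the interior of `U`, is the probability of `φ|_U` in the Potts
model on the induced finite graph on `U` conditioned on the colours of `∂U`. -/
structure IsGibbs (k d : ℕ) (w : ℝ) (μ : Measure (Config k d)) : Prop where
  isProbabilityMeasure : IsProbabilityMeasure μ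
  gibbs : ∀ U : Finset (TreeVertex d), ∀ᵐ φ ∂μ,
    (μ[Set.indicator {ψ : Config k d | ∀ v ∈ U, ψ v = φ v} (fun _ => (1 : ℝ)) |
        cylinderEvents (X := fun _ : TreeVertex d => Fin k)
          (interior (regularTree d) (U : Set (TreeVertex d)))ᶜ]) φ =
      condProb ((regularTree d).induce (U : Set (TreeVertex d))) w
        (Subtype.val ⁻¹' boundary (regularTree d) (U : Set (TreeVertex d)))
        (fun v => φ v)

end Potts

namespace Potts

/-! ### Calculus: the logarithmic inequalities behind the two-step contraction -/

/-! Put `a = 1 - w`, so that `a * (d + 1) ≤ k`. Summing out the descendants of a vertex gives a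
vector of `k` partition functions, and these vectors obey `z i = ∏ l, (∑ c, y l c - a * y l i)`
(`treeStep`). Uniqueness follows once `n` steps of this recursion, from any boundary condition,
force all ratios of entries towards `1` as `n` grows (`exists_reach_subset_ratioSet`): every Gibbs
measure then gives each ball the free Potts weights (`IsGibbs.measureReal_ball`). Existence is
explicit, by broadcasting independent increments from the root.

One step need not contract ratios, so two steps are taken together (`treeStep_treeStep_mem`). Mixing
the input with the uniform vector replaces `a` by the critical value `k / (d + 1)`. If the inputs
have ratios at most `T ^ 2`, the claim is that the critical factors `(d + 1) * ∑ z - k * z i` formed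
from the output `z` of the first step have ratios at most `ratioNum / ratioDen`, the value for the
vector `z` with one entry `1`, one entry `T ^ 2` and all others `T`. The second step raises this to
the power `d`, and the result is at most `T ^ 2` (`contractRatio_le`).

The claim is a linear inequality in `z`, hence multilinear in the inputs, so inputs with entries in
`{1, T ^ 2}` suffice. There the inequality compares products, and the tangent bound `1 + s ≤ exp s`
with suitable weights (`HasWeights`) splits it into one logarithmic inequality per child. Two
choices of weights are used: tangency at the extremal vector when `eCoef ≤ qCoef`, equal weights
otherwise. The resulting inequalities in `T` and `d` are proved by differentiation and reduce to
polynomials with nonnegative coefficients.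

The case `k = 3`, `d = 2` is borderline: the weights work only for bounded `T`, so a separate
argument first bounds the ratios, and strict contraction comes only from the mixing, since `a < 1 =
k / (d + 1)`. -/

theorem le_of_hasDerivAt_nonneg {f f' : ℝ → ℝ} {a : ℝ}
    (hf : ∀ x, a ≤ x → HasDerivAt f (f' x) x) (hf' : ∀ x, a ≤ x → 0 ≤ f' x) {x : ℝ}
    (hx : a ≤ x) : f a ≤ f x := by
  have hmono : MonotoneOn f (Set.Ici a) := by
    apply monotoneOn_of_deriv_nonneg (convex_Ici a)
    · exact fun y hy => (hf y hy).continuousAt.continuousWithinAt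
    · intro y hy
      rw [interior_Ici] at hy
      exact (hf y (le_of_lt hy)).differentiableAt.differentiableWithinAt
    · intro y hy
      rw [interior_Ici] at hy
      rw [(hf y (le_of_lt hy)).deriv]
      exact hf' y (le_of_lt hy)
  exact hmono Set.self_mem_Ici hx hx

theorem lt_of_hasDerivAt_pos {f f' : ℝ → ℝ} {a : ℝ}
    (hf : ∀ x, a ≤ x → HasDerivAt f (f' x) x) (hf' : ∀ x, a < x → 0 < f' x) {x : ℝ}
    (hx : a < x) : f a < f x := by
  have hmono : StrictMonoOn f (Set.Ici a) := by
    apply strictMonoOn_of_deriv_pos (convex_Ici a)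
    · exact fun y hy => (hf y hy).continuousAt.continuousWithinAt
    · intro y hy
      rw [interior_Ici] at hy
      rw [(hf y (le_of_lt hy)).deriv]
      exact hf' y hy
  exact hmono Set.self_mem_Ici (le_of_lt hx) hx

/-- This and the next bound are accurate to second order at `1`. They remove the logarithm that
survives in a derivative; the sign of its coefficient decides which of the two is needed. -/
theorem two_mul_sub_div_add_le_log {T : ℝ} (hT : 1 ≤ T) :
    2 * (T - 1) / (T + 1) ≤ Real.log T := by
  have h := le_of_hasDerivAt_nonneg (a := 1) (f := fun x => Real.log x - 2 * (x - 1) / (x + 1))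
    (f' := fun x => 1 / x - (2 * (x + 1) - 2 * (x - 1) * 1) / (x + 1) ^ 2) ?_ ?_ hT
  · simp at h
    linarith
  · intro x hx
    have h1 : HasDerivAt (fun x : ℝ => 2 * (x - 1)) 2 x := by
      simpa using ((hasDerivAt_id x).sub_const 1).const_mul 2
    have h2 : HasDerivAt (fun x : ℝ => x + 1) 1 x := (hasDerivAt_id x).add_const 1
    exact ((Real.hasDerivAt_log (by linarith : x ≠ 0)).sub (h1.div h2 (by linarith))).congr_deriv
      (by rw [one_div])
  · intro x hx
    have : 1 / x - (2 * (x + 1) - 2 * (x - 1) * 1) / (x + 1) ^ 2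
        = (x - 1) ^ 2 / (x * (x + 1) ^ 2) := by
      have : x + 1 ≠ 0 := by linarith
      have : x ≠ 0 := by linarith
      field_simp
      ring
    rw [this]
    positivity

theorem log_le_sq_sub_one_div {T : ℝ} (hT : 1 ≤ T) :
    Real.log T ≤ (T ^ 2 - 1) / (2 * T) := by
  have h := le_of_hasDerivAt_nonneg (a := 1) (f := fun x => (x ^ 2 - 1) / (2 * x) - Real.log x)
    (f' := fun x => ((2 * x) * (2 * x) - (x ^ 2 - 1) * 2) / (2 * x) ^ 2 - 1 / x) ?_ ?_ hT
  · simp at h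
    linarith
  · intro x hx
    have h1 : HasDerivAt (fun x : ℝ => x ^ 2 - 1) (2 * x) x := by
      simpa using (hasDerivAt_pow 2 x).sub_const 1
    have h2 : HasDerivAt (fun x : ℝ => 2 * x) 2 x := by
      simpa using (hasDerivAt_id x).const_mul 2
    exact ((h1.div h2 (by linarith)).sub (Real.hasDerivAt_log (by linarith : x ≠ 0))).congr_deriv
      (by rw [one_div])
  · intro x hx
    have : ((2 * x) * (2 * x) - (x ^ 2 - 1) * 2) / (2 * x) ^ 2 - 1 / x
        = (x - 1) ^ 2 / (2 * x ^ 2) := by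
      have : x ≠ 0 := by linarith
      field_simp
      ring
    rw [this]
    positivity

/-- The value of `(d + 1) * S - k` when `m` of the `k` entries are `T ^ 2`, the others `1`, and
`S` is their sum. -/
noncomputable def hiFactor (k m d T : ℝ) : ℝ := d * (m * T ^ 2 + (k - m)) + m * (T ^ 2 - 1)

/-- The value of `(d + 1) * S - k * T ^ 2` when `m` of the `k` entries are `T ^ 2`, the others `1`,
and `S` is their sum. -/
noncomputable def loFactor (k m d T : ℝ) : ℝ := d * (m * T ^ 2 + (k - m)) - (k - m) * (T ^ 2 - 1)

/-- `d` times the logarithmic ratio of `hiFactor` and `loFactor`. -/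
noncomputable def logGap (k m d T : ℝ) : ℝ :=
  d * (Real.log (hiFactor k m d T) - Real.log (loFactor k m d T))

/-- The contraction inequality for colours `i` and `j`, divided by `k`, has coefficient `T * qCoef`
at `z i`, `-tCoef` at `z j` and `eCoef` at every other colour (`sum_formCoef_eq_ratio`). -/
noncomputable def qCoef (k d T : ℝ) : ℝ := (2 * (d + 1) - k) * T + (k - 2) * (d + 1)

noncomputable def eCoef (d T : ℝ) : ℝ := (d + 1) * (T ^ 2 - 1)

noncomputable def tCoef (k d T : ℝ) : ℝ := (k - 2) * (d + 1) * T + 2 * (d + 1) - k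

theorem hiFactor_pos {k m d T : ℝ} (hd : 0 < d) (hm : 1 ≤ m) (hmk : m ≤ k) (hT : 1 ≤ T) :
    0 < hiFactor k m d T := by
  have : 1 ≤ T ^ 2 := one_le_pow₀ hT
  have h1 : 0 < m * T ^ 2 := by positivity
  have h2 : 0 ≤ m * (T ^ 2 - 1) := mul_nonneg (by linarith) (by linarith)
  have h3 : 0 < m * T ^ 2 + (k - m) := by linarith
  unfold hiFactor
  positivity

theorem loFactor_pos {k m d T : ℝ} (hd : 0 < d) (hkd : k - 1 ≤ d) (hm : 1 ≤ m) (hmk : m ≤ k)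
    (hT : 1 ≤ T) : 0 < loFactor k m d T := by
  have h1 : 1 ≤ T ^ 2 := one_le_pow₀ hT
  have h2 : 0 ≤ (d * m - (k - m)) * (T ^ 2 - 1) :=
    mul_nonneg (by nlinarith) (by linarith)
  have h3 : loFactor k m d T = (d * m - (k - m)) * (T ^ 2 - 1) + d * k := by
    unfold loFactor; ring
  have h4 : 0 < d * k := mul_pos hd (by linarith)
  linarith

/-- Both factors are affine in `T ^ 2`, so the numerator of the logarithmic derivative is `2 * T`
times a determinant, which is `k ^ 2 * d` for every `m`. -/
theorem hasDerivAt_logGap {k m d T : ℝ} (hhi : 0 < hiFactor k m d T)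
    (hlo : 0 < loFactor k m d T) :
    HasDerivAt (logGap k m d)
      (2 * k ^ 2 * d ^ 2 * T / (hiFactor k m d T * loFactor k m d T)) T := by
  have hsq : HasDerivAt (fun x : ℝ => x ^ 2) (2 * T) T := by
    simpa using hasDerivAt_pow 2 T
  have h1 : HasDerivAt (hiFactor k m d) (d * (m * (2 * T)) + m * (2 * T)) T :=
    (((hsq.const_mul m).add_const (k - m)).const_mul d).add ((hsq.sub_const 1).const_mul m)
  have h2 : HasDerivAt (loFactor k m d) (d * (m * (2 * T)) - (k - m) * (2 * T)) T :=
    (((hsq.const_mul m).add_const (k - m)).const_mul d).sub ((hsq.sub_const 1).const_mul (k - m))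
  have h3 := ((h1.log hhi.ne').sub (h2.log hlo.ne')).const_mul d
  refine h3.congr_deriv ?_
  have e1 := hhi.ne'
  have e2 := hlo.ne'
  field_simp
  unfold hiFactor loFactor
  ring

theorem logGap_one {k m d : ℝ} : logGap k m d 1 = 0 := by
  simp [logGap, hiFactor, loFactor]

theorem hasDerivAt_qCoef {k d T : ℝ} : HasDerivAt (qCoef k d) (2 * (d + 1) - k) T := by
  exact (((hasDerivAt_id T).const_mul (2 * (d + 1) - k)).add_const ((k - 2) * (d + 1))).congr_deriv
    (mul_one _)

theorem hasDerivAt_eCoef {d T : ℝ} : HasDerivAt (eCoef d) ((d + 1) * (2 * T)) T := by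
  have hsq : HasDerivAt (fun x : ℝ => x ^ 2) (2 * T) T := by
    simpa using hasDerivAt_pow 2 T
  exact (hsq.sub_const 1).const_mul (d + 1)

theorem hasDerivAt_tCoef {k d T : ℝ} : HasDerivAt (tCoef k d) ((k - 2) * (d + 1)) T := by
  exact ((((hasDerivAt_id T).const_mul ((k - 2) * (d + 1))).add_const (2 * (d + 1))).sub_const
    k).congr_deriv (mul_one _)

theorem qCoef_pos {k d T : ℝ} (hk : 2 ≤ k) (hd : 0 < d) (hkd : k - 1 ≤ d) (hT : 1 ≤ T) :
    0 < qCoef k d T := by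
  unfold qCoef
  have h1 : 0 < (2 * (d + 1) - k) * T := mul_pos (by linarith) (by linarith)
  have h2 : 0 ≤ (k - 2) * (d + 1) := mul_nonneg (by linarith) (by linarith)
  linarith

theorem eCoef_nonneg {d T : ℝ} (hd : 0 < d) (hT : 1 ≤ T) : 0 ≤ eCoef d T :=
  mul_nonneg (by linarith) (by nlinarith)

theorem eCoef_pos {d T : ℝ} (hd : 0 < d) (hT : 1 < T) : 0 < eCoef d T :=
  mul_pos (by linarith) (by nlinarith)

theorem tCoef_pos {k d T : ℝ} (hk : 2 ≤ k) (hd : 0 < d) (hkd : k - 1 ≤ d) (hT : 1 ≤ T) :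
    0 < tCoef k d T := by
  unfold tCoef
  have h2 : 0 ≤ (k - 2) * (d + 1) * T :=
    mul_nonneg (mul_nonneg (by linarith) (by linarith)) (by linarith)
  linarith

/-- Expresses that the linear inequality is an equality at the extremal vector with `z i = 1`, `z j
= T ^ 2` and all other entries `T`. -/
theorem mul_tCoef (k d T : ℝ) : T * tCoef k d T = qCoef k d T + (k - 2) * eCoef d T := by
  unfold tCoef qCoef eCoef; ring

/-- Derivative criterion for the bound on `logGap k 1 d`. -/
theorem qCoef_mul_logGap_one_le {k d : ℝ} (hk : 2 ≤ k) (hd : 0 < d) (hkd : k - 1 ≤ d)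
    (key : ∀ T : ℝ, 1 ≤ T → 0 ≤
      (k - 2) * ((d + 1) * (2 * T) * qCoef k d T - eCoef d T * (2 * (d + 1) - k)) * 2 * (T - 1) * T
          * (hiFactor k 1 d T * loFactor k 1 d T)
        + (2 * qCoef k d T + (k - 2) * eCoef d T) * qCoef k d T * (T + 1)
          * (hiFactor k 1 d T * loFactor k 1 d T)
        - 2 * k ^ 2 * d ^ 2 * T ^ 2 * (T + 1) * qCoef k d T ^ 2)
    (key' : ∀ T : ℝ, 1 ≤ T →
      0 ≤ (d + 1) * (2 * T) * qCoef k d T - eCoef d T * (2 * (d + 1) - k))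
    {T : ℝ} (hT : 1 ≤ T) :
    qCoef k d T * logGap k 1 d T ≤ (2 * qCoef k d T + (k - 2) * eCoef d T) * Real.log T := by
  -- Dividing by `qCoef` leaves `logGap` bare, so its derivative is rational. Only one logarithm
  -- survives, with nonnegative coefficient by `key'`, so the lower bound for `log` applies.
  have h := le_of_hasDerivAt_nonneg (a := 1)
    (f := fun x => (2 + (k - 2) * (eCoef d x / qCoef k d x)) * Real.log x - logGap k 1 d x)
    (f' := fun x => (k - 2) * (((d + 1) * (2 * x) * qCoef k d x - eCoef d x * (2 * (d + 1) - k))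
      / qCoef k d x ^ 2) * Real.log x + (2 + (k - 2) * (eCoef d x / qCoef k d x)) * x⁻¹
      - 2 * k ^ 2 * d ^ 2 * x / (hiFactor k 1 d x * loFactor k 1 d x)) ?_ ?_ hT
  · simp only [Real.log_one, mul_zero, logGap_one, sub_zero] at h
    have hq := qCoef_pos hk hd hkd hT
    have h2 := mul_nonneg hq.le h
    have h3 : qCoef k d T * ((2 + (k - 2) * (eCoef d T / qCoef k d T)) * Real.log T
        - logGap k 1 d T) = (2 * qCoef k d T + (k - 2) * eCoef d T) * Real.log T
        - qCoef k d T * logGap k 1 d T := by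
      field_simp
    linarith
  · intro x hx
    have hq := qCoef_pos hk hd hkd hx
    have h1 := ((((hasDerivAt_eCoef (d := d) (T := x)).div (hasDerivAt_qCoef (k := k)) hq.ne').const_mul
      (k - 2)).const_add 2).mul (Real.hasDerivAt_log (by linarith : x ≠ 0))
    exact h1.sub (hasDerivAt_logGap (hiFactor_pos hd le_rfl (by linarith) hx)
      (loFactor_pos hd hkd le_rfl (by linarith) hx))
  · intro x hx
    have hq := qCoef_pos hk hd hkd hx
    have hhi := hiFactor_pos (k := k) (m := 1) hd le_rfl (by linarith) hx
    have hlo := loFactor_pos (k := k) (m := 1) hd hkd le_rfl (by linarith) hx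
    have h1 := key x hx
    have h2 : 0 ≤ (k - 2) * (((d + 1) * (2 * x) * qCoef k d x - eCoef d x * (2 * (d + 1) - k))
      / qCoef k d x ^ 2) := mul_nonneg (by linarith) (div_nonneg (key' x hx) (by positivity))
    have h3 := mul_le_mul_of_nonneg_left (two_mul_sub_div_add_le_log hx) h2
    refine le_trans ?_ (sub_le_sub_right (add_le_add_left h3 _) _)
    have hx0 : x ≠ 0 := by linarith
    have hx1 : x + 1 ≠ 0 := by linarith
    have e : (k - 2) * (((d + 1) * (2 * x) * qCoef k d x - eCoef d x * (2 * (d + 1) - k))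
        / qCoef k d x ^ 2) * (2 * (x - 1) / (x + 1)) + (2 + (k - 2) * (eCoef d x / qCoef k d x)) * x⁻¹
        - 2 * k ^ 2 * d ^ 2 * x / (hiFactor k 1 d x * loFactor k 1 d x)
        = ((k - 2) * ((d + 1) * (2 * x) * qCoef k d x - eCoef d x * (2 * (d + 1) - k)) * 2 * (x - 1) * x
          * (hiFactor k 1 d x * loFactor k 1 d x)
        + (2 * qCoef k d x + (k - 2) * eCoef d x) * qCoef k d x * (x + 1)
          * (hiFactor k 1 d x * loFactor k 1 d x)
        - 2 * k ^ 2 * d ^ 2 * x ^ 2 * (x + 1) * qCoef k d x ^ 2)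
          / (qCoef k d x ^ 2 * x * (x + 1) * (hiFactor k 1 d x * loFactor k 1 d x)) := by
      field_simp
    rw [e]
    positivity

/-- Derivative criterion for the bound on `logGap k (k - 1) d`. -/
theorem mul_logGap_pred_le {k d : ℝ} (hk : 2 ≤ k) (hd : 0 < d) (hkd : k - 1 ≤ d)
    (key : ∀ T : ℝ, 1 ≤ T → 0 ≤
      (2 * qCoef k d T + (k - 2) * eCoef d T) * (qCoef k d T + (k - 2) * eCoef d T)
          * (hiFactor k (k - 1) d T * loFactor k (k - 1) d T) * (2 * T)
        + ((2 * (d + 1) - k) * (qCoef k d T + (k - 2) * eCoef d T)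
            - qCoef k d T * (2 * (d + 1) - k + (k - 2) * ((d + 1) * (2 * T)))) * T * (T ^ 2 - 1)
          * (hiFactor k (k - 1) d T * loFactor k (k - 1) d T)
        - 2 * k ^ 2 * d ^ 2 * T ^ 2 * (qCoef k d T + (k - 2) * eCoef d T) ^ 2 * (2 * T))
    (key' : ∀ T : ℝ, 1 ≤ T →
      (2 * (d + 1) - k) * (qCoef k d T + (k - 2) * eCoef d T)
            - qCoef k d T * (2 * (d + 1) - k + (k - 2) * ((d + 1) * (2 * T))) ≤ 0)
    {T : ℝ} (hT : 1 ≤ T) :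
    (qCoef k d T + (k - 2) * eCoef d T) * logGap k (k - 1) d T
      ≤ (2 * qCoef k d T + (k - 2) * eCoef d T) * Real.log T := by
  have hg : ∀ x : ℝ, 1 ≤ x → 0 < qCoef k d x + (k - 2) * eCoef d x := fun x hx =>
    add_pos_of_pos_of_nonneg (qCoef_pos hk hd hkd hx)
      (mul_nonneg (by linarith) (eCoef_nonneg hd hx))
  have h := le_of_hasDerivAt_nonneg (a := 1)
    (f := fun x => (1 + qCoef k d x / (qCoef k d x + (k - 2) * eCoef d x)) * Real.log x
      - logGap k (k - 1) d x)
    (f' := fun x => (((2 * (d + 1) - k) * (qCoef k d x + (k - 2) * eCoef d x)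
            - qCoef k d x * (2 * (d + 1) - k + (k - 2) * ((d + 1) * (2 * x))))
          / (qCoef k d x + (k - 2) * eCoef d x) ^ 2) * Real.log x
      + (1 + qCoef k d x / (qCoef k d x + (k - 2) * eCoef d x)) * x⁻¹
      - 2 * k ^ 2 * d ^ 2 * x / (hiFactor k (k - 1) d x * loFactor k (k - 1) d x)) ?_ ?_ hT
  · simp only [Real.log_one, mul_zero, logGap_one, sub_zero] at h
    have hq := hg T hT
    have h2 := mul_nonneg hq.le h
    have h3 : (qCoef k d T + (k - 2) * eCoef d T) *
        ((1 + qCoef k d T / (qCoef k d T + (k - 2) * eCoef d T)) * Real.log T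
        - logGap k (k - 1) d T) = (2 * qCoef k d T + (k - 2) * eCoef d T) * Real.log T
        - (qCoef k d T + (k - 2) * eCoef d T) * logGap k (k - 1) d T := by
      field_simp
      ring
    linarith
  · intro x hx
    have hq := hg x hx
    have h1 := (((hasDerivAt_qCoef (k := k) (d := d) (T := x)).div
      ((hasDerivAt_qCoef (k := k) (d := d) (T := x)).add (hasDerivAt_eCoef.const_mul (k - 2)))
        hq.ne').const_add 1).mul (Real.hasDerivAt_log (by linarith : x ≠ 0))
    exact h1.sub (hasDerivAt_logGap (hiFactor_pos hd (by linarith) (by linarith) hx)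
      (loFactor_pos hd hkd (by linarith) (by linarith) hx))
  · intro x hx
    have hq := hg x hx
    have hhi := hiFactor_pos (k := k) (m := k - 1) hd (by linarith) (by linarith) hx
    have hlo := loFactor_pos (k := k) (m := k - 1) hd hkd (by linarith) (by linarith) hx
    have h1 := key x hx
    have h2 : ((2 * (d + 1) - k) * (qCoef k d x + (k - 2) * eCoef d x)
            - qCoef k d x * (2 * (d + 1) - k + (k - 2) * ((d + 1) * (2 * x))))
          / (qCoef k d x + (k - 2) * eCoef d x) ^ 2 ≤ 0 :=
      div_nonpos_of_nonpos_of_nonneg (key' x hx) (by positivity)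
    -- The coefficient of the logarithm is now nonpositive, hence the upper bound for `log`.
    have h3 := mul_le_mul_of_nonpos_left (log_le_sq_sub_one_div hx) h2
    refine le_trans ?_ (sub_le_sub_right (add_le_add_left h3 _) _)
    have hx0 : 0 < x := by linarith
    generalize hG : qCoef k d x + (k - 2) * eCoef d x = g at *
    have hq2 : 2 * qCoef k d x + (k - 2) * eCoef d x = qCoef k d x + g := by rw [← hG]; ring
    rw [hq2] at h1
    generalize hiFactor k (k - 1) d x = a at *
    generalize loFactor k (k - 1) d x = b at *
    generalize qCoef k d x = q at *
    have e : ((2 * (d + 1) - k) * g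
            - q * (2 * (d + 1) - k + (k - 2) * ((d + 1) * (2 * x))))
          / g ^ 2 * ((x ^ 2 - 1) / (2 * x))
        + (1 + q / g) * x⁻¹
        - 2 * k ^ 2 * d ^ 2 * x / (a * b)
        = ((q + g) * g * (a * b) * (2 * x)
        + ((2 * (d + 1) - k) * g
            - q * (2 * (d + 1) - k + (k - 2) * ((d + 1) * (2 * x)))) * x * (x ^ 2 - 1)
          * (a * b)
        - 2 * k ^ 2 * d ^ 2 * x ^ 2 * g ^ 2 * (2 * x))
          / (g ^ 2 * x * (2 * x) * (a * b)) := by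
      field_simp
      ring
    rw [e]
    positivity

end Potts

/-! ### Polynomial certificates for three and four colours -/

namespace Potts

theorem exists_add_eq {a T : ℝ} (h : a ≤ T) : ∃ x, 0 ≤ x ∧ T = a + x :=
  ⟨T - a, by linarith, by ring⟩

-- Writing `T = 1 + x` and `d = 2 + y` turns both criteria into polynomials in `x, y ≥ 0` without
-- negative coefficients, which is what `positivity` checks. The later certificates shift in the
-- same way from the smallest admissible `T` and `d`.
set_option maxHeartbeats 1000000 in
theorem qCoef_mul_logGap_one_le_three {d : ℝ} (hd : 2 ≤ d) {T : ℝ} (hT : 1 ≤ T) :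
    qCoef 3 d T * logGap 3 1 d T ≤ (2 * qCoef 3 d T + (3 - 2) * eCoef d T) * Real.log T := by
  refine qCoef_mul_logGap_one_le (by norm_num) (by linarith) (by linarith) ?_ ?_ hT
  · intro T hT
    obtain ⟨x, hx, rfl⟩ := exists_add_eq hT
    obtain ⟨y, hy, rfl⟩ := exists_add_eq hd
    simp only [qCoef, eCoef, hiFactor, loFactor]
    ring_nf
    positivity
  · intro T hT
    obtain ⟨x, hx, rfl⟩ := exists_add_eq hT
    obtain ⟨y, hy, rfl⟩ := exists_add_eq hd
    simp only [qCoef, eCoef]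
    ring_nf
    positivity

set_option maxHeartbeats 1000000 in
theorem mul_logGap_two_le_three {d : ℝ} (hd : 2 ≤ d) {T : ℝ} (hT : 1 ≤ T) :
    (qCoef 3 d T + (3 - 2) * eCoef d T) * logGap 3 (3 - 1) d T
      ≤ (2 * qCoef 3 d T + (3 - 2) * eCoef d T) * Real.log T := by
  refine mul_logGap_pred_le (by norm_num) (by linarith) (by linarith) ?_ ?_ hT
  · intro T hT
    obtain ⟨x, hx, rfl⟩ := exists_add_eq hT
    obtain ⟨y, hy, rfl⟩ := exists_add_eq hd
    simp only [qCoef, eCoef, hiFactor, loFactor]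
    ring_nf
    positivity
  · intro T hT
    rw [← neg_nonneg]
    obtain ⟨x, hx, rfl⟩ := exists_add_eq hT
    obtain ⟨y, hy, rfl⟩ := exists_add_eq hd
    simp only [qCoef, eCoef]
    ring_nf
    positivity

set_option maxHeartbeats 1000000 in
theorem qCoef_mul_logGap_one_le_four {d : ℝ} (hd : 4 ≤ d) {T : ℝ} (hT : 1 ≤ T) :
    qCoef 4 d T * logGap 4 1 d T ≤ (2 * qCoef 4 d T + (4 - 2) * eCoef d T) * Real.log T := by
  refine qCoef_mul_logGap_one_le (by norm_num) (by linarith) (by linarith) ?_ ?_ hT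
  · intro T hT
    obtain ⟨x, hx, rfl⟩ := exists_add_eq hT
    obtain ⟨y, hy, rfl⟩ := exists_add_eq hd
    simp only [qCoef, eCoef, hiFactor, loFactor]
    ring_nf
    positivity
  · intro T hT
    obtain ⟨x, hx, rfl⟩ := exists_add_eq hT
    obtain ⟨y, hy, rfl⟩ := exists_add_eq hd
    simp only [qCoef, eCoef]
    ring_nf
    positivity

set_option maxHeartbeats 1000000 in
theorem mul_logGap_three_le_four {d : ℝ} (hd : 4 ≤ d) {T : ℝ} (hT : 1 ≤ T) :
    (qCoef 4 d T + (4 - 2) * eCoef d T) * logGap 4 (4 - 1) d T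
      ≤ (2 * qCoef 4 d T + (4 - 2) * eCoef d T) * Real.log T := by
  refine mul_logGap_pred_le (by norm_num) (by linarith) (by linarith) ?_ ?_ hT
  · intro T hT
    obtain ⟨x, hx, rfl⟩ := exists_add_eq hT
    obtain ⟨y, hy, rfl⟩ := exists_add_eq hd
    simp only [qCoef, eCoef, hiFactor, loFactor]
    ring_nf
    positivity
  · intro T hT
    rw [← neg_nonneg]
    obtain ⟨x, hx, rfl⟩ := exists_add_eq hT
    obtain ⟨y, hy, rfl⟩ := exists_add_eq hd
    simp only [qCoef, eCoef]
    ring_nf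
    positivity

theorem logGap_two_le_four {d : ℝ} (hd : 4 ≤ d) {T : ℝ} (hT : 1 ≤ T) :
    logGap 4 2 d T ≤ 2 * Real.log T := by
  have hhi : ∀ x : ℝ, 1 ≤ x → 0 < hiFactor 4 2 d x := fun x hx =>
    hiFactor_pos (by linarith) (by norm_num) (by norm_num) hx
  have hlo : ∀ x : ℝ, 1 ≤ x → 0 < loFactor 4 2 d x := fun x hx =>
    loFactor_pos (by linarith) (by linarith) (by norm_num) (by norm_num) hx
  have h := le_of_hasDerivAt_nonneg (a := 1) (f := fun x => 2 * Real.log x - logGap 4 2 d x)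
    (f' := fun x => 2 * x⁻¹ - 2 * 4 ^ 2 * d ^ 2 * x / (hiFactor 4 2 d x * loFactor 4 2 d x)) ?_ ?_ hT
  · simp only [Real.log_one, mul_zero, logGap_one, sub_zero] at h
    linarith
  · intro x hx
    exact ((Real.hasDerivAt_log (by linarith : x ≠ 0)).const_mul 2).sub
      (hasDerivAt_logGap (hhi x hx) (hlo x hx))
  · intro x hx
    have h1 := hhi x hx
    have h2 := hlo x hx
    have hx0 : 0 < x := by linarith
    have key : 0 ≤ 2 * (hiFactor 4 2 d x * loFactor 4 2 d x) - 2 * 4 ^ 2 * d ^ 2 * x ^ 2 := by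
      obtain ⟨x, hx, rfl⟩ := exists_add_eq hx
      obtain ⟨y, hy, rfl⟩ := exists_add_eq hd
      simp only [hiFactor, loFactor]
      ring_nf
      positivity
    have e : 2 * x⁻¹ - 2 * 4 ^ 2 * d ^ 2 * x / (hiFactor 4 2 d x * loFactor 4 2 d x)
      = (2 * (hiFactor 4 2 d x * loFactor 4 2 d x) - 2 * 4 ^ 2 * d ^ 2 * x ^ 2) /
        (x * (hiFactor 4 2 d x * loFactor 4 2 d x)) := by
      field_simp
    rw [e]
    positivity

/-- The logarithm of the product of the coefficients in the arithmetic-geometric mean regime. -/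
noncomputable def logCoefs (k d T : ℝ) : ℝ :=
  Real.log (T * qCoef k d T) + (k - 2) * Real.log (eCoef d T)
    - (k - 1) * Real.log (tCoef k d T / (k - 1))

/-- At the crossover between the two choices of weights, `tCoef / (k - 1)` equals `qCoef / T`.
Divided by it, the coefficients become `T ^ 2` once and `T` for the other `k - 2` colours, with
product `T ^ k`. -/
theorem logCoefs_eq_of_eCoef_eq {k d T : ℝ} (hk : 2 ≤ k) (hd : 0 < d) (hkd : k - 1 ≤ d)
    (hT : 1 ≤ T) (h : eCoef d T = qCoef k d T) : logCoefs k d T = k * Real.log T := by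
  have hq := qCoef_pos hk hd hkd hT
  have h1 := mul_tCoef k d T
  have hT0 : 0 < T := by linarith
  have hk1 : k - 1 ≠ 0 := by linarith
  have h2 : tCoef k d T / (k - 1) = qCoef k d T / T := by
    rw [div_eq_div_iff hk1 hT0.ne']
    rw [h] at h1
    linarith
  unfold logCoefs
  rw [h2, h, Real.log_mul hT0.ne' hq.ne', Real.log_div hq.ne' hT0.ne']
  ring

theorem exists_eCoef_eq {k d T : ℝ} {T₀ : ℝ}
    (hT₀ : eCoef d T₀ ≤ qCoef k d T₀) (hTT : T₀ ≤ T) (h : qCoef k d T ≤ eCoef d T) :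
    ∃ S, T₀ ≤ S ∧ S ≤ T ∧ eCoef d S = qCoef k d S := by
  have hc : ContinuousOn (fun x => eCoef d x - qCoef k d x) (Set.Icc T₀ T) := by
    unfold eCoef qCoef
    fun_prop
  have := intermediate_value_Icc hTT hc
  obtain ⟨S, hS, hS'⟩ := this (show (0 : ℝ) ∈ Set.Icc _ _ from ⟨by simpa using hT₀, by simpa using h⟩)
  exact ⟨S, hS.1, hS.2, by simpa [sub_eq_zero] using hS'⟩

/-- Derivative criterion for the monotonicity of `logCoefs k d - m * logGap k m d`. -/
theorem logCoefs_sub_mono {k m d : ℝ} (hk : 2 ≤ k) (hm : 1 ≤ m) (hmk : m ≤ k) (hd : 0 < d)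
    (hkd : k - 1 ≤ d) {T₀ : ℝ} (hT₀ : 1 < T₀)
    (key : ∀ T : ℝ, T₀ ≤ T → 0 ≤
      ((qCoef k d T + T * (2 * (d + 1) - k)) * (T ^ 2 - 1) * tCoef k d T
        + (k - 2) * (2 * T) * (T * qCoef k d T) * tCoef k d T
        - (k - 1) * ((k - 2) * (d + 1)) * (T * qCoef k d T) * (T ^ 2 - 1))
        * (hiFactor k m d T * loFactor k m d T)
      - m * (2 * k ^ 2 * d ^ 2 * T) * (T * qCoef k d T) * tCoef k d T * (T ^ 2 - 1))
    {S T : ℝ} (hS : T₀ ≤ S) (hT : S ≤ T) :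
    logCoefs k d S - m * logGap k m d S ≤ logCoefs k d T - m * logGap k m d T := by
  refine le_of_hasDerivAt_nonneg (a := S) (f := fun x => logCoefs k d x - m * logGap k m d x)
    (f' := fun x => ((1 * qCoef k d x + x * (2 * (d + 1) - k)) / (x * qCoef k d x)
        + (k - 2) * ((d + 1) * (2 * x) / eCoef d x)
        - (k - 1) * ((k - 2) * (d + 1) / (k - 1) / (tCoef k d x / (k - 1))))
      - m * (2 * k ^ 2 * d ^ 2 * x / (hiFactor k m d x * loFactor k m d x))) ?_ ?_ hT
  · intro x hx
    have hx1 : 1 < x := by linarith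
    have hq := qCoef_pos hk hd hkd hx1.le
    have he := eCoef_pos hd hx1
    have ht := tCoef_pos hk hd hkd hx1.le
    have hx0 : 0 < x := by linarith
    have h1 := ((hasDerivAt_id x).mul (hasDerivAt_qCoef (k := k) (d := d) (T := x))).log
      (mul_pos hx0 hq).ne'
    have h2 := ((hasDerivAt_eCoef (d := d) (T := x)).log he.ne').const_mul (k - 2)
    have h3 := (((hasDerivAt_tCoef (k := k) (d := d) (T := x)).div_const (k - 1)).log
      (div_pos ht (by linarith)).ne').const_mul (k - 1)
    exact ((h1.add h2).sub h3).sub ((hasDerivAt_logGap (hiFactor_pos hd hm hmk hx1.le)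
      (loFactor_pos hd hkd hm hmk hx1.le)).const_mul m)
  · intro x hx
    have hx1 : 1 < x := by linarith
    have hq := qCoef_pos hk hd hkd hx1.le
    have ht := tCoef_pos hk hd hkd hx1.le
    have hx0 : 0 < x := by linarith
    have hhi := hiFactor_pos hd hm hmk hx1.le
    have hlo := loFactor_pos hd hkd hm hmk hx1.le
    have h1 := key x (by linarith)
    have hs : 0 < x ^ 2 - 1 := by nlinarith
    have hd1 : 0 < d + 1 := by linarith
    have hk1 : k - 1 ≠ 0 := by linarith
    have e1 : (d + 1) * (2 * x) / eCoef d x = 2 * x / (x ^ 2 - 1) := by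
      unfold eCoef
      field_simp
    rw [e1]
    generalize hiFactor k m d x = a at *
    generalize loFactor k m d x = b at *
    generalize qCoef k d x = q at *
    generalize tCoef k d x = t at *
    generalize hs' : x ^ 2 - 1 = s at *
    have e : (1 * q + x * (2 * (d + 1) - k)) / (x * q)
        + (k - 2) * (2 * x / s)
        - (k - 1) * ((k - 2) * (d + 1) / (k - 1) / (t / (k - 1)))
      - m * (2 * k ^ 2 * d ^ 2 * x / (a * b)) =
      (((q + x * (2 * (d + 1) - k)) * s * t
        + (k - 2) * (2 * x) * (x * q) * t
        - (k - 1) * ((k - 2) * (d + 1)) * (x * q) * s)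
        * (a * b)
      - m * (2 * k ^ 2 * d ^ 2 * x) * (x * q) * t * s) / (x * q * s * t * (a * b)) := by
      field_simp
    rw [e]
    positivity

-- At the crossover `S` the two choices of weights coincide, so the bounds of the first regime hold
-- there; beyond it `logCoefs - m * logGap` is nondecreasing. The number `2` lies below the
-- crossover for every `d ≥ 3`.
set_option maxHeartbeats 1000000 in
theorem logGap_le_logCoefs_three {d : ℝ} (hd : 3 ≤ d) {T : ℝ} (hT : 2 ≤ T)
    (h : qCoef 3 d T ≤ eCoef d T) :
    1 * logGap 3 1 d T ≤ logCoefs 3 d T ∧ 2 * logGap 3 2 d T ≤ logCoefs 3 d T := by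
  have h0 : eCoef d 2 ≤ qCoef 3 d 2 := by unfold eCoef qCoef; linarith
  obtain ⟨S, hS, hST, hS'⟩ := exists_eCoef_eq h0 hT h
  have hS1 : 1 ≤ S := by linarith
  have hq := qCoef_pos (k := 3) (d := d) (by norm_num) (by linarith) (by linarith) hS1
  have hB := logCoefs_eq_of_eCoef_eq (k := 3) (by norm_num) (by linarith) (by linarith) hS1 hS'
  have h1 := qCoef_mul_logGap_one_le_three (by linarith : 2 ≤ d) hS1
  have h2 := mul_logGap_two_le_three (by linarith : 2 ≤ d) hS1
  rw [hS'] at h1 h2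
  have h1' : logGap 3 1 d S ≤ 3 * Real.log S := by
    rw [← mul_le_mul_iff_right₀ hq]; linarith
  have h2' : 2 * logGap 3 2 d S ≤ 3 * Real.log S := by
    rw [← mul_le_mul_iff_right₀ hq]; norm_num at h2; linarith
  constructor
  · have := logCoefs_sub_mono (k := 3) (m := 1) (d := d) (by norm_num) (by norm_num) (by norm_num)
      (by linarith) (by linarith) (T₀ := 2) (by norm_num) ?_ hS hST
    · linarith
    · intro T hT
      obtain ⟨x, hx, rfl⟩ := exists_add_eq hT
      obtain ⟨y, hy, rfl⟩ := exists_add_eq hd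
      simp only [qCoef, tCoef, hiFactor, loFactor]
      ring_nf
      positivity
  · have := logCoefs_sub_mono (k := 3) (m := 2) (d := d) (by norm_num) (by norm_num) (by norm_num)
      (by linarith) (by linarith) (T₀ := 2) (by norm_num) ?_ hS hST
    · linarith
    · intro T hT
      obtain ⟨x, hx, rfl⟩ := exists_add_eq hT
      obtain ⟨y, hy, rfl⟩ := exists_add_eq hd
      simp only [qCoef, tCoef, hiFactor, loFactor]
      ring_nf
      positivity

set_option maxHeartbeats 1000000 in
theorem logGap_le_logCoefs_four {d : ℝ} (hd : 4 ≤ d) {T : ℝ} (hT : 12 / 5 ≤ T)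
    (h : qCoef 4 d T ≤ eCoef d T) :
    1 * logGap 4 1 d T ≤ logCoefs 4 d T ∧ 2 * logGap 4 2 d T ≤ logCoefs 4 d T ∧
      3 * logGap 4 3 d T ≤ logCoefs 4 d T := by
  -- A point just below the crossover for `d = 4`, which is near `2.43`; it works for every `d ≥ 4`.
  have h0 : eCoef d (12 / 5) ≤ qCoef 4 d (12 / 5) := by unfold eCoef qCoef; linarith
  obtain ⟨S, hS, hST, hS'⟩ := exists_eCoef_eq h0 hT h
  have hS1 : 1 ≤ S := by linarith
  have hq := qCoef_pos (k := 4) (d := d) (by norm_num) (by linarith) (by linarith) hS1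
  have hB := logCoefs_eq_of_eCoef_eq (k := 4) (by norm_num) (by linarith) (by linarith) hS1 hS'
  have h1 := qCoef_mul_logGap_one_le_four hd hS1
  have h2 := logGap_two_le_four hd hS1
  have h3 := mul_logGap_three_le_four hd hS1
  rw [hS'] at h1 h3
  have h1' : logGap 4 1 d S ≤ 4 * Real.log S := by
    rw [← mul_le_mul_iff_right₀ hq]; linarith
  have h3' : 3 * logGap 4 3 d S ≤ 4 * Real.log S := by
    rw [← mul_le_mul_iff_right₀ hq]; norm_num at h3; linarith
  refine ⟨?_, ?_, ?_⟩
  · have := logCoefs_sub_mono (k := 4) (m := 1) (d := d) (by norm_num) (by norm_num) (by norm_num)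
      (by linarith) (by linarith) (T₀ := 12 / 5) (by norm_num) ?_ hS hST
    · linarith
    · intro T hT
      obtain ⟨x, hx, rfl⟩ := exists_add_eq hT
      obtain ⟨y, hy, rfl⟩ := exists_add_eq hd
      simp only [qCoef, tCoef, hiFactor, loFactor]
      ring_nf
      positivity
  · have := logCoefs_sub_mono (k := 4) (m := 2) (d := d) (by norm_num) (by norm_num) (by norm_num)
      (by linarith) (by linarith) (T₀ := 12 / 5) (by norm_num) ?_ hS hST
    · linarith
    · intro T hT
      obtain ⟨x, hx, rfl⟩ := exists_add_eq hT
      obtain ⟨y, hy, rfl⟩ := exists_add_eq hd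
      simp only [qCoef, tCoef, hiFactor, loFactor]
      ring_nf
      positivity
  · have := logCoefs_sub_mono (k := 4) (m := 3) (d := d) (by norm_num) (by norm_num) (by norm_num)
      (by linarith) (by linarith) (T₀ := 12 / 5) (by norm_num) ?_ hS hST
    · linarith
    · intro T hT
      obtain ⟨x, hx, rfl⟩ := exists_add_eq hT
      obtain ⟨y, hy, rfl⟩ := exists_add_eq hd
      simp only [qCoef, tCoef, hiFactor, loFactor]
      ring_nf
      positivity

end Potts

/-! ### Admissible weights and the size of the contraction ratio -/

namespace Potts

theorem logGap_nonneg {k m d T : ℝ} (hd : 0 < d) (hkd : k - 1 ≤ d) (hm : 1 ≤ m) (hmk : m ≤ k)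
    (hT : 1 ≤ T) : 0 ≤ logGap k m d T := by
  refine mul_nonneg hd.le (sub_nonneg.2 (Real.log_le_log (loFactor_pos hd hkd hm hmk hT) ?_))
  have : 0 ≤ k * (T ^ 2 - 1) := mul_nonneg (by linarith) (by nlinarith)
  unfold loFactor hiFactor
  linarith

/-- For `d = 2` everything is explicit. As `T` grows, `logGap 3 1 2 T` behaves like `4 * log T` but
`logCoefs 3 2 T` only like `2 * log T`, so an upper bound on `T` is unavoidable. The crossover is
exactly `T = 2`. -/
theorem logGap_le_logCoefs_three_two {T : ℝ} (hT : 2 ≤ T) (hT' : T ≤ 11 / 4) :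
    1 * logGap 3 1 2 T ≤ logCoefs 3 2 T ∧ 2 * logGap 3 2 2 T ≤ logCoefs 3 2 T := by
  have hT1 : 0 < T - 1 := by linarith
  have hC : logCoefs 3 2 T = Real.log (4 * T * (T - 1)) := by
    have e1 : T * qCoef 3 2 T = 3 * T * (T + 1) := by unfold qCoef; ring
    have e2 : eCoef 2 T = 3 * (T + 1) * (T - 1) := by unfold eCoef; ring
    have e3 : tCoef 3 2 T / (3 - 1) = 3 * (T + 1) / 2 := by unfold tCoef; ring
    unfold logCoefs
    rw [e1, e2, e3]
    have e4 : Real.log (4 * T * (T - 1)) =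
        Real.log (3 * T * (T + 1)) + Real.log (3 * (T + 1) * (T - 1))
          - 2 * Real.log (3 * (T + 1) / 2) := by
      rw [← Real.log_mul (by positivity) (by positivity),
        ← Real.log_rpow (by positivity), ← Real.log_div (by positivity) (by positivity)]
      congr 1
      norm_num
      field_simp
      ring
    rw [e4]
    ring
  have e1 : logGap 3 1 2 T = Real.log (((T ^ 2 + 1) / 2) ^ 2) := by
    unfold logGap
    rw [← Real.log_div, Real.log_pow]
    · norm_num [hiFactor, loFactor]
      congr 1
      field_simp
      ring
    · exact (hiFactor_pos (by norm_num) (by norm_num) (by norm_num) (by linarith)).ne'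
    · exact (loFactor_pos (by norm_num) (by norm_num) (by norm_num) (by norm_num)
        (by linarith)).ne'
  have e2 : 2 * logGap 3 2 2 T = Real.log ((2 * T ^ 2 / (T ^ 2 + 1)) ^ 4) := by
    unfold logGap
    rw [← Real.log_div, Real.log_pow, ← mul_assoc]
    · norm_num [hiFactor, loFactor]
      congr 1
      have : (2 * (2 * T ^ 2 + 1) - (T ^ 2 - 1)) ≠ 0 := by nlinarith
      field_simp
      ring
    · exact (hiFactor_pos (by norm_num) (by norm_num) (by norm_num) (by linarith)).ne'
    · exact (loFactor_pos (by norm_num) (by norm_num) (by norm_num) (by norm_num)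
        (by linarith)).ne'
  rw [one_mul, hC, e1, e2]
  constructor
  · apply Real.log_le_log (by positivity)
    obtain ⟨x, hx, rfl⟩ := exists_add_eq hT
    have hx1 : x ≤ 3 / 4 := by linarith
    nlinarith [mul_nonneg hx (sub_nonneg.2 hx1), mul_nonneg (mul_nonneg hx hx) (sub_nonneg.2 hx1),
      mul_nonneg (mul_nonneg (mul_nonneg hx hx) hx) (sub_nonneg.2 hx1)]
  · apply Real.log_le_log (by positivity)
    rw [div_pow, div_le_iff₀ (by positivity)]
    have h1 : (T ^ 2) ^ 4 + 4 * (T ^ 2) ^ 3 ≤ (T ^ 2 + 1) ^ 4 := by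
      have : 0 ≤ T ^ 2 := by positivity
      nlinarith [pow_nonneg this 2]
    have h2 : 4 * T * (T - 1) * ((T ^ 2) ^ 4 + 4 * (T ^ 2) ^ 3)
        ≤ 4 * T * (T - 1) * (T ^ 2 + 1) ^ 4 :=
      mul_le_mul_of_nonneg_left h1 (by positivity)
    refine le_trans ?_ h2
    have h3 : 0 ≤ (T - 2) * (T ^ 2 - 3 * T + 2 + 2 * T) + 0 := by
      have : 0 ≤ T ^ 2 - 3 * T + 2 + 2 * T := by nlinarith
      have := mul_nonneg (sub_nonneg.2 hT) this
      linarith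
    -- The right side is `T ^ 3 - T ^ 2 - 4 = (T - 2) * (T ^ 2 + T + 2)`.
    have h4 : 0 ≤ (T - 1) * (T ^ 2 + 4) - 4 * T := by nlinarith
    have h5 : 4 * T * (T - 1) * ((T ^ 2) ^ 4 + 4 * (T ^ 2) ^ 3) - (2 * T ^ 2) ^ 4
        = 4 * T ^ 7 * ((T - 1) * (T ^ 2 + 4) - 4 * T) := by ring
    have h6 := mul_nonneg (by positivity : 0 ≤ 4 * T ^ 7) h4
    linarith

/-- The numerator of the two-step contraction ratio. -/
noncomputable def ratioNum (k d T : ℝ) : ℝ := (d + 1) * (T ^ 2 + (k - 2) * T + 1) - k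

/-- The denominator of the two-step contraction ratio. -/
noncomputable def ratioDen (k d T : ℝ) : ℝ := (d + 1) * (T ^ 2 + (k - 2) * T + 1) - k * T ^ 2

theorem ratioDen_pos {k d T : ℝ} (hk : 2 ≤ k) (hd : 0 < d) (hkd : k - 1 ≤ d) (hT : 1 ≤ T) :
    0 < ratioDen k d T := by
  have h1 : 0 ≤ (d + 1 - k) * T ^ 2 := mul_nonneg (by linarith) (by positivity)
  have h2 : 0 ≤ (d + 1) * ((k - 2) * T) :=
    mul_nonneg (by linarith) (mul_nonneg (by linarith) (by linarith))
  unfold ratioDen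
  nlinarith

theorem ratioDen_le_ratioNum {k d T : ℝ} (hk : 0 ≤ k) (hT : 1 ≤ T) :
    ratioDen k d T ≤ ratioNum k d T := by
  have : 0 ≤ k * (T ^ 2 - 1) := mul_nonneg hk (by nlinarith)
  unfold ratioDen ratioNum
  linarith

theorem hasDerivAt_log_ratio {k d T : ℝ} (hk : 2 ≤ k) (hd : 0 < d) (hkd : k - 1 ≤ d)
    (hT : 1 ≤ T) :
    HasDerivAt (fun x => 2 * Real.log x
        - d * (Real.log (ratioNum k d x) - Real.log (ratioDen k d x)))
      ((2 * ratioNum k d T * ratioDen k d T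
        - d * T * (((d + 1) * (2 * T + (k - 2))) * ratioDen k d T
          - ((d + 1) * (2 * T + (k - 2)) - k * (2 * T)) * ratioNum k d T))
        / (T * ratioNum k d T * ratioDen k d T)) T := by
  have hden := ratioDen_pos hk hd hkd hT
  have hnum := hden.trans_le (ratioDen_le_ratioNum (by linarith) hT)
  have hsq : HasDerivAt (fun x : ℝ => x ^ 2) (2 * T) T := by
    simpa using hasDerivAt_pow 2 T
  have h0 : HasDerivAt (fun x : ℝ => (d + 1) * (x ^ 2 + (k - 2) * x + 1))
      ((d + 1) * (2 * T + (k - 2) * 1)) T :=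
    ((hsq.add ((hasDerivAt_id T).const_mul (k - 2))).add_const 1).const_mul (d + 1)
  have h1 : HasDerivAt (ratioNum k d) ((d + 1) * (2 * T + (k - 2) * 1)) T := h0.sub_const k
  have h2 : HasDerivAt (ratioDen k d) ((d + 1) * (2 * T + (k - 2) * 1) - k * (2 * T)) T :=
    h0.sub (hsq.const_mul k)
  have hT0 : T ≠ 0 := by linarith
  refine (((Real.hasDerivAt_log hT0).const_mul 2).sub
    (((h1.log hnum.ne').sub (h2.log hden.ne')).const_mul d)).congr_deriv ?_
  have := hden.ne'
  have := hnum.ne'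
  field_simp

/-- For `d = 2` the quotient of `ratioNum` by `ratioDen` is exactly `T`, so equality holds and a
strict version is possible only for larger `d`. -/
theorem log_ratio_le_three {d : ℝ} (hd : 2 ≤ d) {T : ℝ} (hT : 1 ≤ T) :
    d * (Real.log (ratioNum 3 d T) - Real.log (ratioDen 3 d T)) ≤ 2 * Real.log T := by
  have h := le_of_hasDerivAt_nonneg (a := 1) (x := T)
    (fun x hx => hasDerivAt_log_ratio (k := 3) (d := d) (by norm_num) (by linarith)
      (by linarith) hx) ?_ hT
  · have e : ratioNum 3 d 1 = ratioDen 3 d 1 := by simp [ratioNum, ratioDen]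
    simp only [e, Real.log_one] at h
    linarith
  · intro x hx
    have hden := ratioDen_pos (k := 3) (d := d) (by norm_num) (by linarith) (by linarith) hx
    have hnum := hden.trans_le (ratioDen_le_ratioNum (by linarith) hx)
    refine div_nonneg ?_ (by positivity)
    clear hden hnum
    obtain ⟨x, hx, rfl⟩ := exists_add_eq hx
    obtain ⟨y, hy, rfl⟩ := exists_add_eq hd
    simp only [ratioNum, ratioDen]
    ring_nf
    positivity

theorem log_ratio_lt_three {d : ℝ} (hd : 3 ≤ d) {T : ℝ} (hT : 1 < T) :
    d * (Real.log (ratioNum 3 d T) - Real.log (ratioDen 3 d T)) < 2 * Real.log T := by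
  have h := lt_of_hasDerivAt_pos (a := 1) (x := T)
    (fun x hx => hasDerivAt_log_ratio (k := 3) (d := d) (by norm_num) (by linarith)
      (by linarith) hx) ?_ hT
  · have e : ratioNum 3 d 1 = ratioDen 3 d 1 := by simp [ratioNum, ratioDen]
    simp only [e, Real.log_one] at h
    linarith
  · intro x hx
    have hden := ratioDen_pos (k := 3) (d := d) (by norm_num) (by linarith) (by linarith) hx.le
    have hnum := hden.trans_le (ratioDen_le_ratioNum (by linarith) hx.le)
    refine div_pos ?_ (by positivity)
    clear hden hnum
    obtain ⟨x, rfl⟩ : ∃ y, x = 1 + y := ⟨x - 1, by ring⟩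
    have hx : 0 < x := by linarith
    obtain ⟨y, hy, rfl⟩ := exists_add_eq hd
    simp only [ratioNum, ratioDen]
    ring_nf
    positivity

theorem log_ratio_lt_four {d : ℝ} (hd : 4 ≤ d) {T : ℝ} (hT : 1 < T) :
    d * (Real.log (ratioNum 4 d T) - Real.log (ratioDen 4 d T)) < 2 * Real.log T := by
  have h := lt_of_hasDerivAt_pos (a := 1) (x := T)
    (fun x hx => hasDerivAt_log_ratio (k := 4) (d := d) (by norm_num) (by linarith)
      (by linarith) hx) ?_ hT
  · have e : ratioNum 4 d 1 = ratioDen 4 d 1 := by simp [ratioNum, ratioDen]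
    simp only [e, Real.log_one] at h
    linarith
  · intro x hx
    have hden := ratioDen_pos (k := 4) (d := d) (by norm_num) (by linarith) (by linarith) hx.le
    have hnum := hden.trans_le (ratioDen_le_ratioNum (by linarith) hx.le)
    refine div_pos ?_ (by positivity)
    clear hden hnum
    obtain ⟨x, rfl⟩ : ∃ y, x = 1 + y := ⟨x - 1, by ring⟩
    have hx : 0 < x := by linarith
    obtain ⟨y, hy, rfl⟩ := exists_add_eq hd
    simp only [ratioNum, ratioDen]
    ring_nf
    positivity

/-- Weights of a supporting hyperplane which certify the two-step contraction at `T`. -/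
def HasWeights (k d : ℕ) (T : ℝ) : Prop :=
  ∃ θ₁ θ u₁ u : ℝ, 0 < θ₁ ∧ 0 < θ ∧ T * qCoef k d T = θ₁ * Real.exp u₁ ∧
    eCoef d T = θ * Real.exp u ∧ θ₁ + ((k : ℝ) - 2) * θ = tCoef k d T ∧
    0 ≤ θ₁ * u₁ + ((k : ℝ) - 2) * θ * u ∧
    (∀ m : ℕ, 1 ≤ m → m + 1 ≤ k →
      (θ₁ + ((m : ℝ) - 1) * θ) * logGap k m d T ≤ θ₁ * u₁ + ((k : ℝ) - 2) * θ * u) ∧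
    ∀ m : ℕ, 1 ≤ m → m + 2 ≤ k →
      (m : ℝ) * θ * logGap k m d T ≤ θ₁ * u₁ + ((k : ℝ) - 2) * θ * u

/-- The weights make the tangent bound exact at the extremal vector, where `z i / z j = T⁻²` and `z
x / z j = T⁻¹` for the other colours. Their sum is right by `mul_tCoef`. -/
theorem hasWeights_of_eCoef_le {k d : ℕ} {T : ℝ} (hk : 2 ≤ k) (hkd : k ≤ d + 1) (hd : 0 < d)
    (hT : 1 < T) (h : eCoef d T ≤ qCoef k d T)
    (key : ∀ m : ℕ, 1 ≤ m → m + 1 ≤ k → (qCoef k d T + ((m : ℝ) - 1) * eCoef d T) * logGap k m d T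
      ≤ (2 * qCoef k d T + ((k : ℝ) - 2) * eCoef d T) * Real.log T) : HasWeights k d T := by
  have hk' : (2 : ℝ) ≤ k := by exact_mod_cast hk
  have hd' : (0 : ℝ) < d := by exact_mod_cast hd
  have hkd' : (k : ℝ) - 1 ≤ d := by
    have : (k : ℝ) ≤ d + 1 := by exact_mod_cast hkd
    linarith
  have hT0 : 0 < T := by linarith
  have hq := qCoef_pos hk' hd' hkd' hT.le
  have he := eCoef_pos hd' hT
  have hlog := Real.log_pos hT
  have e1 : qCoef k d T / T * (2 * Real.log T) + ((k : ℝ) - 2) * (eCoef d T / T) * Real.log T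
      = (2 * qCoef k d T + ((k : ℝ) - 2) * eCoef d T) * Real.log T / T := by
    field_simp
  have hmain : ∀ m : ℕ, 1 ≤ m → m + 1 ≤ k →
      (qCoef k d T / T + ((m : ℝ) - 1) * (eCoef d T / T)) * logGap k m d T ≤
        (2 * qCoef k d T + ((k : ℝ) - 2) * eCoef d T) * Real.log T / T := by
    intro m hm hmk
    rw [le_div_iff₀ hT0]
    refine le_of_eq_of_le ?_ (key m hm hmk)
    field_simp
  refine ⟨qCoef k d T / T, eCoef d T / T, 2 * Real.log T, Real.log T, by positivity, by positivity,
    ?_, ?_, ?_, ?_, ?_, ?_⟩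
  · rw [two_mul, Real.exp_add, Real.exp_log hT0]
    field_simp
  · rw [Real.exp_log hT0]
    field_simp
  · have := mul_tCoef k d T
    field_simp
    linarith
  · rw [e1]
    have : 0 ≤ ((k : ℝ) - 2) * eCoef d T := mul_nonneg (by linarith) he.le
    positivity
  · intro m hm hmk
    rw [e1]
    exact hmain m hm hmk
  · intro m hm hmk
    rw [e1]
    -- Since `eCoef ≤ qCoef` gives `θ ≤ θ₁`, the case in which colour `i` has a small entry is the
    -- weaker one.
    refine le_trans ?_ (hmain m hm (by omega))
    have hg : 0 ≤ logGap k m d T := logGap_nonneg hd' hkd' (by exact_mod_cast hm)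
      (by exact_mod_cast (by omega : m ≤ k)) hT.le
    refine mul_le_mul_of_nonneg_right ?_ hg
    have : eCoef d T / T ≤ qCoef k d T / T := by gcongr
    linarith

/-- All `k - 1` weights are equal, which is the plain arithmetic-geometric mean inequality; a set of
`m` large entries then costs `m * θ` whether or not it contains `i`. -/
theorem hasWeights_of_logGap_le {k d : ℕ} {T : ℝ} (hk : 2 ≤ k) (hkd : k ≤ d + 1) (hd : 0 < d)
    (hT : 1 < T) (key : ∀ m : ℕ, 1 ≤ m → m + 1 ≤ k → (m : ℝ) * logGap k m d T ≤ logCoefs k d T) :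
    HasWeights k d T := by
  have hk' : (2 : ℝ) ≤ k := by exact_mod_cast hk
  have hd' : (0 : ℝ) < d := by exact_mod_cast hd
  have hkd' : (k : ℝ) - 1 ≤ d := by
    have : (k : ℝ) ≤ d + 1 := by exact_mod_cast hkd
    linarith
  have hT0 : 0 < T := by linarith
  have hk1 : (0 : ℝ) < k - 1 := by linarith
  have hq := qCoef_pos hk' hd' hkd' hT.le
  have he := eCoef_pos hd' hT
  have ht := tCoef_pos hk' hd' hkd' hT.le
  set θ := tCoef k d T / ((k : ℝ) - 1) with hθ
  have hθ0 : 0 < θ := by positivity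
  have e1 : θ * Real.log (T * qCoef k d T / θ) + ((k : ℝ) - 2) * θ * Real.log (eCoef d T / θ)
      = θ * logCoefs k d T := by
    rw [Real.log_div (by positivity) hθ0.ne', Real.log_div he.ne' hθ0.ne', logCoefs, ← hθ]
    ring
  have hmain : ∀ m : ℕ, 1 ≤ m → m + 1 ≤ k → (m : ℝ) * θ * logGap k m d T ≤ θ * logCoefs k d T := by
    intro m hm hmk
    have := mul_le_mul_of_nonneg_left (key m hm hmk) hθ0.le
    linarith
  refine ⟨θ, θ, Real.log (T * qCoef k d T / θ), Real.log (eCoef d T / θ), hθ0, hθ0,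
    ?_, ?_, ?_, ?_, ?_, ?_⟩
  · rw [Real.exp_log (by positivity)]
    field_simp
  · rw [Real.exp_log (by positivity)]
    field_simp
  · have : ((k : ℝ) - 1) * θ = tCoef k d T := by
      rw [hθ]
      field_simp
    linarith
  · rw [e1]
    have h1 := key 1 le_rfl (by omega)
    have hg : 0 ≤ logGap k (1 : ℕ) d T := logGap_nonneg hd' hkd' (by norm_num)
      (by norm_num; linarith) hT.le
    have : 0 ≤ logCoefs k d T := le_trans (by positivity) h1
    positivity
  · intro m hm hmk
    rw [e1]
    refine le_of_eq_of_le ?_ (hmain m hm hmk)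
    ring
  · intro m hm hmk
    rw [e1]
    exact hmain m hm (by omega)

/-- The range of `k`, `d` and `T` in which the two-step contraction is established. -/
def GoodRange (k d : ℕ) (T : ℝ) : Prop :=
  (k = 3 ∧ d = 2 ∧ T ≤ 11 / 4) ∨ (k = 3 ∧ 3 ≤ d) ∨ (k = 4 ∧ 4 ≤ d)

theorem hasWeights_of_goodRange {k d : ℕ} {T : ℝ} (h : GoodRange k d T) (hT : 1 < T) :
    HasWeights k d T := by
  have hthree : ∀ d : ℕ, 2 ≤ d → (∀ T : ℝ, 2 ≤ T → qCoef 3 d T ≤ eCoef d T → GoodRange 3 d T →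
      1 * logGap 3 1 d T ≤ logCoefs 3 d T ∧ 2 * logGap 3 2 d T ≤ logCoefs 3 d T) →
      GoodRange 3 d T → HasWeights 3 d T := by
    intro d hd hB hg
    have hd' : (2 : ℝ) ≤ d := by exact_mod_cast hd
    rcases le_total (eCoef d T) (qCoef 3 d T) with hqe | hqe
    · refine hasWeights_of_eCoef_le (by norm_num) (by omega) (by omega) hT hqe ?_
      intro m hm hmk
      have h1 := qCoef_mul_logGap_one_le_three hd' hT.le
      have h2 := mul_logGap_two_le_three hd' hT.le
      obtain rfl | rfl : m = 1 ∨ m = 2 := by omega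
      · norm_num at h1 ⊢
        exact h1
      · norm_num at h2 ⊢
        exact h2
    · have hT2 : 2 ≤ T := by
        by_contra hlt
        unfold qCoef eCoef at hqe
        nlinarith [mul_pos (sub_pos.2 hT) (sub_pos.2 (not_le.1 hlt))]
      obtain ⟨h1, h2⟩ := hB T hT2 hqe hg
      refine hasWeights_of_logGap_le (by norm_num) (by omega) (by omega) hT ?_
      intro m hm hmk
      obtain rfl | rfl : m = 1 ∨ m = 2 := by omega
      · norm_num at h1 ⊢
        exact h1
      · norm_num at h2 ⊢
        exact h2
  rcases h with ⟨rfl, rfl, hT'⟩ | ⟨rfl, hd⟩ | ⟨rfl, hd⟩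
  · refine hthree 2 le_rfl ?_ (Or.inl ⟨rfl, rfl, hT'⟩)
    rintro T hT - (⟨-, -, h⟩ | ⟨-, h⟩ | ⟨h, -⟩)
    · exact_mod_cast logGap_le_logCoefs_three_two hT h
    · omega
    · omega
  · refine hthree d (by omega) ?_ (Or.inr (Or.inl ⟨rfl, hd⟩))
    intro T hT hqe _
    exact logGap_le_logCoefs_three (by exact_mod_cast hd) hT hqe
  · have hd' : (4 : ℝ) ≤ d := by exact_mod_cast hd
    rcases le_total (eCoef d T) (qCoef 4 d T) with hqe | hqe
    · refine hasWeights_of_eCoef_le (by norm_num) (by omega) (by omega) hT hqe ?_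
      intro m hm hmk
      have h1 := qCoef_mul_logGap_one_le_four hd' hT.le
      have h2 := logGap_two_le_four hd' hT.le
      have h3 := mul_logGap_three_le_four hd' hT.le
      obtain rfl | rfl | rfl : m = 1 ∨ m = 2 ∨ m = 3 := by omega
      · norm_num at h1 ⊢
        exact h1
      · have hq := qCoef_pos (k := 4) (d := d) (by norm_num) (by linarith) (by linarith) hT.le
        have he := eCoef_pos (d := d) (by linarith) hT
        have := mul_le_mul_of_nonneg_left h2 (by linarith : 0 ≤ qCoef 4 d T + eCoef d T)
        norm_num at this ⊢
        linarith
      · norm_num at h3 ⊢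
        exact h3
    · have hT2 : 12 / 5 ≤ T := by
        by_contra hlt
        unfold qCoef eCoef at hqe
        nlinarith [mul_pos (sub_pos.2 hT) (sub_pos.2 (not_le.1 hlt))]
      obtain ⟨h1, h2, h3⟩ := logGap_le_logCoefs_four hd' hT2 hqe
      refine hasWeights_of_logGap_le (by norm_num) (by omega) (by omega) hT ?_
      intro m hm hmk
      obtain rfl | rfl | rfl : m = 1 ∨ m = 2 ∨ m = 3 := by omega
      · norm_num at h1 ⊢
        exact h1
      · norm_num at h2 ⊢
        exact h2
      · norm_num at h3 ⊢
        exact h3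

end Potts

namespace Potts

/-! ### The two-step contraction -/

/-- The arguments are moved from `V` into its convex hull one at a time, so convexity in each slot
separately is enough. -/
theorem nonneg_of_nonneg_on_vertices {ι E : Type*} [Fintype ι] [DecidableEq ι] [AddCommGroup E]
    [Module ℝ E] {V : Set E} {f : (ι → E) → ℝ}
    (hf : ∀ y l, Convex ℝ {v | 0 ≤ f (Function.update y l v)})
    (hV : ∀ y, (∀ l, y l ∈ V) → 0 ≤ f y) {y : ι → E} (hy : ∀ l, y l ∈ convexHull ℝ V) :
    0 ≤ f y := by
  have key : ∀ s : Finset ι, ∀ y : ι → E, (∀ l ∈ s, y l ∈ convexHull ℝ V) → (∀ l ∉ s, y l ∈ V) →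
      0 ≤ f y := by
    intro s
    induction s using Finset.induction_on with
    | empty => exact fun y _ h => hV y fun l => h l (Finset.notMem_empty l)
    | insert a s ha ih =>
      intro y h1 h2
      have hsub : V ⊆ {v | 0 ≤ f (Function.update y a v)} := by
        intro v hv
        apply ih
        · intro l hl
          rw [Function.update_of_ne (ne_of_mem_of_not_mem hl ha)]
          exact h1 l (Finset.mem_insert_of_mem hl)
        · intro l hl
          rcases eq_or_ne l a with rfl | hla
          · rwa [Function.update_self]
          · rw [Function.update_of_ne hla]
            exact h2 l (by simp [hla, hl])
      have := convexHull_min hsub (hf y a) (h1 a (Finset.mem_insert_self a s))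
      simpa using this
  exact key Finset.univ y (fun l _ => hy l) fun l hl => absurd (Finset.mem_univ l) hl

/-- The multilinear form whose nonnegativity expresses the two-step contraction. -/
noncomputable def multiForm {k d : ℕ} (cf : Fin k → ℝ) (y : Fin d → Fin k → ℝ) : ℝ :=
  ∑ x, cf x * ∏ l, (((d : ℝ) + 1) * ∑ c, y l c - k * y l x)

theorem convex_multiForm_update {k d : ℕ} (cf : Fin k → ℝ) (y : Fin d → Fin k → ℝ) (l : Fin d) :
    Convex ℝ {v | 0 ≤ multiForm cf (Function.update y l v)} := by
  have h : ∀ v, multiForm cf (Function.update y l v) = ∑ x, (((d : ℝ) + 1) * ∑ c, v c - k * v x) *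
      (cf x * ∏ l' ∈ Finset.univ.erase l, (((d : ℝ) + 1) * ∑ c, y l' c - k * y l' x)) := by
    intro v
    refine Finset.sum_congr rfl fun x _ => ?_
    rw [← Finset.mul_prod_erase Finset.univ _ (Finset.mem_univ l), Function.update_self,
      mul_left_comm]
    congr 2
    refine Finset.prod_congr rfl fun l' hl' => ?_
    rw [Function.update_of_ne (Finset.ne_of_mem_erase hl')]
  have hlin : IsLinearMap ℝ fun v => multiForm cf (Function.update y l v) := by
    constructor
    · intro v w
      rw [h, h, h, ← Finset.sum_add_distrib]
      refine Finset.sum_congr rfl fun x _ => ?_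
      simp only [Pi.add_apply, Finset.sum_add_distrib]
      ring
    · intro s v
      rw [h, h, smul_eq_mul, Finset.mul_sum _ _ s]
      refine Finset.sum_congr rfl fun x _ => ?_
      simp only [Pi.smul_apply, smul_eq_mul, ← Finset.mul_sum]
      ring
  exact convex_halfSpace_ge hlin 0

theorem multiForm_smul {k d : ℕ} (cf : Fin k → ℝ) (s : Fin d → ℝ) (y : Fin d → Fin k → ℝ) :
    multiForm cf (fun l => s l • y l) = (∏ l, s l) * multiForm cf y := by
  unfold multiForm
  rw [Finset.mul_sum]
  refine Finset.sum_congr rfl fun x _ => ?_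
  rw [mul_left_comm, ← Finset.prod_mul_distrib]
  congr 1
  refine Finset.prod_congr rfl fun l _ => ?_
  simp only [Pi.smul_apply, smul_eq_mul, ← Finset.mul_sum]
  ring

/-- The coefficients of the linear inequality for the colours `i` and `j`. -/
noncomputable def formCoef (k d : ℕ) (T : ℝ) (i j x : Fin k) : ℝ :=
  if x = i then T * qCoef k d T else if x = j then -tCoef k d T else eCoef d T

theorem sum_formCoef {k d : ℕ} {T : ℝ} {i j : Fin k} (hij : i ≠ j) (z : Fin k → ℝ) :
    ∑ x, formCoef k d T i j x * z x = T * qCoef k d T * z i - tCoef k d T * z j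
      + eCoef d T * ∑ x ∈ (Finset.univ.erase i).erase j, z x := by
  rw [← Finset.add_sum_erase Finset.univ _ (Finset.mem_univ i),
    ← Finset.add_sum_erase (Finset.univ.erase i) _
      (Finset.mem_erase.2 ⟨hij.symm, Finset.mem_univ j⟩), Finset.mul_sum]
  have : ∀ x ∈ (Finset.univ.erase i).erase j, formCoef k d T i j x * z x = eCoef d T * z x := by
    intro x hx
    simp only [Finset.mem_erase] at hx
    simp [formCoef, hx.1, hx.2.1]
  rw [Finset.sum_congr rfl this]
  simp [formCoef, hij.symm]
  ring

/-- Clearing denominators in the ratio bound leaves an inequality linear in `z`; this is what makes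
the reduction to vertices possible. -/
theorem sum_formCoef_eq_ratio {k d : ℕ} {T : ℝ} {i j : Fin k} (hij : i ≠ j) (z : Fin k → ℝ) :
    ∑ x, formCoef k d T i j x * z x = ratioNum k d T * (((d : ℝ) + 1) * ∑ x, z x - k * z j)
      / k - ratioDen k d T * (((d : ℝ) + 1) * ∑ x, z x - k * z i) / k := by
  have hk : (k : ℝ) ≠ 0 := by
    have := i.pos
    positivity
  rw [sum_formCoef hij, ← Finset.add_sum_erase Finset.univ z (Finset.mem_univ i),
    ← Finset.add_sum_erase (Finset.univ.erase i) z
      (Finset.mem_erase.2 ⟨hij.symm, Finset.mem_univ j⟩)]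
  field_simp
  unfold qCoef tCoef eCoef ratioNum ratioDen
  ring

section Vertex

variable {k d : ℕ} {T : ℝ} {v : Fin k → ℝ}

theorem vertex_factor (hv : ∀ x, v x = 1 ∨ v x = T ^ 2) (x : Fin k) :
    ((d : ℝ) + 1) * ∑ c, v c - k * v x = if v x = T ^ 2
      then loFactor k ((Finset.univ.filter fun x => v x = T ^ 2).card : ℕ) d T
      else hiFactor k ((Finset.univ.filter fun x => v x = T ^ 2).card : ℕ) d T := by
  have hsum : ∑ c, v c = ((Finset.univ.filter fun x => v x = T ^ 2).card : ℝ) * T ^ 2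
      + (k - ((Finset.univ.filter fun x => v x = T ^ 2).card : ℝ)) := by
    have h1 : ∀ c, v c = 1 + (if v c = T ^ 2 then T ^ 2 - 1 else 0) := by
      intro c
      split_ifs with h
      · rw [h]; ring
      · rw [(hv c).resolve_right h]; ring
    rw [Finset.sum_congr rfl fun c _ => h1 c, Finset.sum_add_distrib, ← Finset.sum_filter]
    simp
    ring
  rw [hsum]
  split_ifs with h
  · rw [h]; unfold loFactor; ring
  · rw [(hv x).resolve_right h]; unfold hiFactor; ring

theorem vertex_factor_pos (hd : 0 < d) (hkd : k ≤ d + 1) (hT : 1 < T)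
    (hv : ∀ x, v x = 1 ∨ v x = T ^ 2) (x : Fin k) :
    0 < ((d : ℝ) + 1) * ∑ c, v c - k * v x := by
  have hd' : (0 : ℝ) < d := by exact_mod_cast hd
  have hkd' : (k : ℝ) - 1 ≤ d := by
    have : (k : ℝ) ≤ d + 1 := by exact_mod_cast hkd
    linarith
  have hcard : (Finset.univ.filter fun x => v x = T ^ 2).card ≤ k := by
    simpa using Finset.card_le_univ (Finset.univ.filter fun x => v x = T ^ 2)
  rw [vertex_factor hv]
  split_ifs with h
  · have : 1 ≤ (Finset.univ.filter fun x => v x = T ^ 2).card :=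
      Finset.card_pos.2 ⟨x, by simp [h]⟩
    exact loFactor_pos hd' hkd' (by exact_mod_cast this) (by exact_mod_cast hcard) hT.le
  · rcases Nat.eq_zero_or_pos (Finset.univ.filter fun x => v x = T ^ 2).card with h0 | h0
    · rw [h0]
      have := x.pos
      simp only [hiFactor, Nat.cast_zero]
      have : (0 : ℝ) < k := by exact_mod_cast this
      simp
      positivity
    · exact hiFactor_pos hd' (by exact_mod_cast h0) (by exact_mod_cast hcard) hT.le

/-- The contribution of one child. If the entry at `j` is large, the factor at `j` is the smallest
and all logarithms are nonnegative. Otherwise each of the `m` large entries costs `logGap / d`, with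
total weight `θ₁ + (m - 1) * θ` or `m * θ` according to whether `i` is among them. -/
theorem vertex_log_sum_ge (hd : 0 < d) (hkd : k ≤ d + 1) (hT : 1 < T)
    (hv : ∀ x, v x = 1 ∨ v x = T ^ 2) {i j : Fin k} (hij : i ≠ j) {θ₁ θ Λ : ℝ} (hθ₁ : 0 < θ₁)
    (hθ : 0 < θ) (hΛ : 0 ≤ Λ)
    (h1 : ∀ m : ℕ, 1 ≤ m → m + 1 ≤ k → (θ₁ + ((m : ℝ) - 1) * θ) * logGap k m d T ≤ Λ)
    (h2 : ∀ m : ℕ, 1 ≤ m → m + 2 ≤ k → (m : ℝ) * θ * logGap k m d T ≤ Λ) :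
    -(Λ / d) ≤ θ₁ * (Real.log (((d : ℝ) + 1) * ∑ c, v c - k * v i)
        - Real.log (((d : ℝ) + 1) * ∑ c, v c - k * v j))
      + θ * ∑ x ∈ (Finset.univ.erase i).erase j,
        (Real.log (((d : ℝ) + 1) * ∑ c, v c - k * v x)
          - Real.log (((d : ℝ) + 1) * ∑ c, v c - k * v j)) := by
  have hd' : (0 : ℝ) < d := by exact_mod_cast hd
  by_cases hj : v j = T ^ 2
  · have hx : ∀ x, 0 ≤ Real.log (((d : ℝ) + 1) * ∑ c, v c - k * v x)
          - Real.log (((d : ℝ) + 1) * ∑ c, v c - k * v j) := by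
      intro x
      refine sub_nonneg.2 (Real.log_le_log (vertex_factor_pos hd hkd hT hv j) ?_)
      have h3 : v x ≤ v j := by
        rw [hj]
        rcases hv x with h | h
        · rw [h]; nlinarith
        · rw [h]
      have : (0 : ℝ) ≤ k := by positivity
      nlinarith
    have h4 : 0 ≤ ∑ x ∈ (Finset.univ.erase i).erase j,
        (Real.log (((d : ℝ) + 1) * ∑ c, v c - k * v x)
          - Real.log (((d : ℝ) + 1) * ∑ c, v c - k * v j)) := Finset.sum_nonneg fun x _ => hx x
    have h5 := hx i
    have : 0 ≤ Λ / d := by positivity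
    have := mul_nonneg hθ₁.le h5
    have := mul_nonneg hθ.le h4
    linarith
  · set A := Finset.univ.filter fun x => v x = T ^ 2 with hA
    have hjA : j ∉ A := by simp [hA, hj]
    have hx : ∀ x, Real.log (((d : ℝ) + 1) * ∑ c, v c - k * v x)
          - Real.log (((d : ℝ) + 1) * ∑ c, v c - k * v j)
          = if x ∈ A then -(logGap k (A.card : ℕ) d T / d) else 0 := by
      intro x
      rw [vertex_factor hv, vertex_factor hv, if_neg hj, ← hA]
      have : x ∈ A ↔ v x = T ^ 2 := by simp [hA]
      simp only [this]
      split_ifs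
      · unfold logGap
        field_simp
        ring
      · ring
    have hcard : (((Finset.univ.erase i).erase j).filter fun x => x ∈ A).card = (A.erase i).card := by
      congr 1
      ext x
      simp only [Finset.mem_filter, Finset.mem_erase, Finset.mem_univ, and_true]
      constructor
      · rintro ⟨⟨-, h⟩, h'⟩
        exact ⟨h, h'⟩
      · rintro ⟨h, h'⟩
        exact ⟨⟨fun e => hjA (e ▸ h'), h⟩, h'⟩
    simp only [hx]
    rw [← Finset.sum_filter, Finset.sum_const, hcard, nsmul_eq_mul]
    by_cases hi : i ∈ A
    · have hm : 1 ≤ A.card := Finset.card_pos.2 ⟨i, hi⟩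
      have hmk : A.card + 1 ≤ k := by
        have := Finset.card_le_univ (insert j A)
        rw [Finset.card_insert_of_notMem hjA] at this
        simpa using this
      rw [if_pos hi, Finset.card_erase_of_mem hi, Nat.cast_sub hm, Nat.cast_one]
      have := div_le_div_of_nonneg_right (h1 _ hm hmk) hd'.le
      have e : (θ₁ + ((A.card : ℝ) - 1) * θ) * logGap k (A.card : ℕ) d T / d
        = -(θ₁ * -(logGap k (A.card : ℕ) d T / d)
          + θ * (((A.card : ℝ) - 1) * -(logGap k (A.card : ℕ) d T / d))) := by ring
      linarith
    · rw [if_neg hi, Finset.erase_eq_of_notMem hi]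
      rcases Nat.eq_zero_or_pos A.card with h0 | hm
      · rw [h0]
        have : 0 ≤ Λ / d := by positivity
        simp
        exact this
      · have hmk : A.card + 2 ≤ k := by
          have := Finset.card_le_univ (insert i (insert j A))
          rw [Finset.card_insert_of_notMem (by simp [hij, hi]),
            Finset.card_insert_of_notMem hjA, Fintype.card_fin] at this
          exact this
        have := div_le_div_of_nonneg_right (h2 _ hm hmk) hd'.le
        have e : (A.card : ℝ) * θ * logGap k (A.card : ℕ) d T / d
          = -(θ₁ * 0 + θ * ((A.card : ℝ) * -(logGap k (A.card : ℕ) d T / d))) := by ring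
        linarith

end Vertex

/-- After division by the product at `j`, the positive terms are weighted exponentials and the
negative term is the sum of the weights. By `1 + s ≤ exp s` the weights cancel, and what remains is
additive over the children. -/
theorem multiForm_nonneg_of_vertices {k d : ℕ} {T : ℝ} (hd : 0 < d) (hkd : k ≤ d + 1) (hT : 1 < T)
    (hw : HasWeights k d T) {i j : Fin k} (hij : i ≠ j) {y : Fin d → Fin k → ℝ}
    (hy : ∀ l x, y l x = 1 ∨ y l x = T ^ 2) : 0 ≤ multiForm (formCoef k d T i j) y := by
  obtain ⟨θ₁, θ, u₁, u, hθ₁, hθ, hq, he, hsum, hΛ, h1, h2⟩ := hw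
  have hd' : (0 : ℝ) < d := by exact_mod_cast hd
  set Λ := θ₁ * u₁ + ((k : ℝ) - 2) * θ * u with hΛdef
  set Z : Fin k → Fin d → ℝ := fun x l => ((d : ℝ) + 1) * ∑ c, y l c - k * y l x with hZ
  have hZpos : ∀ x l, 0 < Z x l := fun x l => vertex_factor_pos hd hkd hT (hy l) x
  have hcard : (((Finset.univ.erase i).erase j).card : ℝ) = k - 2 := by
    have hk2 : 2 ≤ k := by
      have := Finset.card_le_univ ({i, j} : Finset (Fin k))
      rw [Finset.card_pair hij] at this
      simpa using this
    rw [Finset.card_erase_of_mem (by simp [hij.symm]), Finset.card_erase_of_mem (Finset.mem_univ i),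
      Finset.card_univ, Fintype.card_fin, Nat.sub_sub, Nat.cast_sub hk2]
    norm_num
  have hlogs : -Λ ≤ θ₁ * ∑ l, (Real.log (Z i l) - Real.log (Z j l))
      + θ * ∑ x ∈ (Finset.univ.erase i).erase j, ∑ l, (Real.log (Z x l) - Real.log (Z j l)) := by
    rw [Finset.sum_comm, Finset.mul_sum, Finset.mul_sum, ← Finset.sum_add_distrib]
    calc -Λ = ∑ _l : Fin d, -(Λ / d) := by
          rw [Finset.sum_const, Finset.card_univ, Fintype.card_fin, nsmul_eq_mul]
          field_simp
      _ ≤ _ := Finset.sum_le_sum fun l _ =>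
          vertex_log_sum_ge hd hkd hT (hy l) hij hθ₁ hθ hΛ h1 h2
  have hprod : ∀ x, ∏ l, Z x l = (∏ l, Z j l) *
      Real.exp (∑ l, (Real.log (Z x l) - Real.log (Z j l))) := by
    intro x
    rw [Real.exp_sum, ← Finset.prod_mul_distrib]
    refine Finset.prod_congr rfl fun l _ => ?_
    rw [Real.exp_sub, Real.exp_log (hZpos x l), Real.exp_log (hZpos j l)]
    have := (hZpos j l).ne'
    field_simp
  have hPj : 0 < ∏ l, Z j l := Finset.prod_pos fun l _ => hZpos j l
  have hform : multiForm (formCoef k d T i j) y = (∏ l, Z j l) *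
      (θ₁ * Real.exp (u₁ + ∑ l, (Real.log (Z i l) - Real.log (Z j l)))
        + θ * ∑ x ∈ (Finset.univ.erase i).erase j,
          Real.exp (u + ∑ l, (Real.log (Z x l) - Real.log (Z j l)))
        - (θ₁ + ((k : ℝ) - 2) * θ)) := by
    unfold multiForm
    rw [sum_formCoef hij (fun x => ∏ l, Z x l), hprod i, hq, he, ← hsum]
    simp only [Real.exp_add, ← Finset.mul_sum]
    have : ∑ x ∈ (Finset.univ.erase i).erase j, ∏ l, Z x l
        = (∏ l, Z j l) * ∑ x ∈ (Finset.univ.erase i).erase j,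
          Real.exp (∑ l, (Real.log (Z x l) - Real.log (Z j l))) := by
      rw [Finset.mul_sum]
      exact Finset.sum_congr rfl fun x _ => hprod x
    rw [this]
    ring
  rw [hform]
  refine mul_nonneg hPj.le ?_
  have g1 := mul_le_mul_of_nonneg_left
    (Real.add_one_le_exp (u₁ + ∑ l, (Real.log (Z i l) - Real.log (Z j l)))) hθ₁.le
  have g2 : θ * ∑ x ∈ (Finset.univ.erase i).erase j,
      (u + ∑ l, (Real.log (Z x l) - Real.log (Z j l)) + 1) ≤
      θ * ∑ x ∈ (Finset.univ.erase i).erase j,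
          Real.exp (u + ∑ l, (Real.log (Z x l) - Real.log (Z j l))) :=
    mul_le_mul_of_nonneg_left (Finset.sum_le_sum fun x _ => Real.add_one_le_exp _) hθ.le
  rw [Finset.sum_add_distrib, Finset.sum_add_distrib, Finset.sum_const, Finset.sum_const,
    nsmul_eq_mul, nsmul_eq_mul, hcard] at g2
  linarith

/-- Vectors with positive entries whose ratios are at most `C`. -/
def ratioSet (k : ℕ) (C : ℝ) : Set (Fin k → ℝ) :=
  {y | (∀ i, 0 < y i) ∧ ∀ i j, y i ≤ C * y j}

/-- Division by the smallest entry puts the vector into the cube `[1, C] ^ k`, the convex hull of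
its corners. -/
theorem exists_smul_mem_convexHull {k : ℕ} {C : ℝ} (hk : 0 < k) (hC : 1 ≤ C) {y : Fin k → ℝ}
    (hy : y ∈ ratioSet k C) :
    ∃ s : ℝ, 0 < s ∧ ∃ v ∈ convexHull ℝ {v : Fin k → ℝ | ∀ x, v x = 1 ∨ v x = C}, y = s • v := by
  have : Nonempty (Fin k) := ⟨⟨0, hk⟩⟩
  obtain ⟨i, hi⟩ := Finite.exists_min y
  refine ⟨y i, hy.1 i, (y i)⁻¹ • y, ?_, ?_⟩
  · have e : {v : Fin k → ℝ | ∀ x, v x = 1 ∨ v x = C}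
        = Set.pi Set.univ (fun _ => ({1, C} : Set ℝ)) := by
      ext v
      simp
    rw [e, convexHull_pi]
    intro x _
    rw [convexHull_pair, segment_eq_Icc hC]
    have h0 := hy.1 i
    simp only [Pi.smul_apply, smul_eq_mul, Set.mem_Icc]
    constructor
    · rw [← div_eq_inv_mul, le_div_iff₀ h0, one_mul]
      exact hi x
    · rw [← div_eq_inv_mul, div_le_iff₀ h0]
      exact hy.2 x i
  · rw [smul_smul, mul_inv_cancel₀ (hy.1 i).ne', one_smul]

theorem multiForm_nonneg {k d : ℕ} {T : ℝ} (hd : 0 < d) (hkd : k ≤ d + 1) (hT : 1 < T)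
    (hw : HasWeights k d T) {i j : Fin k} (hij : i ≠ j) {y : Fin d → Fin k → ℝ}
    (hy : ∀ l, y l ∈ ratioSet k (T ^ 2)) : 0 ≤ multiForm (formCoef k d T i j) y := by
  choose s hs v hv hyv using fun l => exists_smul_mem_convexHull i.pos (one_le_pow₀ hT.le) (hy l)
  have : y = fun l => s l • v l := funext hyv
  rw [this, multiForm_smul]
  refine mul_nonneg (Finset.prod_nonneg fun l _ => (hs l).le) ?_
  exact nonneg_of_nonneg_on_vertices (V := {v : Fin k → ℝ | ∀ x, v x = 1 ∨ v x = T ^ 2}) (convex_multiForm_update _)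
    (fun y hy => multiForm_nonneg_of_vertices hd hkd hT hw hij hy) hv

/-- The two-step contraction before taking the second product. -/
theorem ratioDen_mul_le {k d : ℕ} {T : ℝ} (hk : 2 ≤ k) (hd : 0 < d) (hkd : k ≤ d + 1) (hT : 1 < T)
    (hw : HasWeights k d T) {y : Fin d → Fin k → ℝ} (hy : ∀ l, y l ∈ ratioSet k (T ^ 2))
    {z : Fin k → ℝ} (hz : ∀ x, z x = ∏ l, (((d : ℝ) + 1) * ∑ c, y l c - k * y l x))
    (i j : Fin k) (hpos : 0 ≤ ((d : ℝ) + 1) * ∑ x, z x - k * z j) :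
    ratioDen k d T * (((d : ℝ) + 1) * ∑ x, z x - k * z i)
      ≤ ratioNum k d T * (((d : ℝ) + 1) * ∑ x, z x - k * z j) := by
  rcases eq_or_ne i j with rfl | hij
  · exact mul_le_mul_of_nonneg_right (ratioDen_le_ratioNum (by positivity) hT.le) hpos
  · have h := multiForm_nonneg hd hkd hT hw hij hy
    have e : multiForm (formCoef k d T i j) y = ∑ x, formCoef k d T i j x * z x :=
      Finset.sum_congr rfl fun x _ => by rw [hz]
    rw [e, sum_formCoef_eq_ratio hij, sub_nonneg] at h
    have hk0 : (0 : ℝ) < k := by exact_mod_cast (by omega : 0 < k)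
    exact (div_le_div_iff_of_pos_right hk0).1 h

end Potts

namespace Potts

/-! ### The tree recursion -/

/-- One step of the recursion for the partition functions of rooted `d`-ary trees. -/
noncomputable def treeStep {k d : ℕ} (a : ℝ) (y : Fin d → Fin k → ℝ) : Fin k → ℝ :=
  fun i => ∏ l, (∑ c, y l c - a * y l i)

/-- The vectors reached by `n` steps of the tree recursion. -/
def reach (k d : ℕ) (a : ℝ) : ℕ → Set (Fin k → ℝ)
  | 0 => {y | (∀ i, 0 ≤ y i) ∧ 0 < ∑ i, y i}
  | n + 1 => {z | ∃ y : Fin d → Fin k → ℝ, (∀ l, y l ∈ reach k d a n) ∧ z = treeStep a y}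

theorem sub_mul_pos {k : ℕ} {a : ℝ} (ha1 : a < 1) {y : Fin k → ℝ} (hy : ∀ i, 0 ≤ y i)
    (hS : 0 < ∑ i, y i) (i : Fin k) : 0 < ∑ c, y c - a * y i := by
  have h := Finset.single_le_sum (f := y) (fun c _ => hy c) (Finset.mem_univ i)
  rcases (hy i).eq_or_lt with h0 | h0
  · rw [← h0]; simpa using hS
  · nlinarith

theorem treeStep_pos {k d : ℕ} {a : ℝ} (ha1 : a < 1) {y : Fin d → Fin k → ℝ}
    (hy : ∀ l, (∀ i, 0 ≤ y l i) ∧ 0 < ∑ i, y l i) (i : Fin k) : 0 < treeStep a y i :=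
  Finset.prod_pos fun l _ => sub_mul_pos ha1 (hy l).1 (hy l).2 i

theorem ratioSet_mono {k : ℕ} {C C' : ℝ} (h : C ≤ C') : ratioSet k C ⊆ ratioSet k C' :=
  fun _ hy => ⟨hy.1, fun i j => (hy.2 i j).trans (mul_le_mul_of_nonneg_right h (hy.1 j).le)⟩

/-- The amount of mixing with the uniform vector which turns the recursion with parameter `a`
into the critical one. -/
noncomputable def mixAmount (k d : ℕ) (a : ℝ) : ℝ := (k / a - (d + 1)) / (k * d)

noncomputable def mixRatio (ε C : ℝ) : ℝ := (C + ε) / (1 + ε)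

/-- The critical two-step contraction factor. -/
noncomputable def contractRatio (k d : ℕ) (T : ℝ) : ℝ := (ratioNum k d T / ratioDen k d T) ^ d

section Step

variable {k d : ℕ} {a : ℝ}

theorem mixAmount_nonneg (ha0 : 0 < a) (ha : a * (d + 1) ≤ k) : 0 ≤ mixAmount k d a := by
  refine div_nonneg (sub_nonneg.2 ?_) (by positivity)
  rw [le_div_iff₀ ha0]
  linarith

theorem mixAmount_pos (hk : 0 < k) (hd : 0 < d) (ha0 : 0 < a) (ha : a * (d + 1) < k) :
    0 < mixAmount k d a := by
  have hk' : (0 : ℝ) < k := by exact_mod_cast hk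
  have hd' : (0 : ℝ) < d := by exact_mod_cast hd
  refine div_pos (sub_pos.2 ?_) (by positivity)
  rw [lt_div_iff₀ ha0]
  linarith

theorem mix_factor (hk : 0 < k) (hd : 0 < d) (ha0 : 0 < a) (y : Fin k → ℝ) (i : Fin k) :
    ((d : ℝ) + 1) * ∑ c, (y c + mixAmount k d a * ∑ x, y x)
        - k * (y i + mixAmount k d a * ∑ x, y x)
      = k / a * (∑ c, y c - a * y i) := by
  have hk' : (0 : ℝ) < k := by exact_mod_cast hk
  have hd' : (0 : ℝ) < d := by exact_mod_cast hd
  rw [Finset.sum_add_distrib, Finset.sum_const, Finset.card_univ, Fintype.card_fin, nsmul_eq_mul]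
  have : mixAmount k d a * (k * d) = k / a - (d + 1) := by
    unfold mixAmount
    field_simp
  have e : ((d : ℝ) + 1) * (∑ c, y c + k * (mixAmount k d a * ∑ x, y x))
        - k * (y i + mixAmount k d a * ∑ x, y x)
      = ((d : ℝ) + 1) * ∑ c, y c - k * y i + mixAmount k d a * (k * d) * ∑ x, y x := by ring
  rw [e, this]
  field_simp
  ring

/-- With `S` the sum of the entries, `(C * y j + ε * S) / (y j + ε * S)` is nonincreasing in `S`,
and `S ≥ y j`. -/
theorem mix_mem_ratioSet {ε C : ℝ} (hε : 0 ≤ ε) (hC : 1 ≤ C) {y : Fin k → ℝ}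
    (hy : y ∈ ratioSet k C) : (fun i => y i + ε * ∑ x, y x) ∈ ratioSet k (mixRatio ε C) := by
  have hS : ∀ j, y j ≤ ∑ x, y x := fun j =>
    Finset.single_le_sum (f := y) (fun c _ => (hy.1 c).le) (Finset.mem_univ j)
  constructor
  · intro i
    have h1 := hy.1 i
    have h2 := hS i
    have := mul_nonneg hε (h1.le.trans h2)
    linarith
  · intro i j
    have h1 := hy.2 i j
    have h2 := hS j
    have h3 : 0 < 1 + ε := by linarith
    show y i + ε * ∑ x, y x ≤ mixRatio ε C * (y j + ε * ∑ x, y x)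
    unfold mixRatio
    rw [div_mul_eq_mul_div, le_div_iff₀ h3]
    have h4 : 0 ≤ ε * (C - 1) * (∑ x, y x - y j) :=
      mul_nonneg (mul_nonneg hε (by linarith)) (by linarith)
    nlinarith

theorem mixRatio_le {ε C : ℝ} (hε : 0 ≤ ε) (hC : 1 ≤ C) : mixRatio ε C ≤ C := by
  unfold mixRatio
  rw [div_le_iff₀ (by linarith)]
  nlinarith

theorem mixRatio_lt {ε C : ℝ} (hε : 0 < ε) (hC : 1 < C) : mixRatio ε C < C := by
  unfold mixRatio
  rw [div_lt_iff₀ (by linarith)]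
  nlinarith

theorem one_lt_mixRatio {ε C : ℝ} (hε : 0 ≤ ε) (hC : 1 < C) : 1 < mixRatio ε C := by
  unfold mixRatio
  rw [lt_div_iff₀ (by linarith)]
  linarith

/-- Mixing turns the first step into a critical one up to a constant, with inputs of ratio at most
`T ^ 2`. The second step bounds each of its `d` factors separately, whence the power `d` in
`contractRatio`. -/
theorem treeStep_treeStep_mem (hk : 2 ≤ k) (hd : 0 < d) (hkd : k ≤ d + 1) (ha0 : 0 < a)
    (ha1 : a < 1) (ha : a * (d + 1) ≤ k) {C T : ℝ} (hC : 1 ≤ C) (hT : 1 < T)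
    (hCT : mixRatio (mixAmount k d a) C = T ^ 2) (hw : HasWeights k d T)
    {y : Fin d → Fin d → Fin k → ℝ} (hy : ∀ l l', y l l' ∈ ratioSet k C) :
    treeStep a (fun l => treeStep a (y l)) ∈ ratioSet k (contractRatio k d T) := by
  have hk0 : 0 < k := by omega
  have hk' : (2 : ℝ) ≤ k := by exact_mod_cast hk
  have hd' : (0 : ℝ) < d := by exact_mod_cast hd
  have hkd' : (k : ℝ) - 1 ≤ d := by
    have : (k : ℝ) ≤ d + 1 := by exact_mod_cast hkd
    linarith
  have hne : Nonempty (Fin k) := ⟨⟨0, hk0⟩⟩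
  have hden := ratioDen_pos hk' hd' hkd' hT.le
  have hle := ratioDen_le_ratioNum (d := d) (by linarith : (0 : ℝ) ≤ k) hT.le
  have hpos1 : ∀ l i, 0 < treeStep a (y l) i := fun l i => treeStep_pos ha1 (fun l' =>
    ⟨fun i => ((hy l l').1 i).le, Finset.sum_pos (fun i _ => (hy l l').1 i)
      Finset.univ_nonempty⟩) i
  have hS1 : ∀ l, 0 < ∑ i, treeStep a (y l) i := fun l =>
    Finset.sum_pos (fun i _ => hpos1 l i) Finset.univ_nonempty
  have hfac : ∀ l i, 0 < ∑ c, treeStep a (y l) c - a * treeStep a (y l) i := fun l i =>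
    sub_mul_pos ha1 (fun i => (hpos1 l i).le) (hS1 l) i
  have hcrit : ∀ l i j,
      ratioDen k d T * (∑ c, treeStep a (y l) c - a * treeStep a (y l) i)
        ≤ ratioNum k d T * (∑ c, treeStep a (y l) c - a * treeStep a (y l) j) := by
    intro l i j
    set z := treeStep a (y l) with hz
    have hka : 0 < (k : ℝ) / a := by positivity
    have hD : 0 ≤ (k : ℝ) / a - (d + 1) := by
      rw [sub_nonneg, le_div_iff₀ ha0]
      linarith
    have hprod : ∀ x, ((k : ℝ) / a) ^ d * z x = ∏ l', (((d : ℝ) + 1) *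
        ∑ c, (y l l' c + mixAmount k d a * ∑ x, y l l' x)
          - k * (y l l' x + mixAmount k d a * ∑ x, y l l' x)) := by
      intro x
      rw [Finset.prod_congr rfl fun l' _ => mix_factor hk0 hd ha0 (y l l') x,
        Finset.prod_mul_distrib, Finset.prod_const, Finset.card_univ, Fintype.card_fin]
      rfl
    have hpos : 0 ≤ ((d : ℝ) + 1) * ∑ x, z x - k * z j := by
      have h5 : z j ≤ ∑ x, z x := Finset.single_le_sum (f := z)
        (fun c _ => (hpos1 l c).le) (Finset.mem_univ j)
      have h6 : 0 < ∑ x, z x := hS1 l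
      nlinarith
    have h0 : ∀ l', (fun c => y l l' c + mixAmount k d a * ∑ x, y l l' x) ∈
        ratioSet k (T ^ 2) := fun l' =>
      hCT ▸ mix_mem_ratioSet (mixAmount_nonneg ha0 ha) hC (hy l l')
    have hka' : 0 < ((k : ℝ) / a) ^ d := by positivity
    have h1 := ratioDen_mul_le (z := fun x => ((k : ℝ) / a) ^ d * z x) hk hd hkd hT hw h0 hprod i j
      (by
        rw [← Finset.mul_sum]
        nlinarith [mul_nonneg hka'.le hpos])
    have h2 : ratioDen k d T * (((d : ℝ) + 1) * ∑ x, z x - k * z i)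
        ≤ ratioNum k d T * (((d : ℝ) + 1) * ∑ x, z x - k * z j) := by
      rw [← mul_le_mul_iff_right₀ hka']
      simp only [← Finset.mul_sum] at h1
      linarith
    -- Up to scaling, the factor for `a` is the critical factor plus a nonnegative term independent
    -- of the colour, which can only bring ratios closer to `1`.
    have h3 : ∀ i, (k : ℝ) / a * (∑ c, z c - a * z i) =
        ((d : ℝ) + 1) * ∑ x, z x - k * z i + (k / a - (d + 1)) * ∑ x, z x := by
      intro i
      field_simp
      ring
    have h4 : ratioDen k d T * ((k / a - (d + 1)) * ∑ x, z x) ≤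
        ratioNum k d T * ((k / a - (d + 1)) * ∑ x, z x) :=
      mul_le_mul_of_nonneg_right hle (mul_nonneg hD (hS1 l).le)
    rw [← mul_le_mul_iff_right₀ hka, mul_left_comm, mul_left_comm ((k : ℝ) / a), h3, h3]
    linarith
  refine ⟨fun i => Finset.prod_pos fun l _ => hfac l i, fun i j => ?_⟩
  unfold contractRatio
  have e : (ratioNum k d T / ratioDen k d T) ^ d
      = ∏ _l : Fin d, ratioNum k d T / ratioDen k d T := by
    rw [Finset.prod_const, Finset.card_univ, Fintype.card_fin]
  rw [e]
  unfold treeStep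
  rw [← Finset.prod_mul_distrib]
  refine Finset.prod_le_prod (fun l _ => (hfac l i).le) fun l _ => ?_
  have h : ∑ c, treeStep a (y l) c - a * treeStep a (y l) i ≤ ratioNum k d T / ratioDen k d T *
      (∑ c, treeStep a (y l) c - a * treeStep a (y l) j) := by
    rw [div_mul_eq_mul_div, le_div_iff₀ hden, mul_comm]
    exact hcrit l i j
  exact h

end Step

/-- Replaces a limit of iterates: let `c` be the infimum of the attained bounds up to `x₀`. If no
bound is below `b`, then `G c < c`, and by continuity `G` sends attained bounds near `c` below `c`,
a contradiction. -/
theorem exists_lt_of_continuousOn {G : ℝ → ℝ} {b x₀ : ℝ}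
    (hG : ContinuousOn G (Set.Icc b x₀)) (hlt : ∀ x ∈ Set.Icc b x₀, G x < x) {Q : ℝ → Prop}
    (h0 : Q x₀) (hQ : ∀ x ∈ Set.Icc b x₀, Q x → Q (G x)) : ∃ x < b, Q x := by
  by_contra hcon
  push Not at hcon
  have hbd : ∀ x, Q x → b ≤ x := fun x hx => not_lt.1 fun h => hcon x h hx
  set s := {x | Q x ∧ x ≤ x₀} with hs
  have hne : s.Nonempty := ⟨x₀, h0, le_rfl⟩
  have hbb : BddBelow s := ⟨b, fun x hx => hbd x hx.1⟩
  set c := sInf s with hc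
  have hcb : b ≤ c := le_csInf hne fun x hx => hbd x hx.1
  have hcx : c ≤ x₀ := csInf_le hbb ⟨h0, le_rfl⟩
  have hcI : c ∈ Set.Icc b x₀ := ⟨hcb, hcx⟩
  have hev : ∀ᶠ x in nhdsWithin c (Set.Icc b x₀), G x < c :=
    (hG c hcI).eventually (gt_mem_nhds (hlt c hcI))
  rw [Filter.Eventually, Metric.mem_nhdsWithin_iff] at hev
  obtain ⟨δ, hδ, hball⟩ := hev
  obtain ⟨x, hx, hxc⟩ := exists_lt_of_csInf_lt hne (by linarith : sInf s < c + δ)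
  have hcx' : c ≤ x := csInf_le hbb hx
  have hxI : x ∈ Set.Icc b x₀ := ⟨hcb.trans hcx', hx.2⟩
  have hGx : G x < c := hball ⟨by
    rw [Metric.mem_ball, Real.dist_eq, abs_of_nonneg (by linarith)]
    linarith, hxI⟩
  have : c ≤ G x := csInf_le hbb ⟨hQ x hxI hx.1, by linarith⟩
  linarith

end Potts

/-! ### A priori bounds for `k = 3`, `d = 2`, and convergence of the recursion -/

namespace Potts

/-- Vectors whose normalized entries lie in `[m, M]`. -/
def boxSet (k : ℕ) (m M : ℝ) : Set (Fin k → ℝ) :=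
  {y | 0 < ∑ x, y x ∧ ∀ i, m * ∑ x, y x ≤ y i ∧ y i ≤ M * ∑ x, y x}

theorem reach_mono_of_subset {k d : ℕ} {a : ℝ} {n : ℕ} {A B : Set (Fin k → ℝ)}
    (hn : reach k d a n ⊆ A) (h : ∀ y : Fin d → Fin k → ℝ, (∀ l, y l ∈ A) → treeStep a y ∈ B) :
    reach k d a (n + 1) ⊆ B := by
  rintro _ ⟨y, hy, rfl⟩
  exact h y fun l => hn (hy l)

section Marginal

variable {m M p₁ p₂ p₃ q₁ q₂ q₃ : ℝ}

/-- The extremal case is `p₁ = m`, `p₂ = M`, where `1 - p₃ = M + m`. -/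
theorem mul_le_one_sub_mul_one_sub (hp : p₁ + p₂ + p₃ = 1) (hM : M ≤ 1) (h1 : m ≤ p₁) (h2 : p₂ ≤ M)
    (h3 : p₃ ≤ M) : (1 - M) * (M + m) ≤ (1 - p₂) * (1 - p₃) := by
  nlinarith [mul_nonneg (sub_nonneg.2 h2) (sub_nonneg.2 h3),
    mul_nonneg (sub_nonneg.2 hM) (sub_nonneg.2 h1)]

theorem two_mul_le_add_of_sq_le {c x y : ℝ} (hx : 0 ≤ x) (hy : 0 ≤ y)
    (h : c ^ 2 ≤ x * y) : 2 * c ≤ x + y := by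
  by_contra hlt
  nlinarith [sq_nonneg (x - y), mul_self_lt_mul_self (by linarith : 0 ≤ x + y) (not_le.1 hlt)]

/-- The two competing colours are bounded below together, by the arithmetic-geometric mean
inequality; bounding each alone would lose too much. It limits the normalized output entry of the
first colour. -/
theorem marginal_upper (hp : p₁ + p₂ + p₃ = 1) (hq : q₁ + q₂ + q₃ = 1) (hm : 0 ≤ m) (hM : M ≤ 1)
    (hM0 : 0 ≤ M) (hp₁ : m ≤ p₁) (hq₁ : m ≤ q₁) (hp₂ : p₂ ≤ M) (hp₃ : p₃ ≤ M) (hq₂ : q₂ ≤ M)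
    (hq₃ : q₃ ≤ M) (hp₁' : p₁ ≤ M) (hq₁' : q₁ ≤ M) :
    2 * ((1 - M) * (M + m)) * ((1 - p₁) * (1 - q₁)) ≤
      (1 - m) ^ 2 * ((1 - p₂) * (1 - q₂) + (1 - p₃) * (1 - q₃)) := by
  have h1 := mul_le_one_sub_mul_one_sub hp hM hp₁ hp₂ hp₃
  have h2 := mul_le_one_sub_mul_one_sub hq hM hq₁ hq₂ hq₃
  have hc : 0 ≤ (1 - M) * (M + m) := mul_nonneg (by linarith) (by linarith)
  have h3 : 2 * ((1 - M) * (M + m)) ≤ (1 - p₂) * (1 - q₂) + (1 - p₃) * (1 - q₃) := by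
    apply two_mul_le_add_of_sq_le
    · exact mul_nonneg (by linarith) (by linarith)
    · exact mul_nonneg (by linarith) (by linarith)
    · have := mul_le_mul h1 h2 hc (hc.trans h1)
      linarith
  have h4 : (1 - p₁) * (1 - q₁) ≤ (1 - m) ^ 2 := by
    rw [sq]
    exact mul_le_mul (by linarith) (by linarith) (by linarith) (by linarith)
  have h5 : 0 ≤ (1 - p₁) * (1 - q₁) := mul_nonneg (by linarith) (by linarith)
  calc _ ≤ 2 * ((1 - M) * (M + m)) * (1 - m) ^ 2 := mul_le_mul_of_nonneg_left h4 (by linarith)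
    _ = (1 - m) ^ 2 * (2 * ((1 - M) * (M + m))) := by ring
    _ ≤ _ := mul_le_mul_of_nonneg_left h3 (by positivity)

end Marginal

/-- The mixed and normalized vector. -/
noncomputable def mixNormalize (a : ℝ) (y : Fin 3 → ℝ) (i : Fin 3) : ℝ :=
  (y i + mixAmount 3 2 a * ∑ x, y x) / ((1 + 3 * mixAmount 3 2 a) * ∑ x, y x)

section ThreeTwo

variable {a : ℝ}

theorem treeStep_eq_mixNormalize (ha0 : 0 < a) (ha1 : a < 1) {y : Fin 2 → Fin 3 → ℝ}
    (hy : ∀ l, 0 < ∑ x, y l x) :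
    ∃ κ : ℝ, 0 < κ ∧ ∀ i, treeStep a y i =
      κ * ((1 - mixNormalize a (y 0) i) * (1 - mixNormalize a (y 1) i)) := by
  have hε : 0 ≤ mixAmount 3 2 a := mixAmount_nonneg ha0 (by norm_num; linarith)
  have key : ∀ l i, ∑ c, y l c - a * y l i =
      a * ((1 + 3 * mixAmount 3 2 a) * ∑ x, y l x) * (1 - mixNormalize a (y l) i) := by
    intro l i
    have h := mix_factor (k := 3) (d := 2) (by norm_num) (by norm_num) ha0 (y l) i
    rw [Finset.sum_add_distrib, Finset.sum_const, Finset.card_univ, Fintype.card_fin] at h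
    have h3 : 0 < (1 + 3 * mixAmount 3 2 a) * ∑ x, y l x :=
      mul_pos (by linarith) (hy l)
    rw [mul_assoc, mul_sub, mul_one, mixNormalize, mul_div_cancel₀ _ h3.ne']
    norm_num at h
    rw [eq_comm, div_mul_eq_mul_div, div_eq_iff ha0.ne'] at h
    linarith
  refine ⟨a * ((1 + 3 * mixAmount 3 2 a) * ∑ x, y 0 x) *
    (a * ((1 + 3 * mixAmount 3 2 a) * ∑ x, y 1 x)), ?_, fun i => ?_⟩
  · have := hy 0
    have := hy 1
    positivity
  · rw [treeStep, Fin.prod_univ_two, key, key]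
    ring

theorem sum_mixNormalize (ha0 : 0 < a) (ha1 : a < 1) {y : Fin 3 → ℝ} (hy : 0 < ∑ x, y x) :
    mixNormalize a y 0 + mixNormalize a y 1 + mixNormalize a y 2 = 1 := by
  have hε : 0 ≤ mixAmount 3 2 a := mixAmount_nonneg ha0 (by norm_num; linarith)
  have h3 : 0 < (1 + 3 * mixAmount 3 2 a) * ∑ x, y x := mul_pos (by linarith) hy
  unfold mixNormalize
  rw [← add_div, ← add_div, div_eq_one_iff_eq h3.ne', Fin.sum_univ_three]
  ring

theorem mixNormalize_bounds (ha0 : 0 < a) (ha1 : a < 1) {m M m' M' : ℝ}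
    (hm : m' * (1 + 3 * mixAmount 3 2 a) ≤ m + mixAmount 3 2 a)
    (hM : M + mixAmount 3 2 a ≤ M' * (1 + 3 * mixAmount 3 2 a)) {y : Fin 3 → ℝ}
    (hy : y ∈ boxSet 3 m M) (i : Fin 3) :
    m' ≤ mixNormalize a y i ∧ mixNormalize a y i ≤ M' := by
  have hε : 0 ≤ mixAmount 3 2 a := mixAmount_nonneg ha0 (by norm_num; linarith)
  obtain ⟨hS, hy⟩ := hy
  have h3 : 0 < (1 + 3 * mixAmount 3 2 a) * ∑ x, y x := mul_pos (by linarith) hS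
  unfold mixNormalize
  rw [le_div_iff₀ h3, div_le_iff₀ h3]
  have h1 := mul_le_mul_of_nonneg_right hm hS.le
  have h2 := mul_le_mul_of_nonneg_right hM hS.le
  constructor
  · linarith [(hy i).1]
  · linarith [(hy i).2]

theorem treeStep_mem_boxSet (ha0 : 0 < a) (ha1 : a < 1) {m M m₁ M₁ m' M' : ℝ}
    (hm₁ : m₁ * (1 + 3 * mixAmount 3 2 a) ≤ m + mixAmount 3 2 a)
    (hM₁ : M + mixAmount 3 2 a ≤ M₁ * (1 + 3 * mixAmount 3 2 a)) (h0 : 0 ≤ m₁) (h1 : M₁ < 1)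
    (hM0 : 0 ≤ M₁) (hm' : m' * ((1 - M₁) ^ 2 + 2) ≤ (1 - M₁) ^ 2) (hm0 : 0 ≤ m')
    (hM' : (1 - m₁) ^ 2 ≤ M' * ((1 - m₁) ^ 2 + 2 * ((1 - M₁) * (M₁ + m₁))))
    {y : Fin 2 → Fin 3 → ℝ} (hy : ∀ l, y l ∈ boxSet 3 m M) :
    treeStep a y ∈ boxSet 3 m' M' := by
  obtain ⟨κ, hκ, hstep⟩ := treeStep_eq_mixNormalize ha0 ha1 fun l => (hy l).1
  have hb := fun l i => mixNormalize_bounds ha0 ha1 hm₁ hM₁ (hy l) i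
  have hs := fun l => sum_mixNormalize ha0 ha1 (hy l).1
  set p := mixNormalize a (y 0)
  set q := mixNormalize a (y 1)
  have hp : ∀ i, m₁ ≤ p i ∧ p i ≤ M₁ := hb 0
  have hq : ∀ i, m₁ ≤ q i ∧ q i ≤ M₁ := hb 1
  have hps : p 0 + p 1 + p 2 = 1 := hs 0
  have hqs : q 0 + q 1 + q 2 = 1 := hs 1
  have hpos : ∀ i, 0 < (1 - p i) * (1 - q i) := fun i =>
    mul_pos (by linarith [(hp i).2]) (by linarith [(hq i).2])
  have hle1 : ∀ i, (1 - p i) * (1 - q i) ≤ 1 := fun i =>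
    mul_le_one₀ (by linarith [(hp i).1]) (by linarith [(hq i).2]) (by linarith [(hq i).1])
  have hge : ∀ i, (1 - M₁) ^ 2 ≤ (1 - p i) * (1 - q i) := fun i => by
    rw [sq]
    exact mul_le_mul (by linarith [(hp i).2]) (by linarith [(hq i).2]) (by linarith)
      (by linarith [(hp i).2])
  have main : ∀ i j l, p i + p j + p l = 1 → q i + q j + q l = 1 →
      m' * ((1 - p i) * (1 - q i) + (1 - p j) * (1 - q j) + (1 - p l) * (1 - q l))
        ≤ (1 - p i) * (1 - q i) ∧
      (1 - p i) * (1 - q i) ≤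
        M' * ((1 - p i) * (1 - q i) + (1 - p j) * (1 - q j) + (1 - p l) * (1 - q l)) := by
    intro i j l hpi hqi
    constructor
    · have hm1 : m' ≤ 1 := by nlinarith [sq_nonneg (1 - M₁)]
      have e1 := mul_le_mul_of_nonneg_left (add_le_add (hle1 j) (hle1 l)) hm0
      have e2 := mul_le_mul_of_nonneg_left (hge i) (sub_nonneg.2 hm1)
      linarith
    · have h := marginal_upper hpi hqi h0 h1.le hM0 (hp i).1 (hq i).1 (hp j).2 (hp l).2 (hq j).2
        (hq l).2 (hp i).2 (hq i).2
      have hm1 : m₁ < 1 := lt_of_le_of_lt ((hp 0).1.trans (hp 0).2) h1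
      have hc : 0 ≤ (1 - M₁) * (M₁ + m₁) := mul_nonneg (by linarith) (by linarith)
      have hD : 0 < (1 - m₁) ^ 2 + 2 * ((1 - M₁) * (M₁ + m₁)) := by
        have : 0 < (1 - m₁) ^ 2 := pow_pos (by linarith) 2
        linarith
      have hsum : 0 < (1 - p i) * (1 - q i) + (1 - p j) * (1 - q j) + (1 - p l) * (1 - q l) := by
        linarith [hpos i, hpos j, hpos l]
      have e1 := mul_le_mul_of_nonneg_right hM' hsum.le
      rw [← mul_le_mul_iff_left₀ hD]
      linarith
  have hsumstep : ∑ x, treeStep a y x = κ * ((1 - p 0) * (1 - q 0) + (1 - p 1) * (1 - q 1)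
      + (1 - p 2) * (1 - q 2)) := by
    rw [Fin.sum_univ_three, hstep, hstep, hstep]
    ring
  refine ⟨?_, fun i => ?_⟩
  · rw [hsumstep]
    have := hpos 0
    have := hpos 1
    have := hpos 2
    positivity
  · rw [hsumstep, hstep]
    have : m' * ((1 - p 0) * (1 - q 0) + (1 - p 1) * (1 - q 1) + (1 - p 2) * (1 - q 2))
        ≤ (1 - p i) * (1 - q i) ∧ (1 - p i) * (1 - q i) ≤
        M' * ((1 - p 0) * (1 - q 0) + (1 - p 1) * (1 - q 1) + (1 - p 2) * (1 - q 2)) := by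
      fin_cases i
      · exact main 0 1 2 hps hqs
      · have := main 1 0 2 (by linarith) (by linarith)
        constructor
        · refine le_of_eq_of_le ?_ this.1
          ring
        · refine le_of_le_of_eq this.2 ?_
          ring
      · have := main 2 0 1 (by linarith) (by linarith)
        constructor
        · refine le_of_eq_of_le ?_ this.1
          ring
        · refine le_of_le_of_eq this.2 ?_
          ring
    constructor
    · have := mul_le_mul_of_nonneg_left this.1 hκ.le
      linarith
    · have := mul_le_mul_of_nonneg_left this.2 hκ.le
      linarith

/-- Mixing pulls normalized entries towards `1 / 3`, so a box around `1 / 3` is preserved and the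
mixing amount disappears from the conditions. -/
theorem treeStep_mem_boxSet_of_fixed (ha0 : 0 < a) (ha1 : a < 1) {m M m' M' : ℝ}
    (h0 : 0 ≤ m) (hm3 : m ≤ 1 / 3) (hM3 : 1 / 3 ≤ M) (h1 : M < 1)
    (hm' : m' * ((1 - M) ^ 2 + 2) ≤ (1 - M) ^ 2) (hm0 : 0 ≤ m')
    (hM' : (1 - m) ^ 2 ≤ M' * ((1 - m) ^ 2 + 2 * ((1 - M) * (M + m))))
    {y : Fin 2 → Fin 3 → ℝ} (hy : ∀ l, y l ∈ boxSet 3 m M) :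
    treeStep a y ∈ boxSet 3 m' M' := by
  have hε : 0 ≤ mixAmount 3 2 a := mixAmount_nonneg ha0 (by norm_num; linarith)
  exact treeStep_mem_boxSet ha0 ha1 (m₁ := m) (M₁ := M) (by nlinarith) (by nlinarith) h0 h1
    (by linarith) hm' hm0 hM' hy

theorem treeStep_mem_ratioSet_of_boxSet (ha0 : 0 < a) (ha1 : a < 1) {m M C : ℝ}
    (hm3 : m ≤ 1 / 3) (hM3 : 1 / 3 ≤ M) (h1 : M < 1) (hC0 : 0 ≤ C)
    (hC : (1 - m) ^ 2 ≤ C * (1 - M) ^ 2)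
    {y : Fin 2 → Fin 3 → ℝ} (hy : ∀ l, y l ∈ boxSet 3 m M) :
    treeStep a y ∈ ratioSet 3 C := by
  have hε : 0 ≤ mixAmount 3 2 a := mixAmount_nonneg ha0 (by norm_num; linarith)
  obtain ⟨κ, hκ, hstep⟩ := treeStep_eq_mixNormalize ha0 ha1 fun l => (hy l).1
  have hb := fun l i => mixNormalize_bounds ha0 ha1 (m' := m) (M' := M) (by nlinarith)
    (by nlinarith) (hy l) i
  set p := mixNormalize a (y 0)
  set q := mixNormalize a (y 1)
  have hp : ∀ i, m ≤ p i ∧ p i ≤ M := hb 0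
  have hq : ∀ i, m ≤ q i ∧ q i ≤ M := hb 1
  have hle : ∀ i, (1 - p i) * (1 - q i) ≤ (1 - m) ^ 2 := fun i => by
    rw [sq]
    exact mul_le_mul (by linarith [(hp i).1]) (by linarith [(hq i).1]) (by linarith [(hq i).2])
      (by linarith)
  have hge : ∀ i, (1 - M) ^ 2 ≤ (1 - p i) * (1 - q i) := fun i => by
    rw [sq]
    exact mul_le_mul (by linarith [(hp i).2]) (by linarith [(hq i).2]) (by linarith)
      (by linarith [(hp i).2])
  constructor
  · intro i
    rw [hstep]
    exact mul_pos hκ (mul_pos (by linarith [(hp i).2]) (by linarith [(hq i).2]))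
  · intro i j
    rw [hstep, hstep]
    have := mul_le_mul_of_nonneg_left (((hle i).trans hC).trans
      (mul_le_mul_of_nonneg_left (hge j) hC0)) hκ.le
    linarith

/-- With lower bound `0`, one step maps an upper bound `x` to `1 / (1 + 2 * (1 - x) * x)`, which is
below `x` on `(1 / √2, 1)`, and `18 / 25` exceeds `1 / √2`. The map fixes `1`; only the positive
mixing amount gets the iteration away from it. -/
theorem exists_reach_subset_boxSet (ha0 : 0 < a) (ha1 : a < 1) :
    ∃ n, reach 3 2 a n ⊆ boxSet 3 0 (18 / 25) := by
  have hε : 0 < mixAmount 3 2 a := mixAmount_pos (by norm_num) (by norm_num) ha0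
    (by norm_num; linarith)
  set ε := mixAmount 3 2 a with hεdef
  set φ : ℝ → ℝ := fun x => 1 / (1 + 2 * ((1 - x) * x)) with hφ
  set s : ℝ → ℝ := fun M => max ((M + ε) / (1 + 3 * ε)) (18 / 25) with hs
  have hs1 : ∀ M ∈ Set.Icc (18 / 25 : ℝ) 1, 18 / 25 ≤ s M ∧ s M < 1 ∧ s M ≤ M := by
    intro M hM
    refine ⟨le_max_right _ _, max_lt ?_ (by norm_num), max_le ?_ hM.1⟩
    · rw [div_lt_one (by linarith)]
      linarith [hM.2]
    · rw [div_le_iff₀ (by linarith)]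
      nlinarith [hM.1]
  have hden : ∀ M ∈ Set.Icc (18 / 25 : ℝ) 1, 0 < 1 + 2 * ((1 - s M) * s M) := by
    intro M hM
    obtain ⟨h1, h2, -⟩ := hs1 M hM
    have : 0 ≤ (1 - s M) * s M := mul_nonneg (by linarith) (by linarith)
    linarith
  have hcont : ContinuousOn (fun M => φ (s M)) (Set.Icc (18 / 25 : ℝ) 1) := by
    have hsc : ContinuousOn s (Set.Icc (18 / 25 : ℝ) 1) := by
      apply Continuous.continuousOn
      rw [hs]
      fun_prop
    refine ContinuousOn.div continuousOn_const ?_ fun M hM => (hden M hM).ne'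
    fun_prop
  suffices h : ∃ x < (18 / 25 : ℝ), ∃ n, reach 3 2 a n ⊆ boxSet 3 0 x by
    obtain ⟨x, hx, n, hn⟩ := h
    refine ⟨n, fun y hy => ⟨(hn hy).1, fun i => ⟨((hn hy).2 i).1, ((hn hy).2 i).2.trans ?_⟩⟩⟩
    exact mul_le_mul_of_nonneg_right hx.le (hn hy).1.le
  refine exists_lt_of_continuousOn hcont
    (Q := fun M => ∃ n, reach 3 2 a n ⊆ boxSet 3 0 M) ?_ ?_ ?_
  · intro M hM
    obtain ⟨h1, h2, h3⟩ := hs1 M hM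
    refine lt_of_lt_of_le ?_ h3
    rw [hφ]
    simp only
    rw [div_lt_iff₀ (hden M hM)]
    have : 0 < (1 - s M) * (2 * s M ^ 2 - 1) := mul_pos (by linarith) (by nlinarith)
    nlinarith
  · refine ⟨0, fun y hy => ⟨hy.2, fun i => ⟨by simpa using hy.1 i, ?_⟩⟩⟩
    rw [one_mul]
    exact Finset.single_le_sum (f := y) (fun c _ => hy.1 c) (Finset.mem_univ i)
  · rintro M hM ⟨n, hn⟩
    obtain ⟨h1, h2, h3⟩ := hs1 M hM
    refine ⟨n + 1, reach_mono_of_subset hn fun y hy => ?_⟩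
    refine treeStep_mem_boxSet ha0 ha1 (m₁ := 0) (M₁ := s M) ?_ ?_ le_rfl h2 (by linarith) ?_ le_rfl
      ?_ hy
    · rw [zero_mul, zero_add]
      exact hε.le
    · rw [← div_le_iff₀ (by linarith)]
      exact le_max_left _ _
    · rw [zero_mul]
      positivity
    · rw [hφ]
      simp only
      rw [div_mul_eq_mul_div, le_div_iff₀ (hden M hM)]
      ring_nf
      rfl

theorem exists_reach_subset_ratioSet_three_two (ha0 : 0 < a) (ha1 : a < 1) :
    ∃ n, reach 3 2 a n ⊆ ratioSet 3 (15 / 2) := by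
  obtain ⟨n, h0⟩ := exists_reach_subset_boxSet ha0 ha1
  have step : ∀ {n : ℕ} {m M m' M' : ℝ}, reach 3 2 a n ⊆ boxSet 3 m M → 0 ≤ m → m ≤ 1 / 3 →
      1 / 3 ≤ M → M < 1 → m' * ((1 - M) ^ 2 + 2) ≤ (1 - M) ^ 2 → 0 ≤ m' →
      (1 - m) ^ 2 ≤ M' * ((1 - m) ^ 2 + 2 * ((1 - M) * (M + m))) →
      reach 3 2 a (n + 1) ⊆ boxSet 3 m' M' := fun h a1 a2 a3 a4 a5 a6 a7 =>
    reach_mono_of_subset h fun y hy =>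
      treeStep_mem_boxSet_of_fixed ha0 ha1 a1 a2 a3 a4 a5 a6 a7 hy
  -- Rounded iterates of the box map, continued until the ratio bound `(1 - m) ^ 2 / (1 - M) ^ 2`
  -- drops below `15 / 2`, which is less than `(11 / 4) ^ 2`.
  have h1 : reach 3 2 a (n + 1) ⊆ boxSet 3 0.037 0.72 := step h0 (by norm_num) (by norm_num)
    (by norm_num) (by norm_num) (by norm_num) (by norm_num) (by norm_num)
  have h2 : reach 3 2 a (n + 2) ⊆ boxSet 3 0.037 0.687 := step h1 (by norm_num) (by norm_num)
    (by norm_num) (by norm_num) (by norm_num) (by norm_num) (by norm_num)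
  have h3 : reach 3 2 a (n + 3) ⊆ boxSet 3 0.046 0.672 := step h2 (by norm_num) (by norm_num)
    (by norm_num) (by norm_num) (by norm_num) (by norm_num) (by norm_num)
  have h4 : reach 3 2 a (n + 4) ⊆ boxSet 3 0.051 0.659 := step h3 (by norm_num) (by norm_num)
    (by norm_num) (by norm_num) (by norm_num) (by norm_num) (by norm_num)
  have h5 : reach 3 2 a (n + 5) ⊆ boxSet 3 0.054 0.651 := step h4 (by norm_num) (by norm_num)
    (by norm_num) (by norm_num) (by norm_num) (by norm_num) (by norm_num)
  exact ⟨n + 6, reach_mono_of_subset h5 fun y hy => treeStep_mem_ratioSet_of_boxSet ha0 ha1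
    (by norm_num) (by norm_num) (by norm_num) (by norm_num) (by norm_num) hy⟩

end ThreeTwo

/-- Every factor lies between `1 - a` and `1` times the sum of the entries. This crude start is
enough wherever `T` is unrestricted. -/
theorem reach_one_subset_ratioSet {k d : ℕ} {a : ℝ} (ha0 : 0 < a) (ha1 : a < 1) :
    reach k d a 1 ⊆ ratioSet k ((1 / (1 - a)) ^ d) := by
  rintro _ ⟨y, hy, rfl⟩
  have hy' : ∀ l, (∀ i, 0 ≤ y l i) ∧ 0 < ∑ i, y l i := hy
  refine ⟨treeStep_pos ha1 hy', fun i j => ?_⟩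
  have e : (1 / (1 - a)) ^ d = ∏ _l : Fin d, 1 / (1 - a) := by
    rw [Finset.prod_const, Finset.card_univ, Fintype.card_fin]
  rw [e, treeStep, treeStep, ← Finset.prod_mul_distrib]
  refine Finset.prod_le_prod (fun l _ => (sub_mul_pos ha1 (hy' l).1 (hy' l).2 i).le) fun l _ => ?_
  have h1 : y l j ≤ ∑ c, y l c :=
    Finset.single_le_sum (f := y l) (fun c _ => (hy' l).1 c) (Finset.mem_univ j)
  have h2 := (hy' l).1 i
  rw [div_mul_eq_mul_div, one_mul, le_div_iff₀ (by linarith)]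
  nlinarith [mul_nonneg ha0.le h2, mul_nonneg (mul_nonneg ha0.le h2) (by linarith : 0 ≤ 1 - a)]

theorem contractRatio_le {k d : ℕ} {T : ℝ} (hT : 1 < T) (hg : GoodRange k d T) :
    contractRatio k d T ≤ T ^ 2 ∧ (¬ (k = 3 ∧ d = 2) → contractRatio k d T < T ^ 2) := by
  have hkd : 2 ≤ k ∧ 0 < d ∧ k ≤ d + 1 := by
    rcases hg with ⟨rfl, rfl, -⟩ | ⟨rfl, h⟩ | ⟨rfl, h⟩ <;> omega
  have hk' : (2 : ℝ) ≤ k := by exact_mod_cast hkd.1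
  have hd' : (0 : ℝ) < d := by exact_mod_cast hkd.2.1
  have hkd' : (k : ℝ) - 1 ≤ d := by
    have : (k : ℝ) ≤ d + 1 := by exact_mod_cast hkd.2.2
    linarith
  have hden := ratioDen_pos hk' hd' hkd' hT.le
  have hnum := hden.trans_le (ratioDen_le_ratioNum (by linarith : (0 : ℝ) ≤ k) hT.le)
  have hT0 : 0 < T := by linarith
  have hpos : 0 < contractRatio k d T := pow_pos (div_pos hnum hden) d
  have hlog : Real.log (contractRatio k d T) =
      d * (Real.log (ratioNum k d T) - Real.log (ratioDen k d T)) := by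
    rw [contractRatio, Real.log_pow, Real.log_div hnum.ne' hden.ne']
  have hlog2 : Real.log (T ^ 2) = 2 * Real.log T := by
    rw [Real.log_pow]
    norm_num
  have hlt : ¬ (k = 3 ∧ d = 2) → contractRatio k d T < T ^ 2 := by
    intro hne
    rw [← Real.log_lt_log_iff hpos (by positivity), hlog, hlog2]
    rcases hg with ⟨rfl, rfl, -⟩ | ⟨rfl, h⟩ | ⟨rfl, h⟩
    · exact absurd ⟨rfl, rfl⟩ hne
    · exact log_ratio_lt_three (by exact_mod_cast h) hT
    · exact log_ratio_lt_four (by exact_mod_cast h) hT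
  refine ⟨?_, hlt⟩
  by_cases hne : k = 3 ∧ d = 2
  · obtain ⟨rfl, rfl⟩ := hne
    rw [← Real.log_le_log_iff hpos (by positivity), hlog, hlog2]
    exact log_ratio_le_three (by norm_num) hT.le
  · exact (hlt hne).le

theorem exists_reach_subset_of_goodRange {k d : ℕ} {a C₀ : ℝ} (ha0 : 0 < a) (ha1 : a < 1)
    (ha : a * (d + 1) ≤ k) (hg : ∀ T : ℝ, T ^ 2 ≤ C₀ → GoodRange k d T) {n₀ : ℕ}
    (h₀ : reach k d a n₀ ⊆ ratioSet k C₀) {C : ℝ} (hC : 1 < C) :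
    ∃ n, reach k d a n ⊆ ratioSet k C := by
  rcases lt_or_ge C₀ C with hCC | hCC
  · exact ⟨n₀, h₀.trans (ratioSet_mono hCC.le)⟩
  have hg0 : GoodRange k d 1 := hg 1 (by linarith)
  have hkd : 2 ≤ k ∧ 0 < d ∧ k ≤ d + 1 := by
    rcases hg0 with ⟨rfl, rfl, -⟩ | ⟨rfl, h⟩ | ⟨rfl, h⟩ <;> omega
  obtain ⟨hk, hd, hkd⟩ := hkd
  have hk' : (2 : ℝ) ≤ k := by exact_mod_cast hk
  have hd' : (0 : ℝ) < d := by exact_mod_cast hd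
  have hkd' : (k : ℝ) - 1 ≤ d := by
    have : (k : ℝ) ≤ d + 1 := by exact_mod_cast hkd
    linarith
  have hε := mixAmount_nonneg ha0 ha
  set ε := mixAmount k d a with hεdef
  set s : ℝ → ℝ := fun x => √(mixRatio ε x) with hs
  have hs1 : ∀ x, 1 < x → 1 < s x := fun x hx => by
    rw [hs]
    exact Real.lt_sqrt_of_sq_lt (by simpa using one_lt_mixRatio hε hx)
  have hs2 : ∀ x, 1 < x → s x ^ 2 = mixRatio ε x := fun x hx =>
    Real.sq_sqrt (by linarith [one_lt_mixRatio hε hx])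
  have hcont : ContinuousOn (fun x => contractRatio k d (s x)) (Set.Icc C C₀) := by
    have hsc : ContinuousOn s (Set.Icc C C₀) := by
      apply Continuous.continuousOn
      rw [hs]
      unfold mixRatio
      fun_prop
    unfold contractRatio
    refine (ContinuousOn.div ?_ ?_ ?_).pow d
    · unfold ratioNum
      fun_prop
    · unfold ratioDen
      fun_prop
    · intro x hx
      exact (ratioDen_pos hk' hd' hkd' (hs1 x (hC.trans_le hx.1)).le).ne'
  have hgood : ∀ x ∈ Set.Icc C C₀, GoodRange k d (s x) := fun x hx => by
    have hx1 := hC.trans_le hx.1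
    apply hg
    rw [hs2 x hx1]
    exact (mixRatio_le hε hx1.le).trans hx.2
  suffices h : ∃ x < C, ∃ n, reach k d a n ⊆ ratioSet k x by
    obtain ⟨x, hx, n, hn⟩ := h
    exact ⟨n, hn.trans (ratioSet_mono hx.le)⟩
  refine exists_lt_of_continuousOn hcont
    (Q := fun x => ∃ n, reach k d a n ⊆ ratioSet k x) ?_ ⟨n₀, h₀⟩ ?_
  · intro x hx
    have hx1 := hC.trans_le hx.1
    obtain ⟨h1, h2⟩ := contractRatio_le (hs1 x hx1) (hgood x hx)
    rw [hs2 x hx1] at h1 h2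
    -- In the borderline case the critical contraction is not strict; the strict decrease comes from
    -- the mixing, as `a < 1 = k / (d + 1)`.
    by_cases hne : k = 3 ∧ d = 2
    · refine h1.trans_lt (mixRatio_lt ?_ hx1)
      refine mixAmount_pos (by omega) hd ha0 ?_
      obtain ⟨rfl, rfl⟩ := hne
      norm_num
      linarith
    · exact (h2 hne).trans_le (mixRatio_le hε hx1.le)
  · rintro x hx ⟨n, hn⟩
    have hx1 := hC.trans_le hx.1
    refine ⟨n + 2, ?_⟩
    rintro _ ⟨z, hz, rfl⟩
    choose y hy hyz using hz
    have : z = fun l => treeStep a (y l) := funext hyz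
    rw [this]
    exact treeStep_treeStep_mem hk hd hkd ha0 ha1 ha hx1.le (hs1 x hx1) (hs2 x hx1).symm
      (hasWeights_of_goodRange (hgood x hx) (hs1 x hx1)) fun l l' => hn (hy l l')

/-- The vectors of ratios of the tree recursion converge to the constant vector. -/
theorem exists_reach_subset_ratioSet {k d : ℕ} {a : ℝ}
    (hkd : (k = 3 ∧ 2 ≤ d) ∨ (k = 4 ∧ 4 ≤ d)) (ha0 : 0 < a) (ha1 : a < 1)
    (ha : a * (d + 1) ≤ k) {C : ℝ} (hC : 1 < C) : ∃ n, reach k d a n ⊆ ratioSet k C := by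
  by_cases h32 : k = 3 ∧ d = 2
  · obtain ⟨rfl, rfl⟩ := h32
    obtain ⟨n₀, h₀⟩ := exists_reach_subset_ratioSet_three_two ha0 ha1
    refine exists_reach_subset_of_goodRange ha0 ha1 ha ?_ h₀ hC
    exact fun T hT => Or.inl ⟨rfl, rfl, by nlinarith⟩
  · refine exists_reach_subset_of_goodRange ha0 ha1 ha ?_ (reach_one_subset_ratioSet ha0 ha1) hC
    intro T _
    rcases hkd with ⟨rfl, h⟩ | ⟨rfl, h⟩
    · exact Or.inr (Or.inl ⟨rfl, by omega⟩)
    · exact Or.inr (Or.inr ⟨rfl, h⟩)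

end Potts

namespace Potts

/-! ### Combinatorics of the regular tree -/

/-- The parent of a vertex; the root is its own parent. -/
def parent {d : ℕ} : TreeVertex d → TreeVertex d
  | none => none
  | some (_, []) => none
  | some (i, _ :: l) => some (i, l)

/-- The children of a vertex other than the root. -/
def child {d : ℕ} (v : TreeVertex d) (j : Fin d) : TreeVertex d :=
  match v with
  | none => none
  | some (i, l) => some (i, j :: l)

/-- The distance of a vertex to the root. -/
def depth {d : ℕ} : TreeVertex d → ℕ
  | none => 0
  | some (_, l) => l.length + 1

section Tree

variable {d : ℕ}

theorem isChild_iff {u v : TreeVertex d} : IsChild u v ↔ v ≠ none ∧ parent v = u := by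
  constructor
  · rintro (i | ⟨i, l, j⟩) <;> simp [parent]
  · rintro ⟨hv, rfl⟩
    match v, hv with
    | some (i, []), _ => exact IsChild.root i
    | some (i, j :: l), _ => exact IsChild.step i l j

theorem depth_parent {v : TreeVertex d} (hv : v ≠ none) : depth (parent v) + 1 = depth v := by
  match v, hv with
  | some (i, []), _ => rfl
  | some (i, j :: l), _ => simp [parent, depth]

theorem parent_child {v : TreeVertex d} (hv : v ≠ none) (j : Fin d) : parent (child v j) = v := by
  match v, hv with
  | some (i, l), _ => rfl

theorem depth_child {v : TreeVertex d} (hv : v ≠ none) (j : Fin d) :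
    depth (child v j) = depth v + 1 := by
  match v, hv with
  | some (i, l), _ => simp [child, depth]

theorem depth_parent_le (v : TreeVertex d) : depth (parent v) ≤ depth v := by
  by_cases hv : v = none
  · rw [hv]; rfl
  · have := depth_parent hv
    omega

theorem depth_eq_zero {v : TreeVertex d} : depth v = 0 ↔ v = none := by
  match v with
  | none => simp [depth]
  | some (i, l) => simp [depth]

theorem adj_parent {v : TreeVertex d} (hv : v ≠ none) : (regularTree d).Adj v (parent v) :=
  regularTree_adj.2 (Or.inr (isChild_iff.2 ⟨hv, rfl⟩))

theorem exists_child (hd : 0 < d) (v : TreeVertex d) : ∃ u : TreeVertex d, u ≠ none ∧ parent u = v := by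
  match v with
  | none => exact ⟨some (0, []), by simp, rfl⟩
  | some (i, l) => exact ⟨some (i, ⟨0, hd⟩ :: l), by simp, rfl⟩

theorem finite_depth_le (n : ℕ) : {v : TreeVertex d | depth v ≤ n}.Finite := by
  have h : (Set.univ ×ˢ {l : List (Fin d) | l.length ≤ n} :
      Set (Fin (d + 1) × List (Fin d))).Finite :=
    Set.finite_univ.prod (List.finite_length_le (Fin d) n)
  refine ((h.image some).insert none).subset ?_
  rintro (_ | ⟨i, l⟩) hv
  · exact Set.mem_insert _ _
  · refine Set.mem_insert_of_mem _ ⟨(i, l), ⟨Set.mem_univ _, ?_⟩, rfl⟩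
    simp only [depth, Set.mem_ofPred_eq] at hv ⊢
    omega

/-- The vertices at distance at most `n` from the root. -/
noncomputable def ball (d n : ℕ) : Finset (TreeVertex d) := (finite_depth_le n).toFinset

/-- The vertices at distance `n` from the root. -/
noncomputable def layer (d n : ℕ) : Finset (TreeVertex d) := (ball d n).filter fun v => depth v = n

@[simp] theorem mem_ball {n : ℕ} {v : TreeVertex d} : v ∈ ball d n ↔ depth v ≤ n := by
  simp [ball]

@[simp] theorem mem_layer {n : ℕ} {v : TreeVertex d} : v ∈ layer d n ↔ depth v = n := by
  simp only [layer, Finset.mem_filter, mem_ball, and_iff_right_iff_imp]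
  exact le_of_eq

theorem ball_mono {m n : ℕ} (h : m ≤ n) : ball d m ⊆ ball d n := fun v hv => by
  rw [mem_ball] at hv ⊢
  omega

theorem exists_subset_ball (U : Finset (TreeVertex d)) : ∃ n, U ⊆ ball d n :=
  ⟨U.sup depth, fun _ hv => mem_ball.2 (Finset.le_sup (f := depth) hv)⟩

theorem boundary_ball (hd : 0 < d) (n : ℕ) :
    boundary (regularTree d) (ball d n : Set (TreeVertex d)) = (layer d n : Set (TreeVertex d)) := by
  ext v
  simp only [boundary, Finset.mem_coe, mem_ball, mem_layer, Set.mem_ofPred_eq]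
  constructor
  · rintro ⟨hv, u, hu, hadj⟩
    rcases regularTree_adj.1 hadj with h | h
    · obtain ⟨hu0, rfl⟩ := isChild_iff.1 h
      have := depth_parent hu0
      omega
    · obtain ⟨hv0, rfl⟩ := isChild_iff.1 h
      have := depth_parent hv0
      omega
  · intro hv
    refine ⟨hv.le, ?_⟩
    obtain ⟨u, hu, rfl⟩ := exists_child hd v
    refine ⟨u, ?_, (adj_parent hu).symm⟩
    have := depth_parent hu
    omega

/-- The root is excluded: it has `d + 1` children, and `child` takes a default value on it. -/
theorem prod_layer_succ {M : Type*} [CommMonoid M] {n : ℕ} (hn : n ≠ 0) (f : TreeVertex d → M) :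
    ∏ u ∈ layer d (n + 1), f u =
      ∏ v ∈ layer d n, ∏ j : Fin d, f (child v j) := by
  rw [← Finset.prod_fiberwise_of_maps_to (t := layer d n) (g := parent)]
  · refine Finset.prod_congr rfl fun v hv => ?_
    match v with
    | none =>
      rw [mem_layer] at hv
      exact absurd hv.symm hn
    | some (i, l) =>
      rw [mem_layer] at hv
      symm
      refine Finset.prod_bij (fun j _ => (some (i, j :: l) : TreeVertex d)) ?_ ?_ ?_ ?_
      · intro j _
        rw [Finset.mem_filter, mem_layer]
        refine ⟨?_, rfl⟩
        rw [← hv]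
        rfl
      · intro j _ j' _ h
        simpa using h
      · intro u hu
        simp only [Finset.mem_filter, mem_layer] at hu
        match u with
        | none => simp [parent] at hu
        | some (i', []) => simp [parent] at hu
        | some (i', j :: l') =>
          simp only [parent, Option.some.injEq, Prod.mk.injEq] at hu
          obtain ⟨-, rfl, rfl⟩ := hu
          exact ⟨j, Finset.mem_univ j, rfl⟩
      · intro j _
        rfl
  · intro u hu
    rw [mem_layer] at hu ⊢
    have : u ≠ none := fun h => by rw [h] at hu; simp [depth] at hu
    have := depth_parent this
    omega

/-- The interaction along the edge between a vertex and its parent. -/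
noncomputable def edgeFactor {k : ℕ} (w : ℝ) (φ : Config k d) (v : TreeVertex d) : ℝ :=
  if φ v = φ (parent v) then w else 1

theorem edgeFactor_pos {k : ℕ} {w : ℝ} (hw : 0 < w) (φ : Config k d) (v : TreeVertex d) :
    0 < edgeFactor w φ v := by
  unfold edgeFactor
  split_ifs
  · exact hw
  · exact one_pos

theorem edgeFactor_congr {k : ℕ} {w : ℝ} {φ φ' : Config k d} {v : TreeVertex d}
    (h : φ v = φ' v) (h' : φ (parent v) = φ' (parent v)) : edgeFactor w φ v = edgeFactor w φ' v := by
  unfold edgeFactor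
  rw [h, h']

/-- The vertices of `U` which are joined to their parent inside `U`. -/
noncomputable def inner (U : Finset (TreeVertex d)) : Finset (TreeVertex d) :=
  U.filter fun v => v ≠ none ∧ parent v ∈ U

theorem mem_inner {U : Finset (TreeVertex d)} {v : TreeVertex d} :
    v ∈ inner U ↔ v ∈ U ∧ v ≠ none ∧ parent v ∈ U := by
  simp [inner]

/-- Each edge is encoded by its endpoint farther from the root; comparing depths shows that this
encoding is injective. -/
theorem weight_induce {k : ℕ} (w : ℝ) (U : Finset (TreeVertex d)) (φ : Config k d) :
    weight ((regularTree d).induce (U : Set (TreeVertex d))) w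
      (fun v : (U : Set (TreeVertex d)) => φ v) = ∏ v ∈ inner U, edgeFactor w φ v := by
  have hR : ∏ v ∈ inner U, edgeFactor w φ v =
      w ^ ((inner U).filter fun v => φ v = φ (parent v)).card := by
    unfold edgeFactor
    rw [Finset.prod_ite, Finset.prod_const, Finset.prod_const_one, mul_one]
  rw [hR, weight]
  congr 1
  symm
  rw [← Set.ncard_coe_finset]
  refine Set.ncard_congr (fun v hv => s(⟨parent v, ?_⟩, ⟨v, ?_⟩)) ?_ ?_ ?_
  · simp only [Finset.coe_filter, mem_inner, Set.mem_ofPred_eq] at hv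
    exact hv.1.2.2
  · simp only [Finset.coe_filter, mem_inner, Set.mem_ofPred_eq] at hv
    exact hv.1.1
  · intro v hv
    simp only [Finset.coe_filter, mem_inner, Set.mem_ofPred_eq] at hv
    refine ⟨?_, ?_⟩
    · rw [SimpleGraph.mem_edgeSet, SimpleGraph.comap_adj]
      exact (adj_parent hv.1.2.1).symm
    · rw [Sym2.map_mk, Sym2.mk_isDiag_iff]
      exact hv.2.symm
  · intro v u hv hu h
    simp only [Finset.coe_filter, mem_inner, Set.mem_ofPred_eq] at hv hu
    rw [Sym2.eq_iff] at h
    rcases h with ⟨-, h⟩ | ⟨h1, h2⟩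
    · simpa using h
    · simp only [Subtype.mk.injEq] at h1 h2
      have e1 := depth_parent hv.1.2.1
      have e2 := depth_parent hu.1.2.1
      rw [h1] at e1
      rw [← h2] at e2
      omega
  · intro e
    induction e using Sym2.ind with
    | _ x y =>
      rintro ⟨hadj, hdiag⟩
      rw [SimpleGraph.mem_edgeSet, SimpleGraph.comap_adj] at hadj
      rw [Sym2.map_mk, Sym2.mk_isDiag_iff] at hdiag
      obtain ⟨x, hx⟩ := x
      obtain ⟨y, hy⟩ := y
      rcases regularTree_adj.1 hadj with h | h
      · obtain ⟨h0, h1⟩ := isChild_iff.1 h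
        simp only [Function.Embedding.subtype_apply] at h0 h1
        subst h1
        refine ⟨y, ?_, rfl⟩
        simp only [Finset.coe_filter, mem_inner, Set.mem_ofPred_eq]
        exact ⟨⟨hy, h0, hx⟩, hdiag.symm⟩
      · obtain ⟨h0, h1⟩ := isChild_iff.1 h
        simp only [Function.Embedding.subtype_apply] at h0 h1
        subst h1
        refine ⟨x, ?_, Sym2.eq_swap⟩
        simp only [Finset.coe_filter, mem_inner, Set.mem_ofPred_eq]
        exact ⟨⟨hx, h0, hy⟩, hdiag⟩

theorem inner_ball (n : ℕ) : inner (ball d n) = (ball d n).erase none := by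
  ext v
  simp only [mem_inner, mem_ball, Finset.mem_erase]
  have := depth_parent_le v
  constructor
  · rintro ⟨h1, h2, -⟩
    exact ⟨h2, h1⟩
  · rintro ⟨h2, h1⟩
    exact ⟨h1, h2, by omega⟩

end Tree

end Potts

namespace Potts

/-! ### Cylinder sets -/

section Cylinders

variable {V : Type*} {k : ℕ}

/-- The configurations which agree with `τ` on `S`. -/
def cyl (S : Finset V) (τ : V → Fin k) : Set (V → Fin k) := {ψ | ∀ v ∈ S, ψ v = τ v}

@[simp] theorem mem_cyl {S : Finset V} {τ ψ : V → Fin k} : ψ ∈ cyl S τ ↔ ∀ v ∈ S, ψ v = τ v :=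
  Iff.rfl

theorem cyl_congr {S : Finset V} {τ τ' : V → Fin k} (h : ∀ v ∈ S, τ v = τ' v) :
    cyl S τ = cyl S τ' := by
  ext ψ
  exact forall₂_congr fun v hv => by rw [h v hv]

theorem cyl_anti {S T : Finset V} (h : S ⊆ T) (τ : V → Fin k) : cyl T τ ⊆ cyl S τ :=
  fun _ hψ v hv => hψ v (h hv)

theorem measurableSet_cyl_cylinderEvents {S : Finset V} {Δ : Set V} (h : ∀ v ∈ S, v ∈ Δ)
    (τ : V → Fin k) :
    MeasurableSet[cylinderEvents (X := fun _ : V => Fin k) Δ] (cyl S τ) := by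
  have : cyl S τ = ⋂ v ∈ S, (fun ψ : V → Fin k => ψ v) ⁻¹' {τ v} := by
    ext ψ
    simp
  rw [this]
  exact Finset.measurableSet_biInter S fun v hv =>
    measurable_cylinderEvent_apply (h v hv) (measurableSet_singleton _)

theorem measurableSet_cyl (S : Finset V) (τ : V → Fin k) : MeasurableSet (cyl S τ) :=
  cylinderEvents_le_pi _ (measurableSet_cyl_cylinderEvents (Δ := Set.univ) (fun _ _ => trivial) τ)

open Classical in
/-- The configuration which is `σ` on `S` and `φ` elsewhere. -/
noncomputable def glue (S : Finset V) (φ : V → Fin k) (σ : ↥(S : Set V) → Fin k) : V → Fin k :=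
  fun v => if h : v ∈ S then σ ⟨v, h⟩ else φ v

theorem glue_of_mem {S : Finset V} (φ : V → Fin k) (σ : ↥(S : Set V) → Fin k) {v : V}
    (h : v ∈ S) : glue S φ σ v = σ ⟨v, h⟩ := dif_pos h

theorem glue_of_notMem {S : Finset V} (φ : V → Fin k) (σ : ↥(S : Set V) → Fin k) {v : V}
    (h : v ∉ S) : glue S φ σ v = φ v := dif_neg h

theorem glue_restrict (S : Finset V) (φ ψ : V → Fin k) {v : V} (h : v ∈ S) :
    glue S φ (fun v => ψ v) v = ψ v := glue_of_mem _ _ h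

open Classical in
theorem measureReal_eq_sum_glue (μ : Measure (V → Fin k)) [IsFiniteMeasure μ] (S : Finset V)
    (φ : V → Fin k) (A : Set (V → Fin k)) :
    μ.real A = ∑ σ : ↥(S : Set V) → Fin k, μ.real (cyl S (glue S φ σ) ∩ A) := by
  have h1 : ∀ σ : ↥(S : Set V) → Fin k,
      (fun (ψ : V → Fin k) (v : (S : Set V)) => ψ v) ⁻¹' {σ} = cyl S (glue S φ σ) := by
    intro σ
    ext ψ
    rw [Set.mem_preimage, Set.mem_singleton_iff, funext_iff, mem_cyl]
    constructor
    · intro h v hv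
      rw [glue_of_mem _ _ hv]
      exact h ⟨v, hv⟩
    · rintro h ⟨v, hv⟩
      exact (h v hv).trans (glue_of_mem _ _ hv)
  have h2 := sum_measureReal_preimage_singleton (μ := μ.restrict A) Finset.univ
    (f := fun (ψ : V → Fin k) (v : (S : Set V)) => ψ v)
    (fun σ _ => by rw [h1]; exact measurableSet_cyl _ _)
  rw [Finset.coe_univ, Set.preimage_univ, measureReal_restrict_apply MeasurableSet.univ,
    Set.univ_inter] at h2
  rw [← h2]
  refine Finset.sum_congr rfl fun σ _ => ?_
  rw [h1, measureReal_restrict_apply (measurableSet_cyl _ _)]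

open Classical in
theorem measureReal_cyl_inter_eq_sum (μ : Measure (V → Fin k)) [IsFiniteMeasure μ]
    {S T : Finset V} (hTS : T ⊆ S) (φ : V → Fin k) (A : Set (V → Fin k)) :
    μ.real (cyl T φ ∩ A) = ∑ σ : ↥(S : Set V) → Fin k with (∀ v ∈ T, glue S φ σ v = φ v),
      μ.real (cyl S (glue S φ σ) ∩ A) := by
  rw [measureReal_eq_sum_glue μ S φ, Finset.sum_filter]
  refine Finset.sum_congr rfl fun σ _ => ?_
  split_ifs with h
  · congr 1
    rw [← Set.inter_assoc, ← cyl_congr h, Set.inter_eq_left.2 (cyl_anti hTS _)]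
  · convert measureReal_empty
    rw [Set.eq_empty_iff_forall_notMem]
    rintro ψ ⟨h1, h2, -⟩
    exact h fun v hv => (h1 v (hTS hv)).symm.trans (h2 v hv)

theorem cylinderEvents_eq_generateFrom (Δ : Set V) :
    cylinderEvents (X := fun _ : V => Fin k) Δ =
      MeasurableSpace.generateFrom {s | ∃ (T : Finset V) (τ : V → Fin k), (T : Set V) ⊆ Δ ∧
        s = cyl T τ} := by
  apply le_antisymm
  · refine iSup₂_le fun v hv => ?_
    rintro _ ⟨t, -, rfl⟩
    have : (fun ψ : V → Fin k => ψ v) ⁻¹' t = ⋃ c ∈ t, cyl {v} (fun _ => c) := by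
      ext ψ
      simp
    rw [this]
    refine MeasurableSet.biUnion t.to_countable fun c _ => ?_
    exact MeasurableSpace.measurableSet_generateFrom ⟨{v}, fun _ => c, by simpa using hv, rfl⟩
  · refine MeasurableSpace.generateFrom_le ?_
    rintro _ ⟨T, τ, hT, rfl⟩
    exact measurableSet_cyl_cylinderEvents hT τ

/-- Cylinders over subsets of `Δ` form a generating π-system up to the empty set. Each is a finite
disjoint union of cylinders over a larger `S`, which may leave `Δ`. -/
theorem measure_eq_of_cyl {μ ν : Measure (V → Fin k)} [IsFiniteMeasure μ] [IsFiniteMeasure ν]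
    {Δ : Set V}
    (h : ∀ T : Finset V, (T : Set V) ⊆ Δ → ∃ S : Finset V, T ⊆ S ∧ ∀ τ : V → Fin k,
      μ.real (cyl S τ) = ν.real (cyl S τ))
    {s : Set (V → Fin k)} (hs : MeasurableSet[cylinderEvents (X := fun _ : V => Fin k) Δ] s) :
    μ s = ν s := by
  classical
  have key : ∀ T : Finset V, (T : Set V) ⊆ Δ → ∀ τ : V → Fin k, μ (cyl T τ) = ν (cyl T τ) := by
    intro T hT τ
    obtain ⟨S, hTS, hS⟩ := h T hT
    rw [← measureReal_eq_measureReal_iff, ← Set.inter_univ (cyl T τ),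
      measureReal_cyl_inter_eq_sum μ hTS, measureReal_cyl_inter_eq_sum ν hTS]
    simp only [Set.inter_univ, hS]
  rcases isEmpty_or_nonempty (V → Fin k) with hE | ⟨⟨τ⟩⟩
  · rw [Set.eq_empty_of_isEmpty s, measure_empty, measure_empty]
  · refine ext_on_measurableSpace_of_generate_finite MeasurableSpace.pi
      {s | ∃ (T : Finset V) (τ : V → Fin k), (T : Set V) ⊆ Δ ∧ s = cyl T τ} ?_
      cylinderEvents_le_pi (cylinderEvents_eq_generateFrom Δ) ?_ ?_ hs
    · rintro _ ⟨T, τ, hT, rfl⟩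
      exact key T hT τ
    · rintro _ ⟨T, τ, hT, rfl⟩ _ ⟨T', τ', hT', rfl⟩ ⟨ρ, h1, h2⟩
      refine ⟨T ∪ T', ρ, by rw [Finset.coe_union]; exact Set.union_subset hT hT', ?_⟩
      rw [← cyl_congr h1, ← cyl_congr h2]
      ext ψ
      simp only [Set.mem_inter_iff, mem_cyl, Finset.mem_union]
      exact ⟨fun h v hv => hv.elim (h.1 v) (h.2 v),
        fun h => ⟨fun v hv => h v (Or.inl hv), fun v hv => h v (Or.inr hv)⟩⟩
    · have := key ∅ (by simp) τ
      simpa [cyl] using this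

end Cylinders

end Potts

namespace Potts

/-! ### The local conditional probabilities -/

section Specification

variable {k d : ℕ}

open Classical in
/-- The boundary of a finite set of vertices, as a finite set. -/
noncomputable def bdry (U : Finset (TreeVertex d)) : Finset (TreeVertex d) :=
  U.filter fun v => v ∈ boundary (regularTree d) (U : Set (TreeVertex d))

theorem mem_bdry {U : Finset (TreeVertex d)} {v : TreeVertex d} :
    v ∈ bdry U ↔ v ∈ boundary (regularTree d) (U : Set (TreeVertex d)) := by
  simp only [bdry, Finset.mem_filter, and_iff_right_iff_imp]
  exact fun h => h.1

theorem bdry_subset (U : Finset (TreeVertex d)) : bdry U ⊆ U :=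
  fun _ hv => (mem_bdry.1 hv).1

theorem bdry_ball (hd : 0 < d) (n : ℕ) : bdry (ball d n) = layer d n := by
  ext v
  rw [mem_bdry, boundary_ball hd, Finset.mem_coe]

theorem mem_compl_interior {U : Finset (TreeVertex d)} {v : TreeVertex d} :
    v ∈ (interior (regularTree d) (U : Set (TreeVertex d)))ᶜ ↔ v ∈ bdry U ∨ v ∉ U := by
  rw [mem_bdry, interior, Set.mem_compl_iff, Set.mem_sdiff, Finset.mem_coe]
  tauto

/-- The weight of a configuration in a finite set of vertices. -/
noncomputable def wt (w : ℝ) (U : Finset (TreeVertex d)) (φ : Config k d) : ℝ :=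
  ∏ v ∈ inner U, edgeFactor w φ v

theorem wt_pos {w : ℝ} (hw : 0 < w) (U : Finset (TreeVertex d)) (φ : Config k d) : 0 < wt w U φ :=
  Finset.prod_pos fun _ _ => edgeFactor_pos hw _ _

theorem wt_congr {w : ℝ} {U : Finset (TreeVertex d)} {φ φ' : Config k d}
    (h : ∀ v ∈ U, φ v = φ' v) : wt w U φ = wt w U φ' :=
  Finset.prod_congr rfl fun v hv =>
    edgeFactor_congr (h v (mem_inner.1 hv).1) (h _ (mem_inner.1 hv).2.2)

open Classical in
/-- The sum of the weights of the configurations in `U` which agree with `φ` on the boundary. -/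
noncomputable def wtSum (w : ℝ) (U : Finset (TreeVertex d)) (φ : Config k d) : ℝ :=
  ∑ σ : ↥(U : Set (TreeVertex d)) → Fin k with (∀ v ∈ bdry U, glue U φ σ v = φ v),
    wt w U (glue U φ σ)

theorem wt_glue (w : ℝ) (U : Finset (TreeVertex d)) (φ φ' : Config k d)
    (σ : ↥(U : Set (TreeVertex d)) → Fin k) : wt w U (glue U φ σ) = wt w U (glue U φ' σ) :=
  wt_congr fun v hv => by rw [glue_of_mem _ _ hv, glue_of_mem _ _ hv]

theorem wtSum_congr {w : ℝ} {U : Finset (TreeVertex d)} {φ φ' : Config k d}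
    (h : ∀ v ∈ bdry U, φ v = φ' v) : wtSum w U φ = wtSum w U φ' := by
  unfold wtSum
  refine Finset.sum_congr ?_ fun σ _ => wt_glue w U φ φ' σ
  ext σ
  simp only [Finset.mem_filter, Finset.mem_univ, true_and]
  refine forall₂_congr fun v hv => ?_
  rw [glue_of_mem _ _ (bdry_subset U hv), glue_of_mem _ _ (bdry_subset U hv), h v hv]

theorem wtSum_pos {w : ℝ} (hw : 0 < w) (U : Finset (TreeVertex d)) (φ : Config k d) :
    0 < wtSum w U φ := by
  refine Finset.sum_pos (fun _ _ => wt_pos hw _ _) ⟨fun v => φ v, ?_⟩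
  simp only [Finset.mem_filter, Finset.mem_univ, true_and]
  exact fun v hv => glue_restrict U φ φ (bdry_subset U hv)

theorem condProb_eq (w : ℝ) (U : Finset (TreeVertex d)) (φ : Config k d) :
    condProb ((regularTree d).induce (U : Set (TreeVertex d))) w
        (Subtype.val ⁻¹' boundary (regularTree d) (U : Set (TreeVertex d)))
        (fun v => φ v) = wt w U φ / wtSum w U φ := by
  unfold condProb
  rw [weight_induce w U φ, wtSum, ← wt]
  congr 1
  refine Finset.sum_congr ?_ fun σ _ => ?_
  · ext σ
    simp only [Finset.mem_filter, Finset.mem_univ, true_and]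
    constructor
    · intro h v hv
      rw [glue_of_mem _ _ (bdry_subset U hv)]
      exact h ⟨v, bdry_subset U hv⟩ (mem_bdry.1 hv)
    · rintro h ⟨v, hvU⟩ hv
      have := h v (mem_bdry.2 hv)
      rwa [glue_of_mem _ _ hvU] at this
  · rw [wt, ← weight_induce w U]
    congr 1
    funext v
    exact (glue_of_mem φ σ v.2).symm

variable {w : ℝ} {μ : Measure (Config k d)}

theorem isGibbs_of_local [IsProbabilityMeasure μ]
    (h : ∀ (U : Finset (TreeVertex d)) (φ : Config k d) (s : Set (Config k d)),
      MeasurableSet[cylinderEvents (X := fun _ : TreeVertex d => Fin k)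
        (interior (regularTree d) (U : Set (TreeVertex d)))ᶜ] s →
      μ.real (cyl U φ ∩ s) = wt w U φ / wtSum w U φ * μ.real (cyl (bdry U) φ ∩ s)) :
    IsGibbs k d w μ := by
  classical
  refine ⟨inferInstance, fun U => ?_⟩
  obtain ⟨φ₀⟩ : Nonempty (Config k d) := by
    by_contra hE
    rw [not_nonempty_iff] at hE
    have := measure_univ (μ := μ)
    rw [Set.eq_empty_of_isEmpty (Set.univ : Set (Config k d)), measure_empty] at this
    exact zero_ne_one this
  have key : ∀ φ : Config k d, (fun ψ => (cyl (bdry U) φ).indicator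
      (fun _ => wt w U φ / wtSum w U φ) ψ) =ᵐ[μ]
      μ[(cyl U φ).indicator (fun _ => (1 : ℝ)) |
        cylinderEvents (X := fun _ : TreeVertex d => Fin k)
          (interior (regularTree d) (U : Set (TreeVertex d)))ᶜ] := by
    intro φ
    have hG : MeasurableSet[cylinderEvents (X := fun _ : TreeVertex d => Fin k)
          (interior (regularTree d) (U : Set (TreeVertex d)))ᶜ] (cyl (bdry U) φ) :=
      measurableSet_cyl_cylinderEvents (fun v hv => mem_compl_interior.2 (Or.inl hv)) φ
    refine ae_eq_condExp_of_forall_setIntegral_eq cylinderEvents_le_pi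
      ((integrable_const _).indicator (measurableSet_cyl _ _))
      (fun s _ _ => ((integrable_const _).indicator (measurableSet_cyl _ _)).integrableOn)
      (fun s hs _ => ?_) ?_
    · rw [integral_indicator (measurableSet_cyl _ _), integral_indicator (measurableSet_cyl _ _),
        Measure.restrict_restrict (measurableSet_cyl _ _),
        Measure.restrict_restrict (measurableSet_cyl _ _), setIntegral_const, setIntegral_const,
        smul_eq_mul, smul_eq_mul, mul_one, h U φ s hs, mul_comm]
    · exact (stronglyMeasurable_const.indicator hG).aestronglyMeasurable
  -- The event in the Gibbs condition varies with `φ`, but only through its finitely many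
  -- restrictions to `U`, so a single null set suffices.
  have key' := ae_all_iff.2 fun σ : ↥(U : Set (TreeVertex d)) → Fin k => key (glue U φ₀ σ)
  filter_upwards [key'] with φ hφ
  have h1 := hφ fun v => φ v
  have h2 : ∀ v ∈ U, glue U φ₀ (fun v => φ v) v = φ v := fun v hv => glue_restrict U φ₀ φ hv
  have h3 : ∀ v ∈ bdry U, glue U φ₀ (fun v => φ v) v = φ v := fun v hv => h2 v (bdry_subset U hv)
  rw [cyl_congr h2, cyl_congr h3, wt_congr h2, wtSum_congr h3,
    Set.indicator_of_mem (show φ ∈ cyl (bdry U) φ from fun _ _ => rfl)] at h1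
  rw [condProb_eq]
  exact h1.symm

/-- The Gibbs condition fixes the conditional probability `g` of the cylinder only at points of that
cylinder, where it is `γ`. But `{g ≠ γ}` belongs to the outer σ-algebra and meets the cylinder in a
null set, so `g = 0` almost everywhere on it. Hence `g ≤ γ` almost everywhere. -/
theorem IsGibbs.measureReal_cyl_le (hμ : IsGibbs k d w μ) (hw : 0 < w) (U : Finset (TreeVertex d))
    (φ : Config k d) :
    μ.real (cyl U φ) ≤ wt w U φ / wtSum w U φ * μ.real (cyl (bdry U) φ) := by
  have := hμ.isProbabilityMeasure
  set m := cylinderEvents (X := fun _ : TreeVertex d => Fin k)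
          (interior (regularTree d) (U : Set (TreeVertex d)))ᶜ with hm
  have hm0 : m ≤ MeasurableSpace.pi := cylinderEvents_le_pi
  set f : Config k d → ℝ := (cyl U φ).indicator (fun _ => (1 : ℝ)) with hf
  set g : Config k d → ℝ := μ[f | m] with hg
  set γ := wt w U φ / wtSum w U φ with hγ
  have hγ0 : 0 < γ := div_pos (wt_pos hw _ _) (wtSum_pos hw _ _)
  have hfi : Integrable f μ := (integrable_const _).indicator (measurableSet_cyl _ _)
  have hG : MeasurableSet[m] (cyl (bdry U) φ) :=
    measurableSet_cyl_cylinderEvents (fun v hv => mem_compl_interior.2 (Or.inl hv)) φ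
  have hgm : Measurable[m] g := stronglyMeasurable_condExp.measurable
  have hg0 : 0 ≤ᵐ[μ] g := condExp_nonneg (Filter.Eventually.of_forall fun ψ =>
    Set.indicator_nonneg (fun _ _ => zero_le_one) ψ)
  have hgγ : ∀ᵐ ψ ∂μ, ψ ∈ cyl U φ → g ψ = γ := by
    filter_upwards [hμ.gibbs U] with ψ hψ hψU
    have h3 : ∀ v ∈ bdry U, ψ v = φ v := fun v hv => hψU v (bdry_subset U hv)
    have h4 : {ψ' : Config k d | ∀ v ∈ U, ψ' v = ψ v} = cyl U φ := cyl_congr hψU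
    rw [condProb_eq, wt_congr hψU, wtSum_congr h3, h4] at hψ
    exact hψ
  have hN : MeasurableSet[m] (g ⁻¹' {γ}ᶜ) := hgm (measurableSet_singleton _).compl
  have hNint : ∫ ψ in g ⁻¹' {γ}ᶜ, g ψ ∂μ = 0 := by
    rw [setIntegral_condExp hm0 hfi hN, integral_indicator (measurableSet_cyl _ _),
      Measure.restrict_restrict (measurableSet_cyl _ _), setIntegral_const, smul_eq_mul, mul_one,
      measureReal_eq_zero_iff]
    refine measure_mono_null (t := {ψ | ¬ (ψ ∈ cyl U φ → g ψ = γ)}) ?_ hgγ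
    rintro ψ ⟨h1, h2⟩ h3
    exact h2 (h3 h1)
  have hle : ∀ᵐ ψ ∂μ, g ψ ≤ γ := by
    rw [setIntegral_eq_zero_iff_of_nonneg_ae (ae_restrict_of_ae hg0)
      integrable_condExp.integrableOn, Filter.EventuallyEq, ae_restrict_iff' (hm0 _ hN)] at hNint
    filter_upwards [hNint] with ψ hψ
    by_cases h : g ψ = γ
    · exact h.le
    · rw [hψ h]
      exact hγ0.le
  calc μ.real (cyl U φ) = ∫ ψ in cyl (bdry U) φ, f ψ ∂μ := by
        rw [integral_indicator (measurableSet_cyl _ _),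
          Measure.restrict_restrict (measurableSet_cyl _ _), setIntegral_const, smul_eq_mul,
          mul_one, Set.inter_eq_left.2 (cyl_anti (bdry_subset U) φ)]
    _ = ∫ ψ in cyl (bdry U) φ, g ψ ∂μ := (setIntegral_condExp hm0 hfi hG).symm
    _ ≤ ∫ ψ in cyl (bdry U) φ, γ ∂μ :=
        setIntegral_mono_ae integrable_condExp.integrableOn (integrable_const _).integrableOn hle
    _ = γ * μ.real (cyl (bdry U) φ) := by rw [setIntegral_const, smul_eq_mul, mul_comm]

/-- Summed over all colourings of `U` with the given boundary values, both sides of the inequality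
have the same total, so equality holds term by term. -/
theorem IsGibbs.measureReal_cyl (hμ : IsGibbs k d w μ) (hw : 0 < w) (U : Finset (TreeVertex d))
    (φ : Config k d) :
    μ.real (cyl U φ) = wt w U φ / wtSum w U φ * μ.real (cyl (bdry U) φ) := by
  classical
  have := hμ.isProbabilityMeasure
  have h1 := measureReal_cyl_inter_eq_sum μ (bdry_subset U) φ Set.univ
  simp only [Set.inter_univ] at h1
  have h2 : ∑ σ : ↥(U : Set (TreeVertex d)) → Fin k with (∀ v ∈ bdry U, glue U φ σ v = φ v),
      wt w U (glue U φ σ) / wtSum w U φ * μ.real (cyl (bdry U) φ) = μ.real (cyl (bdry U) φ) := by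
    rw [← Finset.sum_mul, ← Finset.sum_div]
    have h3 : (wtSum w U φ / wtSum w U φ) * μ.real (cyl (bdry U) φ) = μ.real (cyl (bdry U) φ) := by
      rw [div_self (wtSum_pos hw U φ).ne', one_mul]
    convert h3
    unfold wtSum
    congr!
  have h4 := (Finset.sum_eq_sum_iff_of_le (s := Finset.univ.filter
    fun σ : ↥(U : Set (TreeVertex d)) → Fin k => ∀ v ∈ bdry U, glue U φ σ v = φ v)
    (f := fun σ => μ.real (cyl U (glue U φ σ)))
    (g := fun σ => wt w U (glue U φ σ) / wtSum w U φ * μ.real (cyl (bdry U) φ)) ?_).1 ?_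
    (fun v => φ v) ?_
  · have h5 : ∀ v ∈ U, glue U φ (fun v => φ v) v = φ v := fun v hv => glue_restrict U φ φ hv
    rwa [cyl_congr h5, wt_congr h5] at h4
  · intro σ hσ
    simp only [Finset.mem_filter, Finset.mem_univ, true_and] at hσ
    refine (hμ.measureReal_cyl_le hw U _).trans_eq ?_
    rw [wtSum_congr hσ, cyl_congr hσ]
  · rw [h2, h1]
    congr!
  · simp only [Finset.mem_filter, Finset.mem_univ, true_and]
    exact fun v hv => glue_restrict U φ φ (bdry_subset U hv)

end Specification

end Potts

namespace Potts

/-! ### Existence of a Gibbs measure -/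

section Existence

variable {k d : ℕ} {w : ℝ}

theorem cyl_inter_cyl_eq {U W : Finset (TreeVertex d)} (hUW : U ⊆ W)
    {S : Finset (TreeVertex d)} (hS : ∀ v, v ∈ S ↔ v ∈ W ∧ (v ∈ bdry U ∨ v ∉ U))
    {τ ρ : Config k d} (h : ∀ v ∈ S, ρ v = τ v) : cyl U ρ ∩ cyl S τ = cyl W ρ := by
  rw [← cyl_congr h]
  ext ψ
  simp only [Set.mem_inter_iff, mem_cyl]
  constructor
  · rintro ⟨h1, h2⟩ v hv
    by_cases hvU : v ∈ U
    · exact h1 v hvU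
    · exact h2 v ((hS v).2 ⟨hv, Or.inr hvU⟩)
  · exact fun h1 => ⟨fun v hv => h1 v (hUW hv), fun v hv => h1 v ((hS v).1 hv).1⟩

theorem inner_mono {U W : Finset (TreeVertex d)} (h : U ⊆ W) : inner U ⊆ inner W := fun v hv => by
  rw [mem_inner] at hv ⊢
  exact ⟨h hv.1, hv.2.1, h hv.2.2⟩

/-- An edge inside `W` but not inside `U` has both ends in `S`: an end in `U` is a boundary vertex,
by virtue of this very edge. -/
theorem wt_eq_mul {U W : Finset (TreeVertex d)} (hUW : U ⊆ W)
    {S : Finset (TreeVertex d)} (hS : ∀ v, v ∈ S ↔ v ∈ W ∧ (v ∈ bdry U ∨ v ∉ U))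
    {τ ρ : Config k d} (h : ∀ v ∈ S, ρ v = τ v) :
    wt w W ρ = (∏ v ∈ inner W \ inner U, edgeFactor w τ v) * wt w U ρ := by
  rw [wt, wt, ← Finset.prod_sdiff (inner_mono hUW)]
  congr 1
  refine Finset.prod_congr rfl fun v hv => ?_
  rw [Finset.mem_sdiff, mem_inner, mem_inner] at hv
  obtain ⟨⟨h1, h2, h3⟩, h4⟩ := hv
  refine edgeFactor_congr (h _ ((hS _).2 ⟨h1, ?_⟩)) (h _ ((hS _).2 ⟨h3, ?_⟩))
  · by_cases hv : v ∈ U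
    · exact Or.inl (mem_bdry.2 ⟨hv, parent v, fun hp => h4 ⟨hv, h2, hp⟩, adj_parent h2⟩)
    · exact Or.inr hv
  · by_cases hv : parent v ∈ U
    · exact Or.inl (mem_bdry.2 ⟨hv, v, fun hp => h4 ⟨hp, h2, hv⟩, (adj_parent h2).symm⟩)
    · exact Or.inr hv

/-- Inside a ball containing `U` the weight factors into the edges of `U` and a part determined by
the colours off the interior. The latter cancels in conditional probabilities. -/
theorem isGibbs_of_measureReal_ball (hw : 0 < w) {μ : Measure (Config k d)}
    [IsProbabilityMeasure μ]
    (h : ∀ n, ∃ c, ∀ φ : Config k d, μ.real (cyl (ball d n) φ) = c * wt w (ball d n) φ) :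
    IsGibbs k d w μ := by
  classical
  refine isGibbs_of_local fun U φ s hs => ?_
  have hγ0 : 0 < wt w U φ / wtSum w U φ := div_pos (wt_pos hw _ _) (wtSum_pos hw _ _)
  set γ := wt w U φ / wtSum w U φ with hγ
  have hs0 : MeasurableSet s := cylinderEvents_le_pi _ hs
  have hfin := Measure.smul_finite (μ.restrict (cyl (bdry U) φ)) (ENNReal.ofReal_ne_top (r := γ))
  have key := measure_eq_of_cyl (μ := μ.restrict (cyl U φ))
    (ν := ENNReal.ofReal γ • μ.restrict (cyl (bdry U) φ)) (fun T hT => ?_) hs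
  · rw [Measure.smul_apply, Measure.restrict_apply hs0, Measure.restrict_apply hs0,
      Set.inter_comm s, Set.inter_comm s] at key
    rw [measureReal_def, key, smul_eq_mul, ENNReal.toReal_mul, ENNReal.toReal_ofReal hγ0.le,
      measureReal_def]
  · obtain ⟨n, hn⟩ := exists_subset_ball (T ∪ U)
    have hUn : U ⊆ ball d n := Finset.union_subset_right hn
    obtain ⟨c, hc⟩ := h n
    set S := (ball d n).filter fun v => v ∈ bdry U ∨ v ∉ U with hSdef
    have hS : ∀ v, v ∈ S ↔ v ∈ ball d n ∧ (v ∈ bdry U ∨ v ∉ U) := fun v => Finset.mem_filter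
    refine ⟨S, fun v hv => (hS v).2 ⟨hn (Finset.mem_union_left _ hv),
      mem_compl_interior.1 (hT hv)⟩, fun τ => ?_⟩
    have hbS : bdry U ⊆ S := fun v hv => (hS v).2 ⟨hUn (bdry_subset U hv), Or.inl hv⟩
    rw [measureReal_restrict_apply (measurableSet_cyl _ _), measureReal_def,
      measureReal_ennreal_smul_apply, ENNReal.toReal_ofReal hγ0.le,
      measureReal_restrict_apply (measurableSet_cyl _ _), ← measureReal_def]
    by_cases hτ : ∀ v ∈ bdry U, τ v = φ v
    · have hval : ∀ ρ : Config k d, (∀ v ∈ S, ρ v = τ v) → μ.real (cyl U ρ ∩ cyl S τ) =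
          c * (∏ v ∈ inner (ball d n) \ inner U, edgeFactor w τ v) * wt w U ρ := by
        intro ρ hρ
        rw [cyl_inter_cyl_eq hUn hS hρ, hc, wt_eq_mul hUn hS hρ, mul_assoc]
      have hglue : ∀ σ : ↥(U : Set (TreeVertex d)) → Fin k,
          (∀ v ∈ bdry U, glue U τ σ v = τ v) → ∀ v ∈ S, glue U τ σ v = τ v := by
        intro σ hσ v hv
        rcases ((hS v).1 hv).2 with h | h
        · exact hσ v h
        · exact glue_of_notMem _ _ h
      have hρ := hglue (fun v => φ v) fun v hv => by
        rw [glue_restrict _ _ _ (bdry_subset U hv), hτ v hv]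
      have h1 := hval _ hρ
      have h2 : ∀ v ∈ U, glue U τ (fun v => φ v) v = φ v := fun v hv => glue_restrict U τ φ hv
      rw [cyl_congr h2, wt_congr h2] at h1
      rw [Set.inter_comm, h1, Set.inter_comm, ← cyl_congr hτ,
        measureReal_cyl_inter_eq_sum μ (bdry_subset U) τ]
      have h3 : ∑ σ : ↥(U : Set (TreeVertex d)) → Fin k with (∀ v ∈ bdry U, glue U τ σ v = τ v),
          μ.real (cyl U (glue U τ σ) ∩ cyl S τ) =
          c * (∏ v ∈ inner (ball d n) \ inner U, edgeFactor w τ v) * wtSum w U φ := by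
        rw [← wtSum_congr hτ, wtSum, Finset.mul_sum]
        refine Finset.sum_congr (by congr!) fun σ hσ => hval _ (hglue σ ?_)
        simpa using hσ
      have h4 := (wtSum_pos hw U φ).ne'
      trans γ * (c * (∏ v ∈ inner (ball d n) \ inner U, edgeFactor w τ v) * wtSum w U φ)
      · rw [hγ]
        field_simp
      · rw [← h3]
        congr!
    · have h1 : cyl S τ ∩ cyl (bdry U) φ = ∅ := by
        rw [Set.eq_empty_iff_forall_notMem]
        rintro ψ ⟨h1, h2⟩
        exact hτ fun v hv => (h1 v (hbS hv)).symm.trans (h2 v hv)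
      have h2 : cyl S τ ∩ cyl U φ = ∅ := Set.subset_empty_iff.1
        (h1 ▸ Set.inter_subset_inter_right _ (cyl_anti (bdry_subset U) φ))
      rw [h1, h2, measureReal_empty, mul_zero]

theorem exists_measure_singleton {p : Fin k → ℝ} (hp0 : ∀ c, 0 ≤ p c) (hp : ∑ c, p c = 1) :
    ∃ m : Measure (Fin k), IsProbabilityMeasure m ∧ ∀ c, m {c} = ENNReal.ofReal (p c) := by
  refine ⟨(PMF.ofFintype (fun c => ENNReal.ofReal (p c)) ?_).toMeasure, inferInstance, fun c => ?_⟩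
  · rw [← ENNReal.ofReal_sum_of_nonneg fun c _ => hp0 c, hp, ENNReal.ofReal_one]
  · rw [PMF.toMeasure_apply_singleton _ _ (measurableSet_singleton c), PMF.ofFintype_apply]

/-- The configuration with prescribed increments along the edges of the tree. -/
def integrate (ξ : Config k d) : Config k d
  | none => ξ none
  | some (i, []) => ξ none + ξ (some (i, []))
  | some (i, j :: l) => integrate ξ (some (i, l)) + ξ (some (i, j :: l))
termination_by v => depth v
decreasing_by simp [depth]

theorem integrate_of_ne_none (ξ : Config k d) {v : TreeVertex d} (hv : v ≠ none) :
    integrate ξ v = integrate ξ (parent v) + ξ v := by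
  match v, hv with
  | some (i, []), _ => simp only [integrate, parent]
  | some (i, j :: l), _ => simp only [integrate, parent]

theorem measurable_integrate : Measurable (integrate : Config k d → Config k d) := by
  rw [measurable_pi_iff]
  intro v
  induction hn : depth v generalizing v with
  | zero =>
    rw [depth_eq_zero] at hn
    subst hn
    simp only [integrate]
    exact measurable_pi_apply _
  | succ n ih =>
    have hv : v ≠ none := fun h => by simp [h, depth] at hn
    simp only [integrate_of_ne_none _ hv]
    have := depth_parent hv
    exact (measurable_of_countable fun x : Fin k × Fin k => x.1 + x.2).comp
      ((ih (parent v) (by omega)).prodMk (measurable_pi_apply v))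

theorem integrate_preimage_cyl [NeZero k] (n : ℕ) (φ : Config k d) :
    integrate ⁻¹' cyl (ball d n) φ = Set.pi (ball d n : Set (TreeVertex d))
      fun v => {if v = none then φ v else φ v - φ (parent v)} := by
  ext ξ
  simp only [Set.mem_preimage, mem_cyl, Set.mem_pi, Finset.mem_coe, Set.mem_singleton_iff]
  constructor
  · intro h v hv
    split_ifs with h0
    · rw [← h v hv, h0]
      simp only [integrate]
    · rw [← h v hv, ← h (parent v), integrate_of_ne_none ξ h0, add_sub_cancel_left]
      rw [mem_ball] at hv ⊢
      exact (depth_parent_le v).trans hv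
  · intro h v
    induction hm : depth v generalizing v with
    | zero =>
      rw [depth_eq_zero] at hm
      subst hm
      intro hv
      simpa [integrate] using h none hv
    | succ m ih =>
      intro hv
      have h0 : v ≠ none := fun h => by simp [h, depth] at hm
      have h1 := depth_parent h0
      have h2 := h v hv
      rw [if_neg h0] at h2
      rw [integrate_of_ne_none _ h0, h2, ih (parent v) (by omega), add_sub_cancel]
      rw [mem_ball] at hv ⊢
      omega

/-- The free measure: a uniform colour at the root and independent increments in `Fin k`, taken
modulo `k`, along the edges, with increment `0` of weight `w` and all others of weight `1`. Each
edge then contributes `edgeFactor / (w + k - 1)`. -/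
theorem exists_isGibbs (hk : 2 ≤ k) (hw : 0 < w) : ∃ μ : Measure (Config k d), IsGibbs k d w μ := by
  have : NeZero k := ⟨by omega⟩
  have hk' : (2 : ℝ) ≤ k := by exact_mod_cast hk
  have hden : 0 < w + k - 1 := by linarith
  obtain ⟨m₀, hm₀, hm₀'⟩ := exists_measure_singleton (k := k) (p := fun _ => 1 / (k : ℝ))
    (fun _ => by positivity) (by
      rw [Finset.sum_const, Finset.card_univ, Fintype.card_fin, nsmul_eq_mul]
      field_simp)
  obtain ⟨m₁, hm₁, hm₁'⟩ := exists_measure_singleton (k := k)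
    (p := fun c => (if c = 0 then w else 1) / (w + k - 1))
    (fun _ => div_nonneg (by split_ifs <;> linarith) hden.le) (by
      rw [← Finset.sum_div, div_eq_one_iff_eq hden.ne', ← Finset.add_sum_erase _ _ (Finset.mem_univ 0),
        if_pos rfl, Finset.sum_congr rfl (g := fun _ => (1 : ℝ))
        (fun c hc => if_neg (Finset.ne_of_mem_erase hc)), Finset.sum_const,
        Finset.card_erase_of_mem (Finset.mem_univ _), Finset.card_univ, Fintype.card_fin,
        nsmul_eq_mul, mul_one, Nat.cast_sub (by omega), Nat.cast_one]
      ring)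
  let m : TreeVertex d → Measure (Fin k) := fun v => if v = none then m₀ else m₁
  have hm : ∀ v, IsProbabilityMeasure (m v) := fun v => by
    simp only [m]
    split_ifs <;> assumption
  refine ⟨(Measure.infinitePi m).map integrate, ?_⟩
  have := Measure.isProbabilityMeasure_map (μ := Measure.infinitePi m)
    (measurable_integrate (k := k) (d := d)).aemeasurable
  refine isGibbs_of_measureReal_ball hw fun n => ?_
  refine ⟨1 / k * ∏ v ∈ (ball d n).erase none, (1 / (w + k - 1)), fun φ => ?_⟩
  have hnone : (none : TreeVertex d) ∈ ball d n := mem_ball.2 (Nat.zero_le n)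
  rw [map_measureReal_apply measurable_integrate (measurableSet_cyl _ _), integrate_preimage_cyl,
    measureReal_def, Measure.infinitePi_pi _ (fun _ _ => measurableSet_singleton _),
    ENNReal.toReal_prod, ← Finset.mul_prod_erase _ _ hnone, wt, inner_ball, mul_assoc,
    ← Finset.prod_mul_distrib]
  congr 1
  · simp only [m, if_true]
    rw [hm₀', ENNReal.toReal_ofReal (by positivity)]
  · refine Finset.prod_congr rfl fun v hv => ?_
    simp only [m, if_neg (Finset.ne_of_mem_erase hv)]
    rw [hm₁', ENNReal.toReal_ofReal (div_nonneg (by split_ifs <;> linarith) hden.le), edgeFactor,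
      one_div_mul_eq_div]
    simp only [sub_eq_zero]

end Existence

end Potts

namespace Potts

/-! ### Uniqueness of the Gibbs measure -/

section Uniqueness

variable {k d : ℕ} {w : ℝ} {μ : Measure (Config k d)}

open Classical in
theorem sum_prod_glue {V : Type*} (S : Finset V) (φ : V → Fin k) (h : V → Fin k → ℝ) :
    ∑ σ : ↥(S : Set V) → Fin k, ∏ v ∈ S, h v (glue S φ σ v) = ∏ v ∈ S, ∑ c, h v c := by
  have h1 : ∀ f : V → ℝ, ∏ v ∈ S, f v = ∏ v : ↥(S : Set V), f v := fun f =>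
    (Finset.prod_coe_sort S f).symm
  rw [h1, Finset.prod_univ_sum, Fintype.piFinset_univ]
  refine Finset.sum_congr rfl fun σ _ => ?_
  rw [h1]
  refine Finset.prod_congr rfl fun v _ => ?_
  rw [glue_of_mem _ _ v.2]

theorem ball_succ (n : ℕ) : ball d (n + 1) = ball d n ∪ layer d (n + 1) := by
  ext v
  simp only [mem_ball, Finset.mem_union, mem_layer]
  omega

theorem wt_ball_succ {n : ℕ} {φ ρ : Config k d} (h : ∀ v ∈ ball d n, ρ v = φ v) :
    wt w (ball d (n + 1)) ρ =
      wt w (ball d n) φ * ∏ u ∈ layer d (n + 1), if ρ u = φ (parent u) then w else 1 := by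
  rw [← wt_congr h, wt, wt, inner_ball, inner_ball, ball_succ, Finset.erase_union_distrib,
    Finset.erase_eq_of_notMem (s := layer d (n + 1)), Finset.prod_union]
  · congr 1
    refine Finset.prod_congr rfl fun u hu => ?_
    rw [edgeFactor, h (parent u)]
    rw [mem_layer] at hu
    rw [mem_ball]
    have hu0 : u ≠ none := fun h => by simp [h, depth] at hu
    have := depth_parent hu0
    omega
  · rw [Finset.disjoint_left]
    intro v hv hv'
    rw [Finset.mem_erase, mem_ball] at hv
    rw [mem_layer] at hv'
    omega
  · rw [mem_layer]
    simp [depth]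

theorem sum_ite_mul (z : Fin k → ℝ) (b : Fin k) :
    ∑ c, (if c = b then w else 1) * z c = ∑ c, z c - (1 - w) * z b := by
  have : ∀ c, (if c = b then w else 1) * z c = z c - if c = b then (1 - w) * z c else 0 := by
    intro c
    split_ifs <;> ring
  simp only [this, Finset.sum_sub_distrib, Finset.sum_ite_eq', Finset.mem_univ, if_true]

theorem layer_ne_none {n : ℕ} (hn : n ≠ 0) {v : TreeVertex d} (hv : v ∈ layer d n) : v ≠ none := by
  rintro rfl
  exact hn (mem_layer.1 hv).symm

/-- With the colours at depth `N + m` fixed, summing out the layers between factorizes over the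
subtrees at depth `N`; each layer removed is one `treeStep`. The induction on `m` lets `N` vary. The
condition `N ≠ 0` ensures that each vertex of the layer has `d` children. -/
theorem IsGibbs.exists_reach (hμ : IsGibbs k d w μ) (hw : 0 < w) (hd : 0 < d) (τ : Config k d)
    (m : ℕ) : ∀ N, N ≠ 0 → ∃ κ, 0 ≤ κ ∧ ∃ Z : TreeVertex d → Fin k → ℝ,
      (∀ v ∈ layer d N, Z v ∈ reach k d (1 - w) m) ∧ ∀ φ : Config k d,
        μ.real (cyl (ball d N) φ ∩ cyl (layer d (N + m)) τ) =
          κ * wt w (ball d N) φ * ∏ v ∈ layer d N, Z v (φ v) := by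
  classical
  have := hμ.isProbabilityMeasure
  induction m with
  | zero =>
    intro N hN
    refine ⟨μ.real (cyl (layer d N) τ) / wtSum w (ball d N) τ,
      div_nonneg measureReal_nonneg (wtSum_pos hw _ _).le,
      fun v c => if c = τ v then 1 else 0, fun v _ => ⟨fun c => ?_, ?_⟩, fun φ => ?_⟩
    · dsimp only
      split_ifs <;> norm_num
    · simp
    · rw [add_zero]
      by_cases h : ∀ v ∈ layer d N, φ v = τ v
      · have hb : ∀ v ∈ bdry (ball d N), φ v = τ v := by rwa [bdry_ball hd]
        rw [Finset.prod_congr rfl fun v hv => if_pos (h v hv), Finset.prod_const_one, mul_one,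
          Set.inter_eq_left.2, hμ.measureReal_cyl hw, bdry_ball hd, wtSum_congr hb, cyl_congr h]
        · ring
        · rw [← cyl_congr h]
          exact cyl_anti (Finset.filter_subset _ _) φ
      · have h1 : cyl (ball d N) φ ∩ cyl (layer d N) τ = ∅ := by
          rw [Set.eq_empty_iff_forall_notMem]
          rintro ψ ⟨h1, h2⟩
          exact h fun v hv => (h1 v (Finset.filter_subset _ _ hv)).symm.trans (h2 v hv)
        push Not at h
        obtain ⟨v, hv, hne⟩ := h
        rw [h1, measureReal_empty, Finset.prod_eq_zero hv (if_neg hne), mul_zero]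
  | succ m ih =>
    intro N hN
    obtain ⟨κ, hκ, Z, hZ, hval⟩ := ih (N + 1) N.succ_ne_zero
    refine ⟨κ, hκ, fun v => treeStep (1 - w) fun j => Z (child v j), fun v hv => ?_, fun φ => ?_⟩
    · refine ⟨fun j => Z (child v j), fun j => hZ _ ?_, rfl⟩
      rw [mem_layer, depth_child (layer_ne_none hN hv), mem_layer.1 hv]
    · have hglue : ∀ χ, ∀ v ∈ ball d N, glue (layer d (N + 1)) φ χ v = φ v := by
        intro χ v hv
        refine glue_of_notMem _ _ fun h => ?_
        rw [mem_ball] at hv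
        rw [mem_layer] at h
        omega
      have hcyl : ∀ χ, cyl (layer d (N + 1)) (glue (layer d (N + 1)) φ χ) ∩ cyl (ball d N) φ =
          cyl (ball d (N + 1)) (glue (layer d (N + 1)) φ χ) := by
        intro χ
        rw [← cyl_congr (hglue χ), ball_succ]
        ext ψ
        simp only [Set.mem_inter_iff, mem_cyl, Finset.mem_union]
        exact ⟨fun h v hv => hv.elim (h.2 v) (h.1 v),
          fun h => ⟨fun v hv => h v (Or.inr hv), fun v hv => h v (Or.inl hv)⟩⟩
      rw [measureReal_eq_sum_glue μ (layer d (N + 1)) φ]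
      have hterm : ∀ χ, μ.real (cyl (layer d (N + 1)) (glue (layer d (N + 1)) φ χ) ∩
          (cyl (ball d N) φ ∩ cyl (layer d (N + (m + 1))) τ)) =
          κ * wt w (ball d N) φ * ∏ u ∈ layer d (N + 1),
            ((if glue (layer d (N + 1)) φ χ u = φ (parent u) then w else 1) *
              Z u (glue (layer d (N + 1)) φ χ u)) := by
        intro χ
        rw [← Set.inter_assoc, hcyl, show N + (m + 1) = N + 1 + m by ring, hval,
          wt_ball_succ (hglue χ), Finset.prod_mul_distrib]
        ring
      rw [Finset.sum_congr rfl fun χ _ => hterm χ, ← Finset.mul_sum,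
        sum_prod_glue _ φ fun u c => (if c = φ (parent u) then w else 1) * Z u c]
      simp only [sum_ite_mul]
      rw [prod_layer_succ hN]
      congr 1
      refine Finset.prod_congr rfl fun v hv => ?_
      simp only [parent_child (layer_ne_none hN hv), treeStep]

/-- For any distant boundary condition, the influence on the ball is a product of entries whose
ratios are at most `C`, over a layer of fixed size. Averaging over the boundary and letting `C` tend
to `1` removes the influence. -/
theorem IsGibbs.mul_wt_le (hμ : IsGibbs k d w μ) (hkd : (k = 3 ∧ 2 ≤ d) ∨ (k = 4 ∧ 4 ≤ d))
    (hw0 : 0 < w) (hw1 : w < 1) (hw : (1 - w) * (d + 1) ≤ k) {N : ℕ} (hN : N ≠ 0)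
    (φ φ' : Config k d) :
    μ.real (cyl (ball d N) φ) * wt w (ball d N) φ' ≤
      μ.real (cyl (ball d N) φ') * wt w (ball d N) φ := by
  classical
  have := hμ.isProbabilityMeasure
  have hd : 0 < d := by omega
  have hC : ∀ C : ℝ, 1 < C → μ.real (cyl (ball d N) φ) * wt w (ball d N) φ' ≤
      C ^ (layer d N).card * (μ.real (cyl (ball d N) φ') * wt w (ball d N) φ) := by
    intro C hC
    obtain ⟨m, hm⟩ := exists_reach_subset_ratioSet hkd (sub_pos.2 hw1)
      (by linarith : 1 - w < 1) hw hC
    rw [measureReal_eq_sum_glue μ (layer d (N + m)) φ (cyl (ball d N) φ),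
      measureReal_eq_sum_glue μ (layer d (N + m)) φ (cyl (ball d N) φ'), Finset.sum_mul,
      Finset.sum_mul, Finset.mul_sum]
    refine Finset.sum_le_sum fun σ _ => ?_
    obtain ⟨κ, hκ, Z, hZ, hval⟩ :=
      hμ.exists_reach hw0 hd (glue (layer d (N + m)) φ σ) m N hN
    rw [Set.inter_comm, hval, Set.inter_comm, hval]
    have hle : ∏ v ∈ layer d N, Z v (φ v) ≤
        C ^ (layer d N).card * ∏ v ∈ layer d N, Z v (φ' v) := by
      rw [← Finset.prod_const, ← Finset.prod_mul_distrib]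
      exact Finset.prod_le_prod (fun v hv => ((hm (hZ v hv)).1 _).le)
        fun v hv => (hm (hZ v hv)).2 _ _
    have h0 : 0 ≤ κ * wt w (ball d N) φ * wt w (ball d N) φ' :=
      mul_nonneg (mul_nonneg hκ (wt_pos hw0 _ _).le) (wt_pos hw0 _ _).le
    calc _ = κ * wt w (ball d N) φ * wt w (ball d N) φ' * ∏ v ∈ layer d N, Z v (φ v) := by ring
      _ ≤ _ := mul_le_mul_of_nonneg_left hle h0
      _ = _ := by ring
  have hlim : Filter.Tendsto (fun C : ℝ => C ^ (layer d N).card *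
      (μ.real (cyl (ball d N) φ') * wt w (ball d N) φ)) (nhdsWithin 1 (Set.Ioi 1))
      (nhds (1 ^ (layer d N).card * (μ.real (cyl (ball d N) φ') * wt w (ball d N) φ))) :=
    (Continuous.tendsto (by fun_prop) 1).mono_left nhdsWithin_le_nhds
  rw [one_pow, one_mul] at hlim
  exact ge_of_tendsto hlim (eventually_nhdsWithin_of_forall hC)

-- Swapping the two colourings in `IsGibbs.mul_wt_le` gives proportionality to `wt`; total mass `1`
-- fixes the constant.
open Classical in
theorem IsGibbs.measureReal_ball (hμ : IsGibbs k d w μ)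
    (hkd : (k = 3 ∧ 2 ≤ d) ∨ (k = 4 ∧ 4 ≤ d)) (hw0 : 0 < w) (hw1 : w < 1)
    (hw : (1 - w) * (d + 1) ≤ k) {N : ℕ} (hN : N ≠ 0) (φ : Config k d) :
    μ.real (cyl (ball d N) φ) = wt w (ball d N) φ /
      ∑ σ : ↥(ball d N : Set (TreeVertex d)) → Fin k, wt w (ball d N) (glue (ball d N) φ σ) := by
  have := hμ.isProbabilityMeasure
  have hsum := measureReal_eq_sum_glue μ (ball d N) φ Set.univ
  simp only [Set.inter_univ, probReal_univ] at hsum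
  rw [eq_div_iff, Finset.mul_sum]
  · rw [Finset.sum_congr rfl fun σ _ => le_antisymm
      (hμ.mul_wt_le hkd hw0 hw1 hw hN φ (glue (ball d N) φ σ))
      (hμ.mul_wt_le hkd hw0 hw1 hw hN (glue (ball d N) φ σ) φ), ← Finset.sum_mul]
    convert one_mul _
    rw [hsum]
    congr!
  · exact (Finset.sum_pos (fun _ _ => wt_pos hw0 _ _)
      ⟨fun v : ↥(ball d N : Set (TreeVertex d)) => φ v, Finset.mem_univ _⟩).ne'

theorem IsGibbs.eq {ν : Measure (Config k d)} (hμ : IsGibbs k d w μ) (hν : IsGibbs k d w ν)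
    (hkd : (k = 3 ∧ 2 ≤ d) ∨ (k = 4 ∧ 4 ≤ d)) (hw0 : 0 < w) (hw1 : w < 1)
    (hw : (1 - w) * (d + 1) ≤ k) : μ = ν := by
  have := hμ.isProbabilityMeasure
  have := hν.isProbabilityMeasure
  refine Measure.ext fun s hs => measure_eq_of_cyl (Δ := Set.univ) (fun T _ => ?_)
    (by rwa [cylinderEvents_univ])
  obtain ⟨n, hn⟩ := exists_subset_ball T
  refine ⟨ball d (n + 1), hn.trans (ball_mono n.le_succ), fun τ => ?_⟩
  rw [hμ.measureReal_ball hkd hw0 hw1 hw n.succ_ne_zero,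
    hν.measureReal_ball hkd hw0 hw1 hw n.succ_ne_zero]

end Uniqueness

end Potts

theorem theorem3 (k d : ℕ) (w : ℝ) (hkd : (k = 3 ∧ 2 ≤ d) ∨ (k = 4 ∧ 4 ≤ d))
    (hw0 : 0 < w) (hw1 : w < 1) (hw : 1 - (k : ℝ) / ((d : ℝ) + 1) ≤ w) :
    ∃! μ : MeasureTheory.Measure (Potts.Config k d), Potts.IsGibbs k d w μ := by
  have hw' : (1 - w) * (d + 1) ≤ k := by
    rw [← le_div_iff₀ (by positivity)]
    linarith
  obtain ⟨μ, hμ⟩ := Potts.exists_isGibbs (k := k) (d := d) (by omega) hw0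
  exact ⟨μ, hμ, fun ν hν => hν.eq hμ hkd hw0 hw1 hw'⟩
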